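/- **Setting.** For $n\in\mathbb N$ let $\mathcal H_n$ be the Haar distribution on $n$-qubit pure states (the unitarily invariant probability measure on the unit sphere of $(\mathbb C^2)^{\otimes n}$), and let $\mathsf{TD}(\rho,\sigma)=\tfrac12\|\rho-\sigma\|_1$ be the trace distance. Let $m,n,\ell:\mathbb N\to\mathbb N$. In the common Haar state (CHS) model, a *statistical selectively secure $(\lambda,m,n,\ell)$-PRFS generator* is a quantum polynomial-time algorithm $G$ (a polynomial-time Turing machine computes from the classical input $(k,x)$ a circuit over $\{H,T,\mathrm{CNOT}\}$, with ancillas, that is run on the quantum input) such that * for all $\lambda$, $k\in\{0,1\}^\lambda$, $x\in\{0,1\}^{m(\lambda)}$, the map $G_{k,x}$ is a quantum channel on $n(\lambda)$ qubits that maps pure states to pure states; * for every polynomially bounded $t:\mathbb N\to\mathbb N$, every non-uniform computationally unbounded adversary $A=\{A_\lambda\}$ (a two-outcome measurement for each $\lambda$, which may depend on the queries), and all queries $x_1,\dots,x_{\ell(\lambda)}\in\{0,1\}^{m(\lambda)}$ (possibly repeated, chosen for each $\lambda$), there is a negligible function $\mathsf{negl}$ such that for all $\lambda$ $$\Big|\Pr_{k\gets\{0,1\}^\lambda,\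 |\vartheta\rangle\gets\mathcal H_{n(\lambda)}}\Big[A_\lambda\Big(x_1,\dots,x_{\ell(\lambda)},\bigotimes_{i=1}^{\ell(\lambda)}G_{k,x_i}(|\vartheta\rangle\langle\vartheta|)\otimes|\vartheta\rangle\langle\vartheta|^{\otimes t(\lambda)}\Big)=1\Big]-\Pr_{\substack{|\varphi_y\rangle\gets\mathcal H_{n(\lambda)},\ y\in\{0,1\}^{m(\lambda)}\\ |\vartheta\rangle\gets\mathcal H_{n(\lambda)}}}\Big[A_\lambda\Big(x_1,\dots,x_{\ell(\lambda)},\bigotimes_{i=1}^{\ell(\lambda)}|\varphi_{x_i}\rangle\langle\varphi_{x_i}|\otimes|\vartheta\rangle\langle\vartheta|^{\otimes t(\lambda)}\Big)=1\Big]\Big|\le\mathsf{negl}(\lambda).$$ **Construction.** For integers $m\ge1$ and $0\le\lambda'\le n$, a key $K=(k_1^0,\dots,k_m^0,k_1^1,\dots,k_m^1)\in\{0,1\}^{2m\lambda'}$ with blocks $k_i^b\in\{0,1\}^{\lambda'}$, and an input $x\in\{0,1\}^m$, let $G(K,x,\cdot)$ be conjugation by the unitary $Z^{\bigoplus_{i=1}^m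 k_i^{x_i}}\otimes I_{n-\lambda'}$ on $n$ qubits, where $Z^s=Z^{s_1}\otimes\cdots\otimes Z^{s_{\lambda'}}$. **Theorem.** 1. There is an absolute constant $C>0$ such that for all integers $m\ge1$, $0\le\lambda'\le n$, $\ell,t\ge0$ and all $x_1,\dots,x_\ell\in\{0,1\}^m$ (possibly repeated), $$\mathsf{TD}\Big(\mathbb E_{K\gets\{0,1\}^{2m\lambda'},\,|\vartheta\rangle\gets\mathcal H_n}\Big[\bigotimes_{i=1}^{\ell}G(K,x_i,|\vartheta\rangle\langle\vartheta|)\otimes|\vartheta\rangle\langle\vartheta|^{\otimes t}\Big],\ \mathbb E_{\substack{|\varphi_y\rangle\gets\mathcal H_n,\ y\in\{0,1\}^m\\ |\vartheta\rangle\gets\mathcal H_n}}\Big[\bigotimes_{i=1}^{\ell}|\varphi_{x_i}\rangle\langle\varphi_{x_i}|\otimes|\vartheta\rangle\langle\vartheta|^{\otimes t}\Big]\Big)\le C\,\frac{(\ell+t)^{2\ell}}{2^{\lambda'}}.$$ 2. Let $c\in[0,1)$, let $m(\lambda)=\lambda^c$ (rounded down or up to an integer), and let $n(\lambda)\ge\lambda^{1-c}$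 for all $\lambda$. Then there is a generator $G$ with keys of length $\lambda$, which uses one copy of the $n(\lambda)$-qubit common Haar state, such that for every $\varepsilon>0$ and every $\ell:\mathbb N\to\mathbb N$ with $\ell(\lambda)=O\big(\lambda^{1-c}/\log(\lambda)^{1+\varepsilon}\big)$, $G$ is a statistical selectively secure $(\lambda,m,n,\ell)$-PRFS generator in the CHS model. Moreover, $G$ can be taken to be the construction above with $\lambda'=\lfloor\lambda/(2m(\lambda))\rfloor\le n(\lambda)$, the blocks $k_1^0,\dots,k_m^0,k_1^1,\dots,k_m^1$ being the consecutive length-$\lambda'$ blocks of the first $2m(\lambda)\lambda'$ bits of the key. -/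

import Mathlib

open MeasureTheory Filter Asymptotics Computability
open scoped Kronecker BigOperators ComplexOrder

noncomputable section

namespace CHS

/-! ### Pure states, Haar measure, density matrices -/

/-- Bit strings of length `n`; they index the computational basis of `n` qubits. -/
abbrev Bits (n : ℕ) : Type := Fin n → Bool

/-- Operators (square complex matrices) on the space with basis `ι`. -/
abbrev Op (ι : Type) : Type := Matrix ι ι ℂ

/-- Unit vectors of the `n`-qubit space `(ℂ²)^{⊗n}`. -/
abbrev PureState (n : ℕ) : Type := Metric.sphere (0 : EuclideanSpace ℂ (Bits n)) 1

/-- The Haar distribution on `n`-qubit pure states: the normalized surface measure of the unit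
sphere (the unique unitarily invariant Borel probability measure on it). -/
def haar (n : ℕ) : Measure (PureState n) :=
  ((volume : Measure (EuclideanSpace ℂ (Bits n))).toSphere Set.univ)⁻¹ •
    (volume : Measure (EuclideanSpace ℂ (Bits n))).toSphere

instance haar_isProbabilityMeasure (n : ℕ) : IsProbabilityMeasure (haar n) := by
  have : NeZero (volume : Measure (EuclideanSpace ℂ (Bits n))).toSphere :=
    ⟨Measure.toSphere_ne_zero _⟩
  exact isProbabilityMeasureSMul

/-- The rank-one projection `|θ⟩⟨θ|`. -/
def ketbra {n : ℕ} (θ : PureState n) : Op (Bits n) :=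
  Matrix.vecMulVec (fun u => θ.1 u) (fun u => star (θ.1 u))

/-- The tensor product `⨂ᵢ ρᵢ` of a finite family of operators. -/
def tensorPi {ι κ : Type} [Fintype ι] (ρ : ι → Op κ) : Op (ι → κ) :=
  Matrix.of fun u v => ∏ i, ρ i (u i) (v i)

open scoped MatrixOrder in
/-- The trace norm `‖X‖₁ = Tr √(X† X)`. -/
def traceNorm {ι : Type} [Fintype ι] [DecidableEq ι] (X : Op ι) : ℝ :=
  (Matrix.trace (CFC.sqrt (X.conjTranspose * X))).re

/-- The trace distance. -/
def traceDist {ι : Type} [Fintype ι] [DecidableEq ι] (ρ σ : Op ι) : ℝ :=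
  traceNorm (ρ - σ) / 2

/-- Quantum channels: trace preserving linear maps all of whose ampliations `id_d ⊗ Φ` map
positive semidefinite operators to positive semidefinite operators. -/
def IsChannel {ι : Type} [Fintype ι] (Φ : Op ι →ₗ[ℂ] Op ι) : Prop :=
  (∀ ρ, (Φ ρ).trace = ρ.trace) ∧
  ∀ (d : ℕ) (X : Op (Fin d × ι)), X.PosSemidef →
    Matrix.PosSemidef (Matrix.of fun p q : Fin d × ι =>
      Φ (Matrix.of fun i j => X (p.1, i) (q.1, j)) p.2 q.2)

/-- The channel `ρ ↦ U ρ U†`. -/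
def conjBy {ι : Type} [Fintype ι] (U : Op ι) : Op ι →ₗ[ℂ] Op ι where
  toFun ρ := U * ρ * U.conjTranspose
  map_add' ρ σ := by rw [Matrix.mul_add, Matrix.add_mul]
  map_smul' a ρ := by simp

/-! ### Quantum circuits over the gate set {H, T, CNOT} -/

/-- A wire of a circuit: a qubit of the quantum input, or an ancilla qubit. -/
inductive Wire : Type
  | data (i : ℕ)
  | anc (j : ℕ)

inductive Gate : Type
  | H (w : Wire)
  | T (w : Wire)
  | CNOT (control target : Wire)

/-- A circuit: a number of ancilla qubits, initially `|0⟩`, and a list of gates in the order in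
which they are applied. -/
structure Circuit : Type where
  ancillas : ℕ
  gates : List Gate

/-- The qubit that a wire denotes, if there are `n` input qubits and `a` ancillas. -/
def Wire.resolve (n a : ℕ) : Wire → Option (Fin n ⊕ Fin a)
  | .data i => if h : i < n then some (.inl ⟨i, h⟩) else none
  | .anc j => if h : j < a then some (.inr ⟨j, h⟩) else none

/-- All wires exist, and the wires of a two-qubit gate differ. -/
def Gate.WellFormed (n a : ℕ) : Gate → Prop
  | .H w => (w.resolve n a).isSome
  | .T w => (w.resolve n a).isSome
  | .CNOT c t => (c.resolve n a).isSome ∧ (t.resolve n a).isSome ∧ c ≠ t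

def Circuit.WellFormed (n : ℕ) (C : Circuit) : Prop :=
  ∀ g ∈ C.gates, g.WellFormed n C.ancillas

def hadamard : Op Bool := Matrix.of fun a b => (if a && b then -1 else 1) / (Real.sqrt 2 : ℂ)

def tGate : Op Bool :=
  Matrix.diagonal fun b => if b then Complex.exp (Real.pi / 4 * Complex.I) else 1

/-- The one-qubit operator `M` on qubit `w`, the identity on the other qubits. -/
def onQubit {W : Type} [Fintype W] [DecidableEq W] (w : W) (M : Op Bool) : Op (W → Bool) :=
  tensorPi fun v => if v = w then M else 1

/-- The controlled-NOT, `|s⟩ ↦ |s with bit t replaced by s t ⊕ s c⟩`. -/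
def cnotOn {W : Type} [DecidableEq W] [Fintype W] (c t : W) : Op (W → Bool) :=
  Matrix.of fun s s' => if s = Function.update s' t (xor (s' t) (s' c)) then 1 else 0

/-- The unitary of a gate (the identity for gates that are not well-formed). -/
def Gate.op (n a : ℕ) : Gate → Op (Fin n ⊕ Fin a → Bool)
  | .H w => (w.resolve n a).elim 1 fun w => onQubit w hadamard
  | .T w => (w.resolve n a).elim 1 fun w => onQubit w tGate
  | .CNOT c t =>
      (c.resolve n a).elim 1 fun c => (t.resolve n a).elim 1 fun t => cnotOn c t

/-- The unitary of a list of gates, the head of the list being applied first. -/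
def gatesOp (n a : ℕ) (gs : List Gate) : Op (Fin n ⊕ Fin a → Bool) :=
  gs.foldl (fun U g => g.op n a * U) 1

/-- `ρ ⊗ |0…0⟩⟨0…0|`. -/
def withAncillas {n a : ℕ} (ρ : Op (Bits n)) : Op (Fin n ⊕ Fin a → Bool) :=
  Matrix.of fun s s' =>
    if (∀ j, s (.inr j) = false) ∧ (∀ j, s' (.inr j) = false) then
      ρ (fun i => s (.inl i)) (fun i => s' (.inl i)) else 0

/-- The partial trace over the ancillas. -/
def traceAncillas {n a : ℕ} (X : Op (Fin n ⊕ Fin a → Bool)) : Op (Bits n) :=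
  Matrix.of fun u v => ∑ w : Bits a, X (Sum.elim u w) (Sum.elim v w)

/-- Running a circuit on an `n`-qubit input. -/
def Circuit.run (n : ℕ) (C : Circuit) (ρ : Op (Bits n)) : Op (Bits n) :=
  traceAncillas (conjBy (gatesOp n C.ancillas C.gates) (withAncillas ρ))

/-! ### Description of circuits by strings -/

/-- The alphabet for descriptions of circuits. -/
inductive Sym : Type
  | tick | start | data | anc | h | t | cnot

/-- Wire numbers are written in unary. -/
def Wire.encode : Wire → List Sym
  | .data i => List.replicate i .tick ++ [.data]
  | .anc j => List.replicate j .tick ++ [.anc]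

def Gate.encode : Gate → List Sym
  | .H w => w.encode ++ [.h]
  | .T w => w.encode ++ [.t]
  | .CNOT c t => c.encode ++ t.encode ++ [.cnot]

def Circuit.encode (C : Circuit) : List Sym :=
  List.replicate C.ancillas .tick ++ [.start] ++ C.gates.flatMap Gate.encode

/-- State of the left-to-right reader of a description. -/
structure ReadState : Type where
  count : ℕ
  ancillas : ℕ
  wires : List Wire
  gates : List Gate

def ReadState.next (s : ReadState) : Sym → ReadState
  | .tick => { s with count := s.count + 1 }
  | .start => { s with count := 0, ancillas := s.count }
  | .data => { s with count := 0, wires := .data s.count :: s.wires }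
  | .anc => { s with count := 0, wires := .anc s.count :: s.wires }
  | .h => match s.wires with
    | w :: ws => { s with wires := ws, gates := s.gates ++ [.H w] }
    | [] => s
  | .t => match s.wires with
    | w :: ws => { s with wires := ws, gates := s.gates ++ [.T w] }
    | [] => s
  | .cnot => match s.wires with
    | t :: c :: ws => { s with wires := ws, gates := s.gates ++ [.CNOT c t] }
    | _ => s

def Circuit.decode (l : List Sym) : Circuit :=
  let s := l.foldl ReadState.next ⟨0, 0, [], []⟩
  ⟨s.ancillas, s.gates⟩

lemma read_ticks (i c a : ℕ) (ws : List Wire) (gs : List Gate) :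
    (List.replicate i Sym.tick).foldl ReadState.next ⟨c, a, ws, gs⟩ = ⟨c + i, a, ws, gs⟩ := by
  induction i generalizing c with
  | zero => rfl
  | succ i ih =>
    rw [List.replicate_succ, List.foldl_cons]
    exact (ih (c + 1)).trans (by congr 1; omega)

lemma read_wire (w : Wire) (a : ℕ) (ws : List Wire) (gs : List Gate) :
    w.encode.foldl ReadState.next ⟨0, a, ws, gs⟩ = ⟨0, a, w :: ws, gs⟩ := by
  cases w <;> simp [Wire.encode, read_ticks, ReadState.next]

lemma read_gate (g : Gate) (a : ℕ) (gs : List Gate) :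
    g.encode.foldl ReadState.next ⟨0, a, [], gs⟩ = ⟨0, a, [], gs ++ [g]⟩ := by
  cases g <;> simp [Gate.encode, read_wire, ReadState.next]

lemma read_gates (l : List Gate) (a : ℕ) (gs : List Gate) :
    (l.flatMap Gate.encode).foldl ReadState.next ⟨0, a, [], gs⟩ = ⟨0, a, [], gs ++ l⟩ := by
  induction l generalizing gs with
  | nil => simp
  | cons g l ih => simp [List.flatMap_cons, List.foldl_append, read_gate, ih]

lemma Circuit.decode_encode (C : Circuit) : Circuit.decode C.encode = C := by
  have h := read_ticks C.ancillas 0 0 [] []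
  simp [Circuit.decode, Circuit.encode, List.foldl_append, h, ReadState.next, read_gates]

/-- Circuits as strings over the alphabet `Sym`. -/
def circuitEncoding : Encoding Circuit Sym where
  encode := Circuit.encode
  decode l := some (Circuit.decode l)
  decode_encode C := congrArg some C.decode_encode

/-- Pairs of bit strings as strings. -/
def bitsPairEncoding : Encoding (List Bool × List Bool) (Bool ⊕ Bool) :=
  encodingProd (encodingList Bool) (encodingList Bool)

/-! ### Generators in the common Haar state model -/

/-- A generator with keys of length `lam`, inputs of length `m lam`, which acts on one copy of an
`n lam`-qubit common state and outputs `n lam` qubits. -/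
abbrev Generator (m n : ℕ → ℕ) : Type :=
  ∀ lam : ℕ, Bits lam → Bits (m lam) → (Op (Bits (n lam)) →ₗ[ℂ] Op (Bits (n lam)))

/-- Quantum polynomial time: one polynomial-time Turing machine writes down, from the key and the
classical input, a circuit that is then run on the quantum input. -/
def IsQPT {m n : ℕ → ℕ} (G : Generator m n) : Prop :=
  ∃ f : List Bool × List Bool → Circuit,
    Nonempty (Turing.TM2ComputableInPolyTime bitsPairEncoding.encode circuitEncoding.encode f) ∧
    ∀ (lam : ℕ) (k : Bits lam) (x : Bits (m lam)),
      (f (List.ofFn k, List.ofFn x)).WellFormed (n lam) ∧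
      ∀ ρ, G lam k x ρ = (f (List.ofFn k, List.ofFn x)).run (n lam) ρ

/-- `⨂ᵢ Φ_{xᵢ}(|θ⟩⟨θ|) ⊗ |θ⟩⟨θ|^{⊗t}`, where `Φ_x = G_{k,x}`. -/
def realState {m n ℓ : ℕ} (Φ : Bits m → (Op (Bits n) →ₗ[ℂ] Op (Bits n)))
    (x : Fin ℓ → Bits m) (t : ℕ) (θ : PureState n) :
    Op ((Fin ℓ → Bits n) × (Fin t → Bits n)) :=
  tensorPi (fun i => Φ (x i) (ketbra θ)) ⊗ₖ tensorPi (fun _ : Fin t => ketbra θ)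

/-- `⨂ᵢ |φ_{xᵢ}⟩⟨φ_{xᵢ}| ⊗ |θ⟩⟨θ|^{⊗t}`. -/
def idealState {m n ℓ : ℕ} (x : Fin ℓ → Bits m) (t : ℕ)
    (φ : Bits m → PureState n) (θ : PureState n) :
    Op ((Fin ℓ → Bits n) × (Fin t → Bits n)) :=
  tensorPi (fun i => ketbra (φ (x i))) ⊗ₖ tensorPi (fun _ : Fin t => ketbra θ)

/-- Independent Haar states `φ_y` for all `y ∈ {0,1}^m`, and a further one `θ`. -/
def haarFamily (m n : ℕ) : Measure ((Bits m → PureState n) × PureState n) :=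
  (Measure.pi fun _ : Bits m => haar n).prod (haar n)

/-- The accepting element `0 ≤ M ≤ 1` of a two-outcome measurement. -/
def IsEffect {ι : Type} [Fintype ι] [DecidableEq ι] (M : Op ι) : Prop :=
  M.PosSemidef ∧ (1 - M).PosSemidef

/-- The probability that the measurement with accepting element `M` accepts `ρ`. -/
def acceptProb {ι : Type} [Fintype ι] (M ρ : Op ι) : ℝ := (M * ρ).trace.re

/-- Acceptance probability for outputs of the generator, under a uniform key and a common Haar
state. -/
def realProb {m n : ℕ → ℕ} (G : Generator m n) (lam : ℕ) {ℓ : ℕ}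
    (x : Fin ℓ → Bits (m lam)) (t : ℕ)
    (M : Op ((Fin ℓ → Bits (n lam)) × (Fin t → Bits (n lam)))) : ℝ :=
  𝔼 k : Bits lam, ∫ θ, acceptProb M (realState (G lam k) x t θ) ∂haar (n lam)

/-- Acceptance probability for independent Haar states. -/
def idealProb {m n ℓ : ℕ} (x : Fin ℓ → Bits m) (t : ℕ)
    (M : Op ((Fin ℓ → Bits n) × (Fin t → Bits n))) : ℝ :=
  ∫ p, acceptProb M (idealState x t p.1 p.2) ∂haarFamily m n

/-- `t` is bounded by a polynomial. -/
def PolyBounded (t : ℕ → ℕ) : Prop := ∃ p : Polynomial ℕ, ∀ lam, t lam ≤ p.eval lam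

def Negligible (f : ℕ → ℝ) : Prop := SuperpolynomialDecay atTop (fun lam : ℕ => (lam : ℝ)) f

/-- Every `G_{k,x}` is a quantum channel that maps pure states to pure states. -/
def StateGeneration {m n : ℕ → ℕ} (G : Generator m n) : Prop :=
  ∀ (lam : ℕ) (k : Bits lam) (x : Bits (m lam)),
    IsChannel (G lam k x) ∧ ∀ θ : PureState (n lam), ∃ θ' : PureState (n lam),
      G lam k x (ketbra θ) = ketbra θ'

/-- `ℓ`-query selective security. An unbounded non-uniform adversary is an arbitrary measurement
for each `lam`, which may depend on the classical queries. -/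
def SelectivelySecure {m n : ℕ → ℕ} (ℓ : ℕ → ℕ) (G : Generator m n) : Prop :=
  ∀ t : ℕ → ℕ, PolyBounded t →
  ∀ A : ∀ lam : ℕ, (Fin (ℓ lam) → Bits (m lam)) →
      Op ((Fin (ℓ lam) → Bits (n lam)) × (Fin (t lam) → Bits (n lam))),
    (∀ lam x, IsEffect (A lam x)) →
  ∀ x : ∀ lam : ℕ, Fin (ℓ lam) → Bits (m lam),
  ∃ negl : ℕ → ℝ, Negligible negl ∧ ∀ lam,
    |realProb G lam (x lam) (t lam) (A lam (x lam)) -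
      idealProb (x lam) (t lam) (A lam (x lam))| ≤ negl lam

/-- Statistical selectively secure `(lam, m, n, ℓ)`-PRFS generators in the common Haar state
model. -/
structure IsStatisticalPRFS (m n ℓ : ℕ → ℕ) (G : Generator m n) : Prop where
  qpt : IsQPT G
  stateGeneration : StateGeneration G
  selectivelySecure : SelectivelySecure ℓ G

/-! ### The GGM-style generator -/

/-- A key `(k_1^0,…,k_m^0,k_1^1,…,k_m^1)` of `2m` blocks of length `b`; `K c i` is `k_i^c`. -/
abbrev BlockKey (m b : ℕ) : Type := Bool → Fin m → Bits b

/-- `⊕ᵢ k_i^{x_i}`. -/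
def ggmMask {m b : ℕ} (K : BlockKey m b) (x : Bits m) : Bits b :=
  fun j => decide (Odd (Finset.univ.filter fun i : Fin m => K (x i) i j = true).card)

/-- The Pauli matrix `Z`. -/
def pauliZ : Op Bool := Matrix.diagonal fun b => if b then -1 else 1

/-- `Z^s ⊗ I_{n-b}` on `n` qubits, where `Z^s = Z^{s_1} ⊗ ⋯ ⊗ Z^{s_b}`, for `b ≤ n`. -/
def zPrefix {b : ℕ} (n : ℕ) (s : Bits b) : Op (Bits n) :=
  tensorPi fun i : Fin n => if ∃ h : i.val < b, s ⟨i.val, h⟩ = true then pauliZ else 1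

/-- `G(K, x, ·)`, conjugation by `Z^{⊕ᵢ k_i^{x_i}} ⊗ I`. -/
def ggmChannel {m b : ℕ} (n : ℕ) (K : BlockKey m b) (x : Bits m) :
    Op (Bits n) →ₗ[ℂ] Op (Bits n) :=
  conjBy (zPrefix n (ggmMask K x))

lemma block_index_lt {lam m : ℕ} (c : Bool) (i : Fin m) (j : Fin (lam / (2 * m))) :
    (c.toNat * m + i.val) * (lam / (2 * m)) + j.val < lam := by
  have hc : c.toNat ≤ 1 := Bool.toNat_le c
  have h1 : c.toNat * m + i.val + 1 ≤ 2 * m := by nlinarith [i.isLt]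
  have h2 := Nat.mul_le_mul_right (lam / (2 * m)) h1
  have h3 : 2 * m * (lam / (2 * m)) ≤ lam := Nat.mul_div_le lam (2 * m)
  nlinarith [j.isLt]

/-- The first `2m⌊lam/(2m)⌋` bits of a key of length `lam`, cut into `2m` consecutive blocks
`k_1^0,…,k_m^0,k_1^1,…,k_m^1` of length `⌊lam/(2m)⌋`. -/
def keyBlocks {lam : ℕ} (m : ℕ) (k : Bits lam) : BlockKey m (lam / (2 * m)) :=
  fun c i j => k ⟨(c.toNat * m + i.val) * (lam / (2 * m)) + j.val, block_index_lt c i j⟩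

/-- `𝔼_{K,θ} [⨂ᵢ G(K, xᵢ, |θ⟩) ⊗ |θ⟩⟨θ|^{⊗t}]` for a uniform key with blocks of length `b`. -/
def ggmRealAverage {m ℓ : ℕ} (b n : ℕ) (x : Fin ℓ → Bits m) (t : ℕ) :
    Op ((Fin ℓ → Bits n) × (Fin t → Bits n)) :=
  Matrix.of fun u v =>
    𝔼 K : BlockKey m b, ∫ θ, realState (ggmChannel n K) x t θ u v ∂haar n

/-- `𝔼_{φ,θ} [⨂ᵢ |φ_{xᵢ}⟩⟨φ_{xᵢ}| ⊗ |θ⟩⟨θ|^{⊗t}]`. -/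
def idealAverage {m ℓ : ℕ} (n : ℕ) (x : Fin ℓ → Bits m) (t : ℕ) :
    Op ((Fin ℓ → Bits n) × (Fin t → Bits n)) :=
  Matrix.of fun u v => ∫ p, idealState x t p.1 p.2 u v ∂haarFamily m n

end CHS

end

/-!
Averaging over the key and over the phases of the Haar states only leaves matrix entries between
basis states that every key multiplies by the same sign and that are rearrangements of each other
(real state), or that are rearrangements within each group of factors carrying the same Haar state
(ideal state). Call a basis state good if its `ℓ + t` strings are distinct and every rearrangement
of it that receives the same signs only permutes outputs of equal queries. By unitary invariance,
all entries that survive at distinct strings are equal, so on good basis states both averages are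
multiples of one positive semidefinite matrix. As both have trace one, their distance is at most
the total weight of the bad basis states.

A bad basis state satisfies one of `(ℓ + t)² + (ℓ + t)^ℓ` linear equations over `𝔽₂` on the first
`b` bits of its strings (`b` being the block length of the key), each of which involves at least
two strings. Such an equation has probability at most `2 / 2^b`, because the second moments of the
Haar measure make the nontrivial Fourier coefficients of the outcome distribution of a random state
of order `2^(-n/2)` in mean square.

The bound `(ℓ + t)^(2ℓ) / 2^b` is negligible since `ℓ log λ = o(λ^(1 - c))` while `b` is of order
`λ^(1 - c)`. As `Z = T⁴`, the circuits consist of `T` gates, and an explicit stack machine writes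
them down.
-/

noncomputable section

namespace CHS

/-! ### Unitarily invariant measures on the unit sphere -/

lemma integrable_of_continuous {Ω F : Type*} [TopologicalSpace Ω] [CompactSpace Ω]
    [MeasurableSpace Ω] [OpensMeasurableSpace Ω] [NormedAddCommGroup F] {μ : Measure Ω}
    [IsFiniteMeasure μ] {f : Ω → F} (hf : Continuous f) : Integrable f μ :=
  hf.integrable_of_hasCompactSupport (HasCompactSupport.of_compactSpace f)

section Rotation

/-- The action of a linear isometry on the unit sphere. -/
def rotate {𝕜 E : Type*} [NormedField 𝕜] [NormedAddCommGroup E] [NormedSpace 𝕜 E]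
    (U : E ≃ₗᵢ[𝕜] E) (θ : Metric.sphere (0 : E) 1) : Metric.sphere (0 : E) 1 :=
  ⟨U θ.1, by simp⟩

lemma continuous_rotate {𝕜 E : Type*} [NormedField 𝕜] [NormedAddCommGroup E] [NormedSpace 𝕜 E]
    (U : E ≃ₗᵢ[𝕜] E) : Continuous (rotate U) :=
  Continuous.subtype_mk (U.continuous.comp continuous_subtype_val) _

open scoped Pointwise in
lemma measurePreserving_rotate_toSphere {E : Type*} [NormedAddCommGroup E] [NormedSpace ℝ E]
    [MeasurableSpace E] [BorelSpace E] {μ : Measure E} (U : E ≃ₗᵢ[ℝ] E)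
    (hU : MeasurePreserving U μ μ) :
    MeasurePreserving (rotate U) μ.toSphere μ.toSphere := by
  have hm : Measurable (rotate U) := (continuous_rotate U).measurable
  refine ⟨hm, Measure.ext fun s hs => ?_⟩
  have image_preimage : U '' (Subtype.val '' (rotate U ⁻¹' s)) = Subtype.val '' s := by
    ext v
    constructor
    · rintro ⟨_, ⟨θ, hθ, rfl⟩, rfl⟩
      exact ⟨_, hθ, rfl⟩
    · rintro ⟨θ, hθ, rfl⟩
      have hr : rotate U (rotate U.symm θ) = θ := Subtype.ext (U.apply_symm_apply _)
      exact ⟨_, ⟨rotate U.symm θ, by rwa [Set.mem_preimage, hr], rfl⟩, U.apply_symm_apply _⟩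
  have image_cone : U '' (Set.Ioo (0 : ℝ) 1 • (Subtype.val '' (rotate U ⁻¹' s))) =
      Set.Ioo (0 : ℝ) 1 • (Subtype.val '' s) :=
    (Set.image_image2_distrib_right (map_smul U)).trans (by rw [image_preimage]; rfl)
  rw [Measure.map_apply hm hs, Measure.toSphere_apply' _ (hm hs), Measure.toSphere_apply' _ hs,
    ← image_cone, ← hU.measure_preimage_emb U.toHomeomorph.measurableEmbedding (U '' _),
    Set.preimage_image_eq _ U.injective]

end Rotation

section UnitarilyInvariant

variable {ι : Type*} [Fintype ι]

/-- Unit vectors of the complex Euclidean space with basis `ι`; `PureState n` is the case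
`ι = Bits n`. -/
abbrev UnitVector (ι : Type*) [Fintype ι] : Type _ := Metric.sphere (0 : EuclideanSpace ℂ ι) 1

/-- Invariance of a measure on the unit sphere under all unitaries. -/
def IsUnitarilyInvariant (μ : Measure (UnitVector ι)) : Prop :=
  ∀ U : EuclideanSpace ℂ ι ≃ₗᵢ[ℂ] EuclideanSpace ℂ ι, MeasurePreserving (rotate U) μ μ

lemma isUnitarilyInvariant_haar (n : ℕ) : IsUnitarilyInvariant (haar n) := fun U => by
  let V : EuclideanSpace ℂ (Bits n) ≃ₗᵢ[ℝ] EuclideanSpace ℂ (Bits n) :=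
    { U.toLinearEquiv.restrictScalars ℝ with norm_map' := U.norm_map }
  have hV : MeasurePreserving (rotate U) (volume : Measure (EuclideanSpace ℂ (Bits n))).toSphere
      (volume : Measure (EuclideanSpace ℂ (Bits n))).toSphere :=
    measurePreserving_rotate_toSphere V V.measurePreserving
  exact hV.smul_measure _

variable {μ : Measure (UnitVector ι)}

lemma IsUnitarilyInvariant.integral_rotate {F : Type*} [NormedAddCommGroup F] [NormedSpace ℝ F]
    (hμ : IsUnitarilyInvariant μ) (U : EuclideanSpace ℂ ι ≃ₗᵢ[ℂ] EuclideanSpace ℂ ι)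
    {f : UnitVector ι → F} (hf : Continuous f) :
    ∫ θ, f (rotate U θ) ∂μ = ∫ θ, f θ ∂μ := by
  conv_rhs => rw [← (hμ U).map_eq]
  exact (integral_map (hμ U).measurable.aemeasurable hf.aestronglyMeasurable).symm

lemma exists_linearIsometryEquiv_apply_eq {𝕜 E : Type*} [RCLike 𝕜] [NormedAddCommGroup E]
    [InnerProductSpace 𝕜 E] [FiniteDimensional 𝕜 E] {v w : E} (h : ‖v‖ = ‖w‖) :
    ∃ U : E ≃ₗᵢ[𝕜] E, U v = w := by
  rcases eq_or_ne v 0 with rfl | hv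
  · exact ⟨.refl 𝕜 E, (norm_eq_zero.1 (by rw [← h, norm_zero])).symm⟩
  have hr : (‖v‖ : 𝕜) ≠ 0 := RCLike.ofReal_ne_zero.2 (norm_ne_zero_iff.2 hv)
  have norm_v : ‖(‖v‖⁻¹ : 𝕜) • v‖ = 1 := by simp [norm_smul, norm_ne_zero_iff.2 hv]
  have norm_w : ‖(‖v‖⁻¹ : 𝕜) • w‖ = 1 := by simp [norm_smul, ← h, norm_ne_zero_iff.2 hv]
  let e := LinearIsometryEquiv.toSpanUnitSingleton (𝕜 := 𝕜) _ norm_v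
  let L := (LinearIsometry.toSpanSingleton 𝕜 E norm_w).comp e.symm.toLinearIsometry
  have hL : L.extend ((‖v‖⁻¹ : 𝕜) • v) = (‖v‖⁻¹ : 𝕜) • w := by
    calc L.extend ((‖v‖⁻¹ : 𝕜) • v) = L.extend (e 1) := by simp [e]
      _ = L (e 1) := L.extend_apply _
      _ = (‖v‖⁻¹ : 𝕜) • w := by
        simp only [L, LinearIsometry.coe_comp, Function.comp_apply,
          LinearIsometryEquiv.coe_toLinearIsometry, e.symm_apply_apply,
          LinearIsometry.toSpanSingleton_apply, one_smul]
  refine ⟨L.extend.toLinearIsometryEquiv rfl, ?_⟩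
  rw [map_smul] at hL
  exact smul_right_injective E (inv_ne_zero hr) hL

lemma IsUnitarilyInvariant.integral_norm_inner_pow_eq (hμ : IsUnitarilyInvariant μ) (k : ℕ)
    {v w : EuclideanSpace ℂ ι} (h : ‖v‖ = ‖w‖) :
    ∫ θ, ‖inner ℂ v θ.1‖ ^ k ∂μ = ∫ θ, ‖inner ℂ w θ.1‖ ^ k ∂μ := by
  obtain ⟨U, rfl⟩ := exists_linearIsometryEquiv_apply_eq (𝕜 := ℂ) h
  rw [← hμ.integral_rotate U (f := fun θ => ‖inner ℂ (U v) θ.1‖ ^ k) (by fun_prop)]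
  simp only [rotate, U.inner_map_map]

/-! ### Second moments of measurement outcomes -/

/-- The probability of outcome `z` when `θ` is measured in the computational basis. -/
def outcomeProb (θ : UnitVector ι) (z : ι) : ℝ := ‖θ.1 z‖ ^ 2

lemma outcomeProb_nonneg (θ : UnitVector ι) (z : ι) : 0 ≤ outcomeProb θ z := sq_nonneg _

lemma sum_outcomeProb (θ : UnitVector ι) : ∑ z, outcomeProb θ z = 1 := by
  simp only [outcomeProb]
  rw [← EuclideanSpace.norm_sq_eq, mem_sphere_zero_iff_norm.1 θ.2, one_pow]

@[fun_prop]
lemma continuous_outcomeProb (z : ι) : Continuous fun θ : UnitVector ι => outcomeProb θ z := by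
  unfold outcomeProb
  fun_prop

/-- The second moment `𝔼 [p_a p_b]` of the outcome probabilities of a random state. -/
def secondMoment (μ : Measure (UnitVector ι)) (a b : ι) : ℝ :=
  ∫ θ, outcomeProb θ a * outcomeProb θ b ∂μ

lemma sum_norm_add_I_pow_mul_pow_four (z w : ℂ) :
    ∑ k : Fin 4, ‖z + Complex.I ^ (k : ℕ) * w‖ ^ 4 =
      4 * (‖z‖ ^ 4 + ‖w‖ ^ 4 + 4 * (‖z‖ ^ 2 * ‖w‖ ^ 2)) := by
  have pow_four (u : ℂ) : ‖u‖ ^ 4 = (u.re * u.re + u.im * u.im) ^ 2 := by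
    rw [← Complex.normSq_apply, Complex.normSq_eq_norm_sq]
    ring
  rw [pow_four z, pow_four w, ← Complex.normSq_eq_norm_sq, ← Complex.normSq_eq_norm_sq]
  simp only [Fin.sum_univ_four, pow_four, Complex.normSq_apply, Complex.add_re, Complex.add_im,
    Complex.mul_re, Complex.mul_im, Fin.val_zero, Fin.val_one, Fin.val_two, pow_zero, pow_one,
    Complex.I_sq, Complex.I_pow_three, Complex.I_re, Complex.I_im, Complex.one_re, Complex.one_im,
    Complex.neg_re, Complex.neg_im, show ((3 : Fin 4) : ℕ) = 3 from rfl]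
  ring

lemma secondMoment_comm (a b : ι) : secondMoment μ a b = secondMoment μ b a := by
  simp only [secondMoment, mul_comm]

lemma sum_secondMoment [IsProbabilityMeasure μ] : ∑ a, ∑ b, secondMoment μ a b = 1 := by
  have integrable_prod (a b : ι) : Integrable (fun θ => outcomeProb θ a * outcomeProb θ b) μ :=
    integrable_of_continuous (by fun_prop)
  have sum_prod (θ : UnitVector ι) : ∑ a, ∑ b, outcomeProb θ a * outcomeProb θ b = 1 := by
    rw [← Finset.sum_mul_sum, sum_outcomeProb, one_mul]
  calc ∑ a, ∑ b, secondMoment μ a b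
      = ∫ θ, ∑ a, ∑ b, outcomeProb θ a * outcomeProb θ b ∂μ := by
        rw [integral_finsetSum _ fun a _ => integrable_finsetSum _ fun b _ => integrable_prod a b]
        exact Finset.sum_congr rfl fun a _ =>
          (integral_finsetSum _ fun b _ => integrable_prod a b).symm
    _ = 1 := by simp [sum_prod]

lemma IsUnitarilyInvariant.integral_norm_inner_pow_four (hμ : IsUnitarilyInvariant μ)
    (v : EuclideanSpace ℂ ι) (a : ι) :
    ∫ θ, ‖inner ℂ v θ.1‖ ^ 4 ∂μ = ‖v‖ ^ 4 * secondMoment μ a a := by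
  classical
  rw [hμ.integral_norm_inner_pow_eq 4 (w := EuclideanSpace.single a (‖v‖ : ℂ)) (by simp),
    secondMoment, ← integral_const_mul]
  simp only [EuclideanSpace.inner_single_left, outcomeProb, norm_mul, mul_pow, Complex.conj_ofReal,
    Complex.norm_real, norm_norm]
  congr! 3
  ring

/-- The two moments are compared by averaging `|⟨v, θ⟩|⁴` over the four vectors
`v = e_a + (-i)^k e_b`. -/
lemma IsUnitarilyInvariant.secondMoment_self_eq [IsFiniteMeasure μ]
    (hμ : IsUnitarilyInvariant μ) {a b : ι} (hab : a ≠ b) :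
    secondMoment μ a a = 2 * secondMoment μ a b := by
  classical
  have moment_mix (k : Fin 4) :
      ∫ θ, ‖θ.1 a + Complex.I ^ (k : ℕ) * θ.1 b‖ ^ 4 ∂μ = 4 * secondMoment μ a a := by
    let v : EuclideanSpace ℂ ι :=
      EuclideanSpace.single a 1 + EuclideanSpace.single b ((-Complex.I) ^ (k : ℕ))
    have norm_v : ‖v‖ ^ 2 = 2 := by
      rw [@norm_add_sq ℂ]
      norm_num [EuclideanSpace.inner_single_left, hab]
    have := hμ.integral_norm_inner_pow_four v a
    rw [show ‖v‖ ^ 4 = 4 by rw [pow_mul ‖v‖ 2 2, norm_v]; norm_num] at this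
    simpa [v, inner_add_left, EuclideanSpace.inner_single_left] using this
  have moment_diag : secondMoment μ b b = secondMoment μ a a := by
    simpa [EuclideanSpace.inner_single_left, secondMoment, outcomeProb, ← pow_add] using
      hμ.integral_norm_inner_pow_four (EuclideanSpace.single b 1) a
  have sum_mix : 16 * secondMoment μ a a =
      4 * (secondMoment μ a a + secondMoment μ b b + 4 * secondMoment μ a b) := by
    calc 16 * secondMoment μ a a
        = ∑ k : Fin 4, ∫ θ, ‖θ.1 a + Complex.I ^ (k : ℕ) * θ.1 b‖ ^ 4 ∂μ := by
          simp only [moment_mix, Finset.sum_const, Finset.card_univ, Fintype.card_fin]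
          ring
      _ = ∫ θ, 4 * (outcomeProb θ a * outcomeProb θ a + outcomeProb θ b * outcomeProb θ b +
            4 * (outcomeProb θ a * outcomeProb θ b)) ∂μ := by
          rw [← integral_finsetSum _ fun k _ => integrable_of_continuous (by fun_prop)]
          simp only [sum_norm_add_I_pow_mul_pow_four, outcomeProb, ← pow_add]
      _ = 4 * (secondMoment μ a a + secondMoment μ b b + 4 * secondMoment μ a b) := by
          simp only [secondMoment]
          rw [integral_const_mul, integral_add, integral_add, integral_const_mul] <;>
            exact integrable_of_continuous (by fun_prop)
  linarith

lemma IsUnitarilyInvariant.secondMoment_eq [DecidableEq ι] [IsProbabilityMeasure μ]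
    (hμ : IsUnitarilyInvariant μ) (a b : ι) : secondMoment μ a b =
      (1 + if a = b then 1 else 0) / (Fintype.card ι * (Fintype.card ι + 1)) := by
  obtain ⟨D, moment_eq⟩ : ∃ D, ∀ c d, secondMoment μ c d = (1 + if c = d then 1 else 0) * D := by
    refine ⟨secondMoment μ a a / 2, fun c d => ?_⟩
    have diag_eq : secondMoment μ c c = secondMoment μ a a := by
      rcases eq_or_ne a c with rfl | hac
      · rfl
      · rw [hμ.secondMoment_self_eq hac.symm, secondMoment_comm, ← hμ.secondMoment_self_eq hac]
    split_ifs with hcd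
    · subst hcd
      linarith
    · linarith [hμ.secondMoment_self_eq hcd]
  have card_pos : 0 < (Fintype.card ι : ℝ) := by
    exact_mod_cast Fintype.card_pos_iff.2 ⟨a⟩
  have sum_eq : D * (Fintype.card ι * (Fintype.card ι + 1)) = 1 := by
    refine Eq.trans ?_ (sum_secondMoment (μ := μ))
    simp only [moment_eq, ← Finset.sum_mul, Finset.sum_add_distrib, Finset.sum_const,
      Finset.card_univ, Finset.sum_ite_eq, Finset.mem_univ, if_true, nsmul_eq_mul]
    ring
  rw [moment_eq, eq_div_iff (by positivity), mul_assoc, sum_eq, mul_one]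

lemma IsUnitarilyInvariant.integral_sum_mul_outcomeProb_sq [IsProbabilityMeasure μ]
    (hμ : IsUnitarilyInvariant μ) (w : ι → ℝ) :
    ∫ θ, (∑ z, w z * outcomeProb θ z) ^ 2 ∂μ =
      ((∑ z, w z) ^ 2 + ∑ z, w z ^ 2) / (Fintype.card ι * (Fintype.card ι + 1)) := by
  classical
  have expand (θ : UnitVector ι) : (∑ z, w z * outcomeProb θ z) ^ 2 =
      ∑ a, ∑ b, w a * w b * (outcomeProb θ a * outcomeProb θ b) := by
    simp only [sq, Finset.sum_mul_sum, mul_mul_mul_comm]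
  have integrable_term (a b : ι) :
      Integrable (fun θ => w a * w b * (outcomeProb θ a * outcomeProb θ b)) μ :=
    integrable_of_continuous (by fun_prop)
  have integral_term (a b : ι) : ∫ θ, w a * w b * (outcomeProb θ a * outcomeProb θ b) ∂μ =
      (w a * w b + if a = b then w a * w b else 0) /
        (Fintype.card ι * (Fintype.card ι + 1)) := by
    rw [integral_const_mul, ← secondMoment, hμ.secondMoment_eq, ← mul_div_assoc, mul_add, mul_one,
      mul_ite, mul_one, mul_zero]
  simp_rw [expand]
  rw [integral_finsetSum _ fun a _ => integrable_finsetSum _ fun b _ => integrable_term a b]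
  simp_rw [integral_finsetSum _ fun b _ => integrable_term _ b, integral_term, ← Finset.sum_div,
    Finset.sum_add_distrib, Finset.sum_ite_eq, Finset.mem_univ, if_true, sq, Finset.sum_mul_sum]

end UnitarilyInvariant

/-! ### Averages of copies of independent random states -/

section Multisets

lemma exists_perm_of_map_univ_eq {J α : Type*} [Fintype J] {f g : J → α}
    (h : Finset.univ.val.map f = Finset.univ.val.map g) :
    ∃ π : Equiv.Perm J, ∀ j, f (π j) = g j := by
  classical
  have card_eq (a : α) : Fintype.card {j // g j = a} = Fintype.card {j // f j = a} := by
    have h1 := congrArg (Multiset.count a) h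
    simpa [Multiset.count_map, Fintype.card_subtype, Finset.card_def, Finset.filter_val, eq_comm]
      using h1.symm
  exact ⟨Equiv.ofFiberEquiv fun a => Fintype.equivOfCardEq (card_eq a),
    fun j => Equiv.ofFiberEquiv_map _ j⟩

lemma exists_circle_pow_ne {p q : ℕ} (h : p ≠ q) : ∃ z : Circle, z ^ p ≠ z ^ q := by
  wlog hlt : p < q generalizing p q
  · obtain ⟨z, hz⟩ := this h.symm (h.lt_or_gt.resolve_left hlt)
    exact ⟨z, hz.symm⟩
  obtain ⟨r, rfl⟩ := Nat.exists_eq_add_of_lt hlt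
  refine ⟨Circle.exp (Real.pi / (r + 1 : ℕ)), fun heq => ?_⟩
  have pow_eq_one : Circle.exp (Real.pi / (r + 1 : ℕ)) ^ (r + 1) = 1 := by
    rwa [add_assoc, pow_add, eq_comm, mul_eq_left] at heq
  rw [← Circle.exp_nsmul, nsmul_eq_mul, mul_div_cancel₀ _ (by positivity)] at pow_eq_one
  have h1 := congrArg (fun z : Circle => (z : ℂ)) pow_eq_one
  norm_num [Circle.coe_exp] at h1

lemma exists_phase_prod_map_ne {α : Type*} {S T : Multiset α} (h : S ≠ T) :
    ∃ c : α → Circle, (S.map c).prod ≠ (T.map c).prod := by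
  classical
  obtain ⟨a, ha⟩ : ∃ a, S.count a ≠ T.count a := by
    simpa only [ne_eq, Multiset.ext, not_forall] using h
  obtain ⟨z, hz⟩ := exists_circle_pow_ne ha
  have prod_eq (R : Multiset α) :
      (R.map fun b => if b = a then z else 1).prod = z ^ R.count a := by
    induction R using Multiset.induction with
    | empty => simp
    | cons b R ih =>
      by_cases hb : b = a
      · simp [hb, ih, pow_succ']
      · simp [hb, ih, Multiset.count_cons_of_ne (Ne.symm hb)]
  exact ⟨fun b => if b = a then z else 1, by rwa [prod_eq, prod_eq]⟩

/-- The multiset of pairs of a label and a basis state that occur in `u`. -/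
def labelledType {Y J ι : Type*} [Fintype J] (lab : J → Y) (u : J → ι) :
    Multiset (Y × ι) :=
  Finset.univ.val.map fun j => (lab j, u j)

lemma labelledType_eq_iff {Y J ι : Type*} [Fintype J] {lab : J → Y} {u v : J → ι} :
    labelledType lab u = labelledType lab v ↔
      ∃ π : Equiv.Perm J, ∀ j, lab (π j) = lab j ∧ u (π j) = v j := by
  refine ⟨fun h => ?_, fun ⟨π, hπ⟩ => ?_⟩
  · obtain ⟨π, hπ⟩ := exists_perm_of_map_univ_eq h
    exact ⟨π, fun j => Prod.ext_iff.1 (hπ j)⟩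
  · rw [labelledType, ← Multiset.map_univ_val_equiv π, Multiset.map_map]
    exact Multiset.map_congr rfl fun j _ => Prod.ext (hπ j).1 (hπ j).2

end Multisets

lemma posSemidef_integral {Ω κ : Type*} [Finite κ] [MeasurableSpace Ω] {μ : Measure Ω}
    {f : Ω → Matrix κ κ ℂ} (hf : ∀ ω, (f ω).PosSemidef)
    (hint : ∀ u v, Integrable (fun ω => f ω u v) μ) :
    (Matrix.of fun u v => ∫ ω, f ω u v ∂μ).PosSemidef := by
  have := Fintype.ofFinite κ
  refine .of_dotProduct_mulVec_nonneg ?_ fun x => ?_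
  · ext u v
    simp only [Matrix.conjTranspose_apply, Matrix.of_apply, Complex.star_def, ← integral_conj]
    exact integral_congr_ae (.of_forall fun ω => (hf ω).isHermitian.apply u v)
  · have integrable_term (u v : κ) : Integrable (fun ω => star (x u) * (f ω u v * x v)) μ :=
      ((hint u v).mul_const _).const_mul _
    have form_eq : star x ⬝ᵥ (Matrix.of fun u v => ∫ ω, f ω u v ∂μ).mulVec x =
        ∫ ω, star x ⬝ᵥ (f ω).mulVec x ∂μ := by
      simp only [dotProduct, Matrix.mulVec, Pi.star_apply, Matrix.of_apply, Finset.mul_sum]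
      rw [integral_finsetSum _ fun u _ => integrable_finsetSum _ fun v _ => integrable_term u v]
      simp_rw [integral_finsetSum _ fun v _ => integrable_term _ v, integral_const_mul,
        integral_mul_const]
    rw [form_eq]
    exact integral_nonneg fun ω => (hf ω).dotProduct_mulVec_nonneg x

section CopiesAverage

variable {Y J ι : Type*} [Fintype J] [Fintype ι]

/-- The diagonal unitary with the given phases. -/
def phaseIsometry (c : ι → Circle) : EuclideanSpace ℂ ι ≃ₗᵢ[ℂ] EuclideanSpace ℂ ι :=
  LinearIsometryEquiv.piLpCongrRight 2 fun z =>
    { LinearEquiv.smulOfNeZero ℂ ℂ (c z : ℂ) (Circle.coe_ne_zero _) with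
      norm_map' := fun v => by
        change ‖(c z : ℂ) * v‖ = ‖v‖
        rw [norm_mul, Circle.norm_coe, one_mul] }

lemma rotate_phaseIsometry_apply (c : ι → Circle) (θ : UnitVector ι) (z : ι) :
    (rotate (phaseIsometry c) θ).1 z = c z * θ.1 z := rfl

lemma rotate_piLpCongrLeft_apply (σ : Equiv.Perm ι) (θ : UnitVector ι) (z : ι) :
    (rotate (LinearIsometryEquiv.piLpCongrLeft 2 ℂ ℂ σ) θ).1 z = θ.1 (σ.symm z) := rfl

/-- The amplitude of the product state `⨂ⱼ ψⱼ` at the basis state `u`. -/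
def amplitude (ψ : J → UnitVector ι) (u : J → ι) : ℂ := ∏ j, (ψ j).1 (u j)

@[fun_prop]
lemma continuous_amplitude_comp (lab : J → Y) (u : J → ι) :
    Continuous fun φ : Y → UnitVector ι => amplitude (φ ∘ lab) u := by
  unfold amplitude
  simp only [Function.comp_apply]
  fun_prop

lemma norm_amplitude_sq (ψ : J → UnitVector ι) (u : J → ι) :
    ‖amplitude ψ u‖ ^ 2 = ∏ j, outcomeProb (ψ j) (u j) := by
  rw [amplitude, norm_prod, ← Finset.prod_pow]
  rfl

lemma sum_norm_amplitude_sq [DecidableEq J] (ψ : J → UnitVector ι) :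
    ∑ u, ‖amplitude ψ u‖ ^ 2 = 1 := by
  simp only [norm_amplitude_sq, ← Fintype.prod_sum, sum_outcomeProb, Finset.prod_const_one]

variable [Fintype Y] {ν : Measure (UnitVector ι)}

/-- The average of `⨂ⱼ |φ_{lab j}⟩⟨φ_{lab j}|` over independent states `φ_y` with law `ν`. -/
def copiesAverage (ν : Measure (UnitVector ι)) (lab : J → Y) : Matrix (J → ι) (J → ι) ℂ :=
  Matrix.of fun u v =>
    ∫ φ : Y → UnitVector ι, amplitude (φ ∘ lab) u * star (amplitude (φ ∘ lab) v)
      ∂Measure.pi fun _ => ν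

/-- The joint distribution of the outcomes when all copies are measured in the computational
basis: the diagonal of `copiesAverage`. -/
def outcomeDistribution (ν : Measure (UnitVector ι)) (lab : J → Y) (u : J → ι) : ℝ :=
  ∫ φ : Y → UnitVector ι, ‖amplitude (φ ∘ lab) u‖ ^ 2 ∂Measure.pi fun _ => ν

lemma outcomeDistribution_nonneg (lab : J → Y) (u : J → ι) : 0 ≤ outcomeDistribution ν lab u :=
  integral_nonneg fun _ => sq_nonneg _

lemma copiesAverage_self (lab : J → Y) (u : J → ι) :
    copiesAverage ν lab u u = outcomeDistribution ν lab u := by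
  simp only [copiesAverage, outcomeDistribution, Matrix.of_apply, Complex.star_def,
    Complex.mul_conj', ← Complex.ofReal_pow, integral_complex_ofReal]

lemma copiesAverage_eq_self_of_labelledType_eq {lab : J → Y} {u v : J → ι}
    (h : labelledType lab u = labelledType lab v) :
    copiesAverage ν lab u v = copiesAverage ν lab u u := by
  obtain ⟨π, hπ⟩ := labelledType_eq_iff.1 h
  have amplitude_eq (φ : Y → UnitVector ι) : amplitude (φ ∘ lab) v = amplitude (φ ∘ lab) u := by
    rw [amplitude, amplitude, ← Equiv.prod_comp π fun j => ((φ ∘ lab) j).1 (u j)]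
    refine Finset.prod_congr rfl fun j _ => ?_
    rw [Function.comp_apply, Function.comp_apply, (hπ j).1, (hπ j).2]
  simp only [copiesAverage, Matrix.of_apply, amplitude_eq]

variable [IsProbabilityMeasure ν]

lemma integrable_prod_amplitude (lab : J → Y) (u v : J → ι) :
    Integrable (fun φ : Y → UnitVector ι =>
      amplitude (φ ∘ lab) u * star (amplitude (φ ∘ lab) v)) (Measure.pi fun _ => ν) :=
  integrable_of_continuous (by fun_prop)

lemma integrable_norm_amplitude_sq (lab : J → Y) (u : J → ι) :
    Integrable (fun φ : Y → UnitVector ι => ‖amplitude (φ ∘ lab) u‖ ^ 2) (Measure.pi fun _ => ν) :=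
  integrable_of_continuous (by fun_prop)

lemma sum_outcomeDistribution [DecidableEq J] (lab : J → Y) :
    ∑ u, outcomeDistribution ν lab u = 1 := by
  simp only [outcomeDistribution]
  rw [← integral_finsetSum _ fun u _ => integrable_norm_amplitude_sq lab u]
  simp [sum_norm_amplitude_sq]

lemma posSemidef_copiesAverage (lab : J → Y) : (copiesAverage ν lab).PosSemidef :=
  posSemidef_integral (f := fun φ => Matrix.vecMulVec (amplitude (φ ∘ lab))
    (star (amplitude (φ ∘ lab)))) (fun _ => Matrix.posSemidef_vecMulVec_self_star _)
    (integrable_prod_amplitude lab)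

lemma IsUnitarilyInvariant.integral_pi_rotate {F : Type*} [NormedAddCommGroup F] [NormedSpace ℝ F]
    (hν : IsUnitarilyInvariant ν) (U : Y → (EuclideanSpace ℂ ι ≃ₗᵢ[ℂ] EuclideanSpace ℂ ι))
    {f : (Y → UnitVector ι) → F} (hf : Continuous f) :
    ∫ φ, f (fun y => rotate (U y) (φ y)) ∂(Measure.pi fun _ => ν) =
      ∫ φ, f φ ∂(Measure.pi fun _ => ν) := by
  have hU := measurePreserving_pi (fun _ => ν) (fun _ => ν) fun y => hν (U y)
  conv_rhs => rw [← hU.map_eq]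
  exact (integral_map hU.measurable.aemeasurable hf.aestronglyMeasurable).symm

lemma IsUnitarilyInvariant.copiesAverage_eq_zero (hν : IsUnitarilyInvariant ν) {lab : J → Y}
    {u v : J → ι} (h : labelledType lab u ≠ labelledType lab v) :
    copiesAverage ν lab u v = 0 := by
  by_contra hne
  obtain ⟨c, hc⟩ := exists_phase_prod_map_ne h
  have amplitude_phase (φ : Y → UnitVector ι) (w : J → ι) :
      amplitude ((fun y => rotate (phaseIsometry fun z => c (y, z)) (φ y)) ∘ lab) w =
        ((labelledType lab w).map c).prod * amplitude (φ ∘ lab) w := by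
    simp only [amplitude, labelledType, Multiset.map_map, Function.comp_apply,
      rotate_phaseIsometry_apply, Finset.prod_mul_distrib]
    exact congrArg (· * _) (map_prod Circle.coeHom _ _).symm
  set S : Circle := ((labelledType lab u).map c).prod
  set T : Circle := ((labelledType lab v).map c).prod
  have scaled : (S * star (T : ℂ)) * copiesAverage ν lab u v = copiesAverage ν lab u v := by
    have h1 := hν.integral_pi_rotate (Y := Y) (fun y => phaseIsometry fun z => c (y, z))
      (f := fun φ => amplitude (φ ∘ lab) u * star (amplitude (φ ∘ lab) v)) (by fun_prop)
    simpa only [copiesAverage, Matrix.of_apply, amplitude_phase, star_mul', mul_mul_mul_comm,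
      integral_const_mul] using h1
  have phase_ne_one : (S * star (T : ℂ)) ≠ 1 := fun h1 => hc <| by
    rwa [Complex.star_def, ← Circle.coe_inv_eq_conj, ← Circle.coe_mul, Circle.coe_eq_one,
      mul_inv_eq_one] at h1
  exact phase_ne_one ((mul_eq_right₀ hne).1 scaled)

lemma IsUnitarilyInvariant.outcomeDistribution_eq_of_injective (hν : IsUnitarilyInvariant ν)
    (lab : J → Y) {u v : J → ι} (hu : u.Injective) (hv : v.Injective) :
    outcomeDistribution ν lab u = outcomeDistribution ν lab v := by
  obtain ⟨σ, hσ⟩ := Equiv.Perm.exists_extending_pair u v hu hv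
  have h1 := hν.integral_pi_rotate (Y := Y)
    (fun _ => LinearIsometryEquiv.piLpCongrLeft 2 ℂ ℂ σ.symm)
    (f := fun φ => ‖amplitude (φ ∘ lab) u‖ ^ 2) (by fun_prop)
  simpa only [outcomeDistribution, amplitude, Function.comp_apply, rotate_piLpCongrLeft_apply,
    Equiv.symm_symm, hσ] using h1.symm

end CopiesAverage

/-! ### Parity events -/

lemma sum_prod_ite {κ R : Type*} [Fintype κ] [DecidableEq κ] [CommSemiring R] (w : κ → R) :
    ∑ k : κ → Bool, ∏ i, (if k i then w i else 1) = ∏ i, (1 + w i) := by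
  rw [← Fintype.prod_sum fun i (a : Bool) => if a = true then w i else 1]
  exact Finset.prod_congr rfl fun i _ => by simp [add_comm]

lemma prod_le_half_add_sq {J : Type*} {D : Finset J} {a : J → ℝ}
    (ha : ∀ j ∈ D, |a j| ≤ 1) {j₁ j₂ : J} (h₁ : j₁ ∈ D) (h₂ : j₂ ∈ D) (hne : j₁ ≠ j₂) :
    ∏ j ∈ D, a j ≤ (a j₁ ^ 2 + a j₂ ^ 2) / 2 := by
  classical
  have h₂' : j₂ ∈ D.erase j₁ := Finset.mem_erase.2 ⟨hne.symm, h₂⟩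
  have rest_le : ∏ j ∈ (D.erase j₁).erase j₂, |a j| ≤ 1 :=
    Finset.prod_le_one (fun _ _ => abs_nonneg _) fun j hj =>
      ha j (Finset.mem_of_mem_erase (Finset.mem_of_mem_erase hj))
  calc ∏ j ∈ D, a j ≤ ∏ j ∈ D, |a j| := (le_abs_self _).trans_eq (Finset.abs_prod _ _)
    _ = |a j₁| * |a j₂| * ∏ j ∈ (D.erase j₁).erase j₂, |a j| := by
      rw [← Finset.mul_prod_erase D _ h₁, ← Finset.mul_prod_erase _ _ h₂', mul_assoc]
    _ ≤ |a j₁| * |a j₂| := mul_le_of_le_one_right (by positivity) rest_le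
    _ ≤ (a j₁ ^ 2 + a j₂ ^ 2) / 2 := by
      rw [← sq_abs (a j₁), ← sq_abs (a j₂)]
      linarith [two_mul_le_add_sq |a j₁| |a j₂|]

/-- The sign `(-1)^a`. -/
def sgn (a : Bool) : ℝ := if a then -1 else 1

@[simp] lemma sgn_true : sgn true = -1 := rfl

@[simp] lemma sgn_false : sgn false = 1 := rfl

lemma sgn_mul_self (a : Bool) : sgn a * sgn a = 1 := by cases a <;> simp

lemma prod_sgn_eq_one_or_neg_one {J : Type*} (D : Finset J) (a : J → Bool) :
    ∏ j ∈ D, sgn (a j) = 1 ∨ ∏ j ∈ D, sgn (a j) = -1 := by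
  rw [← mul_self_eq_one_iff, ← Finset.prod_mul_distrib]
  exact Finset.prod_eq_one fun j _ => sgn_mul_self _

section Characters

variable {b n : ℕ} (h : b ≤ n)

/-- The character `z ↦ (-1)^{s·z}`, where `s` is matched with the first bits of `z`. -/
def chi (s : Bits b) (z : Bits n) : ℝ :=
  ∏ q : Fin b, if s q then sgn (z (Fin.castLE h q)) else 1

lemma chi_mul_self (s : Bits b) (z : Bits n) : chi h s z * chi h s z = 1 := by
  rw [chi, ← Finset.prod_mul_distrib]
  refine Finset.prod_eq_one fun q _ => ?_
  split_ifs <;> simp [sgn_mul_self]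

lemma abs_chi (s : Bits b) (z : Bits n) : |chi h s z| = 1 := by
  rcases mul_self_eq_one_iff.1 (chi_mul_self h s z) with h1 | h1 <;> simp [h1]

lemma chi_zero (z : Bits n) : chi h (fun _ => false) z = 1 := by
  simp [chi]

lemma chi_eq_prod (s : Bits b) (z : Bits n) :
    chi h s z =
      ∏ i : Fin n, if ∃ hi : i.val < b, s ⟨i.val, hi⟩ = true then sgn (z i) else 1 := by
  obtain ⟨d, rfl⟩ := Nat.exists_eq_add_of_le h
  rw [Fin.prod_univ_add, Finset.prod_eq_one (f := fun i : Fin d => _) fun i _ => by simp, mul_one,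
    chi]
  refine Finset.prod_congr rfl fun q _ => ?_
  simp only [Fin.val_castAdd, Fin.is_lt, exists_true_left]
  rfl

lemma sum_chi {s : Bits b} (hs : s ≠ fun _ => false) : ∑ z, chi h s z = 0 := by
  obtain ⟨q, hq⟩ := Function.ne_iff.1 hs
  simp only [chi_eq_prod]
  rw [← Fintype.prod_sum fun (i : Fin n) a =>
    if ∃ hi : i.val < b, s ⟨i.val, hi⟩ = true then sgn a else 1]
  refine Finset.prod_eq_zero (Finset.mem_univ (Fin.castLE h q)) ?_
  have hq' : ∃ hi : (Fin.castLE h q).val < b, s ⟨(Fin.castLE h q).val, hi⟩ = true :=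
    ⟨q.2, by simpa using hq⟩
  rw [Fintype.sum_bool, if_pos hq', if_pos hq', sgn_true, sgn_false, neg_add_cancel]

/-- The Fourier transform of the outcome distribution of `θ` at the character `chi h s`. -/
def fourier (s : Bits b) (θ : UnitVector (Bits n)) : ℝ := ∑ z, chi h s z * outcomeProb θ z

@[fun_prop]
lemma continuous_fourier (s : Bits b) :
    Continuous fun θ : UnitVector (Bits n) => fourier h s θ := by
  unfold fourier
  fun_prop

lemma abs_fourier_le_one (s : Bits b) (θ : UnitVector (Bits n)) : |fourier h s θ| ≤ 1 :=
  calc |fourier h s θ| ≤ ∑ z, |chi h s z * outcomeProb θ z| := Finset.abs_sum_le_sum_abs _ _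
    _ = ∑ z, outcomeProb θ z := by
      simp only [abs_mul, abs_chi, one_mul, abs_of_nonneg (outcomeProb_nonneg θ _)]
    _ = 1 := sum_outcomeProb θ

variable {ν : Measure (UnitVector (Bits n))} [IsProbabilityMeasure ν]

lemma IsUnitarilyInvariant.integral_fourier_sq_le (hν : IsUnitarilyInvariant ν) {s : Bits b}
    (hs : s ≠ fun _ => false) : ∫ θ, fourier h s θ ^ 2 ∂ν ≤ 1 / 2 ^ n := by
  have moment := hν.integral_sum_mul_outcomeProb_sq (chi h s)
  have sum_sq : ∑ z, chi h s z ^ 2 = 2 ^ n := by simp [pow_two, chi_mul_self]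
  rw [sum_chi h hs, sum_sq] at moment
  calc ∫ θ, fourier h s θ ^ 2 ∂ν = (0 ^ 2 + 2 ^ n) / (2 ^ n * (2 ^ n + 1)) := by
        simpa [fourier] using moment
    _ = 1 / (2 ^ n + 1) := by field_simp; norm_num
    _ ≤ 1 / 2 ^ n := by gcongr; linarith

lemma IsUnitarilyInvariant.sum_integral_fourier_sq_le (hν : IsUnitarilyInvariant ν) :
    ∑ s : Bits b, ∫ θ, fourier h s θ ^ 2 ∂ν ≤ 2 := by
  have trivial_eq : ∫ θ, fourier h (fun _ => false) θ ^ 2 ∂ν = 1 := by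
    simp [fourier, chi_zero, sum_outcomeProb]
  rw [← Finset.add_sum_erase _ _ (Finset.mem_univ fun _ : Fin b => false), trivial_eq]
  have rest_le : ∑ s ∈ Finset.univ.erase (fun _ : Fin b => false), ∫ θ, fourier h s θ ^ 2 ∂ν ≤ 1 :=
    calc ∑ s ∈ Finset.univ.erase (fun _ : Fin b => false), ∫ θ, fourier h s θ ^ 2 ∂ν
        ≤ ∑ s ∈ Finset.univ.erase (fun _ : Fin b => false), (1 / 2 ^ n : ℝ) :=
          Finset.sum_le_sum fun s hs => hν.integral_fourier_sq_le h (Finset.ne_of_mem_erase hs)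
      _ ≤ ∑ _s : Bits b, (1 / 2 ^ n : ℝ) :=
          Finset.sum_le_sum_of_subset_of_nonneg (Finset.erase_subset _ _) fun _ _ _ => by positivity
      _ = 2 ^ b / 2 ^ n := by simp [div_eq_mul_inv]
      _ ≤ 1 := by
        rw [div_le_one (by positivity)]
        exact pow_le_pow_right₀ one_le_two h
  linarith

/-- The first `b` bits of the strings `u j`, `j ∈ D`, add up to zero. -/
def ParityEvent {J : Type*} (D : Finset J) (u : J → Bits n) : Prop :=
  ∀ q : Fin b, ∏ j ∈ D, sgn (u j (Fin.castLE h q)) = 1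

lemma sum_prod_chi {J : Type*} (D : Finset J) (u : J → Bits n) :
    ∑ s, ∏ j ∈ D, chi h s (u j) =
      ∏ q : Fin b, (1 + ∏ j ∈ D, sgn (u j (Fin.castLE h q))) := by
  rw [← sum_prod_ite]
  refine Finset.sum_congr rfl fun s _ => ?_
  simp only [chi]
  rw [Finset.prod_comm]
  refine Finset.prod_congr rfl fun q _ => ?_
  split_ifs <;> simp

open scoped Classical in
lemma indicator_parityEvent_le {J : Type*} (D : Finset J) (u : J → Bits n) :
    (if ParityEvent h D u then (1 : ℝ) else 0) ≤ (∑ s, ∏ j ∈ D, chi h s (u j)) / 2 ^ b := by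
  rw [sum_prod_chi]
  split_ifs with hu
  · rw [Finset.prod_congr rfl fun q _ => by rw [hu q], le_div_iff₀ (by positivity)]
    norm_num
  · refine div_nonneg (Finset.prod_nonneg fun q _ => ?_) (by positivity)
    rcases prod_sgn_eq_one_or_neg_one D fun j => u j (Fin.castLE h q) with hq | hq <;>
      rw [hq] <;> norm_num

variable {J : Type*} [Fintype J] [DecidableEq J]

lemma sum_norm_amplitude_sq_mul_prod_chi (D : Finset J) (s : Bits b)
    (ψ : J → UnitVector (Bits n)) :
    ∑ u, ‖amplitude ψ u‖ ^ 2 * ∏ j ∈ D, chi h s (u j) = ∏ j ∈ D, fourier h s (ψ j) := by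
  have term_eq (u : J → Bits n) : ‖amplitude ψ u‖ ^ 2 * ∏ j ∈ D, chi h s (u j) =
      ∏ j, (if j ∈ D then chi h s (u j) else 1) * outcomeProb (ψ j) (u j) := by
    rw [norm_amplitude_sq, ← Fintype.prod_ite_mem D, ← Finset.prod_mul_distrib]
    exact Finset.prod_congr rfl fun j _ => mul_comm _ _
  simp only [term_eq]
  rw [← Fintype.prod_sum fun j z => (if j ∈ D then chi h s z else 1) * outcomeProb (ψ j) z,
    ← Fintype.prod_ite_mem D]
  refine Finset.prod_congr rfl fun j _ => ?_
  split_ifs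
  · rfl
  · simp only [one_mul, sum_outcomeProb]

open scoped Classical in
lemma sum_norm_amplitude_sq_parityEvent_le {D : Finset J} {j₁ j₂ : J} (h₁ : j₁ ∈ D) (h₂ : j₂ ∈ D)
    (hne : j₁ ≠ j₂) (ψ : J → UnitVector (Bits n)) :
    ∑ u with ParityEvent h D u, ‖amplitude ψ u‖ ^ 2 ≤
      (∑ s, (fourier h s (ψ j₁) ^ 2 + fourier h s (ψ j₂) ^ 2) / 2) / 2 ^ b :=
  calc ∑ u with ParityEvent h D u, ‖amplitude ψ u‖ ^ 2
      = ∑ u, ‖amplitude ψ u‖ ^ 2 * if ParityEvent h D u then 1 else 0 := by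
        simp only [Finset.sum_filter, mul_ite, mul_one, mul_zero]
    _ ≤ ∑ u, ‖amplitude ψ u‖ ^ 2 * ((∑ s, ∏ j ∈ D, chi h s (u j)) / 2 ^ b) := by
        gcongr with u
        exact indicator_parityEvent_le h D u
    _ = (∑ s, ∏ j ∈ D, fourier h s (ψ j)) / 2 ^ b := by
        simp only [← mul_div_assoc, ← Finset.sum_div, Finset.mul_sum,
          ← sum_norm_amplitude_sq_mul_prod_chi]
        rw [Finset.sum_comm]
    _ ≤ _ := by
        gcongr with s
        exact prod_le_half_add_sq (fun j _ => abs_fourier_le_one h s (ψ j)) h₁ h₂ hne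

lemma integrable_fourier_comp_eval_sq {Y : Type*} [Fintype Y] (s : Bits b) (y : Y) :
    Integrable (fun φ : Y → UnitVector (Bits n) => fourier h s (φ y) ^ 2)
      (Measure.pi fun _ => ν) :=
  integrable_of_continuous (by fun_prop)

lemma integral_fourier_comp_eval_sq {Y : Type*} [Fintype Y] (s : Bits b) (y : Y) :
    ∫ φ : Y → UnitVector (Bits n), fourier h s (φ y) ^ 2 ∂(Measure.pi fun _ => ν) =
      ∫ θ, fourier h s θ ^ 2 ∂ν :=
  integral_comp_eval (μ := fun _ : Y => ν) (f := fun θ => fourier h s θ ^ 2)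
    (by fun_prop : Continuous fun θ : UnitVector (Bits n) =>
      fourier h s θ ^ 2).aestronglyMeasurable

open scoped Classical in
lemma IsUnitarilyInvariant.sum_outcomeDistribution_parityEvent_le {Y : Type*} [Fintype Y]
    (hν : IsUnitarilyInvariant ν) (lab : J → Y) {D : Finset J} (hD : D.Nontrivial) :
    ∑ u with ParityEvent h D u, outcomeDistribution ν lab u ≤ 2 / 2 ^ b := by
  obtain ⟨j₁, h₁, j₂, h₂, hne⟩ := hD
  have integrable_term (s : Bits b) : Integrable (fun φ : Y → UnitVector (Bits n) =>
      (fourier h s (φ (lab j₁)) ^ 2 + fourier h s (φ (lab j₂)) ^ 2) / 2) (Measure.pi fun _ => ν) :=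
    ((integrable_fourier_comp_eval_sq h s _).add
      (integrable_fourier_comp_eval_sq h s _)).div_const 2
  calc ∑ u with ParityEvent h D u, outcomeDistribution ν lab u
      = ∫ φ : Y → UnitVector (Bits n), ∑ u with ParityEvent h D u, ‖amplitude (φ ∘ lab) u‖ ^ 2
          ∂(Measure.pi fun _ => ν) :=
        (integral_finsetSum _ fun u _ => integrable_norm_amplitude_sq lab u).symm
    _ ≤ ∫ φ : Y → UnitVector (Bits n), (∑ s : Bits b,
          (fourier h s (φ (lab j₁)) ^ 2 + fourier h s (φ (lab j₂)) ^ 2) / 2) / 2 ^ b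
          ∂(Measure.pi fun _ => ν) :=
        integral_mono (integrable_finsetSum _ fun u _ => integrable_norm_amplitude_sq lab u)
          ((integrable_finsetSum _ fun s _ => integrable_term s).div_const _)
          fun φ => sum_norm_amplitude_sq_parityEvent_le h h₁ h₂ hne (φ ∘ lab)
    _ = (∑ s : Bits b, ∫ θ, fourier h s θ ^ 2 ∂ν) / 2 ^ b := by
        rw [integral_div, integral_finsetSum _ fun s _ => integrable_term s]
        simp_rw [integral_div, integral_add (integrable_fourier_comp_eval_sq h _ _)
          (integrable_fourier_comp_eval_sq h _ _), integral_fourier_comp_eval_sq,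
          add_self_div_two]
    _ ≤ 2 / 2 ^ b := by
        gcongr
        exact hν.sum_integral_fourier_sq_le h

end Characters

/-! ### Trace norm -/

lemma posSemidef_blockIndicator {ι κ : Type*} [Finite ι] [DecidableEq κ] (good : ι → Prop)
    [DecidablePred good] (f : ι → κ) :
    (Matrix.of fun u v => if good u ∧ good v ∧ f u = f v then (1 : ℂ) else 0).PosSemidef := by
  have := Fintype.ofFinite ι
  let e (c : κ) (u : ι) : ℂ := if good u ∧ f u = c then 1 else 0
  convert Matrix.posSemidef_sum (Finset.univ.image f) fun c _ =>
    Matrix.posSemidef_vecMulVec_self_star (e c)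
  ext u v
  rw [Matrix.sum_apply, Finset.sum_eq_single_of_mem (f u) (by simp)]
  · by_cases hu : good u <;> by_cases hv : good v <;>
      simp [e, Matrix.vecMulVec_apply, hu, hv, eq_comm]
  · intro c _ hc
    simp [e, Matrix.vecMulVec_apply, hc.symm]

section TraceNorm

open scoped MatrixOrder

variable {ι : Type} [Fintype ι]

lemma re_trace_mul_nonneg {M P : Op ι} (hM : M.PosSemidef) (hP : P.PosSemidef) :
    0 ≤ (M * P).trace.re := by
  classical
  obtain ⟨B, rfl⟩ := CStarAlgebra.nonneg_iff_eq_star_mul_self.1 (Matrix.nonneg_iff_posSemidef.2 hP)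
  rw [← Matrix.mul_assoc, Matrix.trace_mul_comm, ← Matrix.mul_assoc]
  exact (Complex.nonneg_iff.1 (hM.mul_mul_conjTranspose_same B).trace_nonneg).1

variable [DecidableEq ι]

lemma re_trace_mul_le_of_posSemidef_one_sub {M P : Op ι} (hM : (1 - M).PosSemidef)
    (hP : P.PosSemidef) : (M * P).trace.re ≤ P.trace.re := by
  simpa [Matrix.sub_mul] using re_trace_mul_nonneg hM hP

lemma traceNorm_eq_re_trace_abs (X : Op ι) : traceNorm X = (CFC.abs X).trace.re := rfl

lemma traceNorm_neg (X : Op ι) : traceNorm (-X) = traceNorm X := by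
  rw [traceNorm_eq_re_trace_abs, CFC.abs_neg, traceNorm_eq_re_trace_abs]

lemma traceNorm_sub_comm (X Y : Op ι) : traceNorm (X - Y) = traceNorm (Y - X) := by
  rw [← neg_sub, traceNorm_neg]

lemma exists_mul_eq_abs {X : Op ι} (hX : X.IsHermitian) :
    ∃ W : Op ι, (1 - W).PosSemidef ∧ (1 + W).PosSemidef ∧ W * X = CFC.abs X := by
  have hX' : IsSelfAdjoint X := hX
  have continuousOn (f : ℝ → ℝ) : ContinuousOn f (spectrum ℝ X) :=
    (Matrix.finite_real_spectrum (A := X)).continuousOn f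
  let sign (x : ℝ) : ℝ := if 0 ≤ x then 1 else -1
  have abs_sign_le (x : ℝ) : |sign x| ≤ 1 := by
    dsimp only [sign]
    split_ifs <;> simp
  refine ⟨cfc sign X, ?_, ?_, ?_⟩
  · rw [← Matrix.nonneg_iff_posSemidef, ← cfc_const_one ℝ X,
      ← cfc_sub _ _ X (continuousOn _) (continuousOn _)]
    exact cfc_nonneg fun x _ => sub_nonneg.2 (abs_le.1 (abs_sign_le x)).2
  · rw [← Matrix.nonneg_iff_posSemidef, ← cfc_const_one ℝ X,
      ← cfc_add X _ _ (continuousOn _) (continuousOn _)]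
    exact cfc_nonneg fun x _ => neg_le_iff_add_nonneg'.1 (abs_le.1 (abs_sign_le x)).1
  · have mul_self_eq : cfc sign X * X = cfc (fun x => sign x * x) X := by
      rw [cfc_mul sign (fun x => x) X (continuousOn _) (continuousOn _), cfc_id' ℝ X]
    rw [mul_self_eq, CFC.abs_eq_cfc_norm X]
    refine cfc_congr fun x _ => ?_
    dsimp only [sign]
    split_ifs with hx
    · rw [one_mul, Real.norm_of_nonneg hx]
    · rw [neg_one_mul, Real.norm_of_nonpos (not_le.1 hx).le]

lemma traceNorm_sub_le {P Q : Op ι} (hP : P.PosSemidef) (hQ : Q.PosSemidef) :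
    traceNorm (P - Q) ≤ P.trace.re + Q.trace.re := by
  obtain ⟨W, hW₁, hW₂, hW⟩ := exists_mul_eq_abs (hP.isHermitian.sub hQ.isHermitian)
  have hP' := re_trace_mul_le_of_posSemidef_one_sub hW₁ hP
  have hQ' := re_trace_mul_le_of_posSemidef_one_sub (M := -W) (by rwa [sub_neg_eq_add]) hQ
  rw [traceNorm_eq_re_trace_abs, ← hW, Matrix.mul_sub, Matrix.trace_sub, Complex.sub_re]
  rw [Matrix.neg_mul, Matrix.trace_neg, Complex.neg_re] at hQ'
  linarith

lemma abs_acceptProb_le_traceNorm {M X : Op ι} (hM : IsEffect M) (hX : X.IsHermitian) :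
    |acceptProb M X| ≤ traceNorm X := by
  have hX' : IsSelfAdjoint X := hX
  have abs_posSemidef : (CFC.abs X).PosSemidef := Matrix.nonneg_iff_posSemidef.1 (CFC.abs_nonneg X)
  have sub_posSemidef : (CFC.abs X - X).PosSemidef := by
    rw [← Matrix.nonneg_iff_posSemidef, CFC.abs_sub_self X]
    exact nsmul_nonneg (CFC.negPart_nonneg X) 2
  have add_posSemidef : (CFC.abs X + X).PosSemidef := by
    rw [← Matrix.nonneg_iff_posSemidef, CFC.abs_add_self X]
    exact nsmul_nonneg (CFC.posPart_nonneg X) 2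
  have h_sub := re_trace_mul_nonneg hM.1 sub_posSemidef
  have h_add := re_trace_mul_nonneg hM.1 add_posSemidef
  have h_abs := re_trace_mul_le_of_posSemidef_one_sub hM.2 abs_posSemidef
  simp only [Matrix.mul_sub, Matrix.mul_add, Matrix.trace_sub, Matrix.trace_add, Complex.sub_re,
    Complex.add_re] at h_sub h_add
  rw [acceptProb, traceNorm_eq_re_trace_abs, abs_le]
  constructor <;> linarith

lemma traceNorm_submatrix {κ : Type} [Fintype κ] [DecidableEq κ] (e : κ ≃ ι) (X : Op ι) :
    traceNorm (X.submatrix e e) = traceNorm X := by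
  have abs_submatrix : CFC.abs (X.submatrix e e) = (CFC.abs X).submatrix e e := by
    refine CFC.sqrt_unique ?_ (Matrix.nonneg_iff_posSemidef.2
      ((Matrix.nonneg_iff_posSemidef.1 (CFC.abs_nonneg X)).submatrix e))
    rw [Matrix.submatrix_mul_equiv, CFC.abs_mul_abs]
    simp only [Matrix.star_eq_conjTranspose, Matrix.conjTranspose_submatrix,
      Matrix.submatrix_mul_equiv]
  rw [traceNorm_eq_re_trace_abs, abs_submatrix, traceNorm_eq_re_trace_abs]
  exact congrArg Complex.re (e.sum_comp fun u => CFC.abs X u u)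

end TraceNorm

section Block

variable {ι : Type} {good : ι → Prop} [DecidablePred good] {R S P : Op ι}

/-- The part of a matrix on the rows and columns outside of `good`. -/
def badBlock (good : ι → Prop) [DecidablePred good] (R : Op ι) : Op ι :=
  Matrix.of fun u v => if good u ∨ good v then 0 else R u v

lemma posSemidef_badBlock [Finite ι] (hR : R.PosSemidef) : (badBlock good R).PosSemidef := by
  classical
  have := Fintype.ofFinite ι
  convert hR.mul_mul_conjTranspose_same (Matrix.diagonal fun u => if good u then (0 : ℂ) else 1)
  ext u v
  by_cases hu : good u <;> by_cases hv : good v <;>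
    simp [badBlock, Matrix.diagonal_conjTranspose, Matrix.mul_diagonal, Matrix.diagonal_mul, hu, hv]

lemma trace_badBlock [Fintype ι] : (badBlock good R).trace = ∑ u with ¬ good u, R u u := by
  simp only [Matrix.trace, Matrix.diag_apply, badBlock, Matrix.of_apply, or_self, Finset.sum_filter,
    ite_not]

lemma eq_badBlock_add_smul (hR : R.IsHermitian) (hP : P.IsHermitian) {r : ℝ}
    (hRP : ∀ u v, good u → R u v = r * P u v) (hP₀ : ∀ u v, ¬ good u → P u v = 0) :
    R = badBlock good R + (r : ℂ) • P := by
  ext u v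
  rw [Matrix.add_apply, Matrix.smul_apply, smul_eq_mul, badBlock, Matrix.of_apply]
  by_cases hu : good u
  · simp [hu, hRP u v hu]
  by_cases hv : good v
  · rw [if_pos (.inr hv), zero_add, ← hR.apply, hRP v u hv, star_mul', hP.apply]
    simp
  · simp [hu, hv, hP₀ u v hu]

variable [Fintype ι] [DecidableEq ι]

lemma traceNorm_sub_le_of_le (hR : R.PosSemidef) (hS : S.PosSemidef) (hP : P.PosSemidef)
    (htrace : R.trace = S.trace) {r s : ℝ} (hsr : s ≤ r)
    (hRP : ∀ u v, good u → R u v = r * P u v) (hSP : ∀ u v, good u → S u v = s * P u v)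
    (hP₀ : ∀ u v, ¬ good u → P u v = 0) :
    traceNorm (R - S) ≤ 2 * ∑ u with ¬ good u, (S u u).re := by
  have hR' := eq_badBlock_add_smul hR.isHermitian hP.isHermitian hRP hP₀
  have hS' := eq_badBlock_add_smul hS.isHermitian hP.isHermitian hSP hP₀
  have difference : R - S = (badBlock good R + ((r - s : ℝ) : ℂ) • P) - badBlock good S := by
    rw [Complex.ofReal_sub, sub_smul]
    nth_rewrite 1 [hR', hS']
    abel
  have hle := traceNorm_sub_le
    ((posSemidef_badBlock (good := good) hR).add
      (hP.smul (a := ((r - s : ℝ) : ℂ)) (by exact_mod_cast sub_nonneg.2 hsr)))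
    (posSemidef_badBlock (good := good) hS)
  have trace_eq : (badBlock good R + ((r - s : ℝ) : ℂ) • P).trace = (badBlock good S).trace := by
    have h1 := congrArg Matrix.trace difference
    rw [Matrix.trace_sub, htrace, sub_self, Matrix.trace_sub] at h1
    exact sub_eq_zero.1 h1.symm
  rw [← Complex.re_sum, ← trace_badBlock, difference, two_mul]
  rwa [trace_eq] at hle

lemma traceNorm_sub_le_two_mul_max (hR : R.PosSemidef) (hS : S.PosSemidef) (hP : P.PosSemidef)
    (htrace : R.trace = S.trace) {r s : ℝ}
    (hRP : ∀ u v, good u → R u v = r * P u v) (hSP : ∀ u v, good u → S u v = s * P u v)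
    (hP₀ : ∀ u v, ¬ good u → P u v = 0) :
    traceNorm (R - S) ≤
      2 * max (∑ u with ¬ good u, (R u u).re) (∑ u with ¬ good u, (S u u).re) := by
  rcases le_total s r with hsr | hrs
  · have hle := traceNorm_sub_le_of_le hR hS hP htrace hsr hRP hSP hP₀
    exact hle.trans (by gcongr; exact le_max_right _ _)
  · have hle := traceNorm_sub_le_of_le hS hR hP htrace.symm hrs hSP hRP hP₀
    rw [traceNorm_sub_comm]
    exact hle.trans (by gcongr; exact le_max_left _ _)

end Block

/-! ### Averages over the key -/

lemma expect_prod_ite {κ : Type*} [Fintype κ] [DecidableEq κ] {w : κ → ℝ}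
    (hw : ∀ i, w i = 1 ∨ w i = -1) :
    𝔼 k : κ → Bool, ∏ i, (if k i then w i else 1) = if ∀ i, w i = 1 then 1 else 0 := by
  rw [Finset.expect_eq_sum_div_card, sum_prod_ite]
  split_ifs with h
  · simp [h, one_add_one_eq_two]
  · obtain ⟨i, hi⟩ := not_forall.1 h
    rw [Finset.prod_eq_zero (Finset.mem_univ i) (by rw [(hw i).resolve_left hi, add_neg_cancel]),
      zero_div]

lemma tensorPi_diagonal {ι κ : Type} [Fintype ι] [DecidableEq κ] (d : ι → κ → ℂ) :
    (tensorPi fun i => Matrix.diagonal (d i)) = Matrix.diagonal fun z => ∏ i, d i (z i) := by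
  classical
  ext u v
  rw [tensorPi, Matrix.of_apply, Matrix.diagonal_apply]
  split_ifs with huv
  · simp [huv]
  · obtain ⟨i, hi⟩ := Function.ne_iff.1 huv
    exact Finset.prod_eq_zero (Finset.mem_univ i) (Matrix.diagonal_apply_ne _ hi)

section Masks

variable {m b n ℓ t : ℕ} (h : b ≤ n)

lemma zPrefix_eq_diagonal (s : Bits b) :
    zPrefix n s = Matrix.diagonal fun z => (chi h s z : ℂ) := by
  have factor_eq (i : Fin n) : (if ∃ hi : i.val < b, s ⟨i.val, hi⟩ = true then pauliZ else 1) =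
      Matrix.diagonal fun a =>
        if ∃ hi : i.val < b, s ⟨i.val, hi⟩ = true then (sgn a : ℂ) else 1 := by
    split_ifs
    · refine congrArg Matrix.diagonal (funext fun a => ?_)
      cases a <;> simp
    · rfl
  simp only [zPrefix, factor_eq, tensorPi_diagonal, chi_eq_prod, Complex.ofReal_prod]
  simp only [apply_ite Complex.ofReal, Complex.ofReal_one]

lemma ketbra_apply (θ : PureState n) (u v : Bits n) : ketbra θ u v = θ.1 u * star (θ.1 v) := rfl

lemma ggmChannel_ketbra_apply (K : BlockKey m b) (y : Bits m) (θ : PureState n) (u v : Bits n) :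
    ggmChannel n K y (ketbra θ) u v =
      chi h (ggmMask K y) u * chi h (ggmMask K y) v * (θ.1 u * star (θ.1 v)) := by
  change (zPrefix n (ggmMask K y) * ketbra θ * (zPrefix n (ggmMask K y)).conjTranspose) u v = _
  rw [zPrefix_eq_diagonal h, Matrix.diagonal_conjTranspose, Matrix.mul_diagonal,
    Matrix.diagonal_mul, ketbra_apply]
  simp only [Pi.star_apply, Complex.star_def, Complex.conj_ofReal]
  ring

lemma ite_ggmMask {w : ℝ} (hw : w * w = 1) (K : BlockKey m b) (y : Bits m) (q : Fin b) :
    (if ggmMask K y q then w else 1) = ∏ i, if K (y i) i q then w else 1 := by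
  rw [Finset.prod_ite]
  simp only [Finset.prod_const, one_pow, mul_one, ggmMask, decide_eq_true_eq]
  split_ifs with hodd
  · obtain ⟨k, hk⟩ := hodd
    rw [hk, pow_succ, pow_mul, pow_two, hw, one_pow, one_mul]
  · obtain ⟨k, hk⟩ := Nat.not_odd_iff_even.1 hodd
    rw [hk, ← two_mul, pow_mul, pow_two, hw, one_pow]

lemma chi_ggmMask (K : BlockKey m b) (y : Bits m) (z : Bits n) :
    chi h (ggmMask K y) z =
      ∏ q : Fin b, ∏ i : Fin m, if K (y i) i q then sgn (z (Fin.castLE h q)) else 1 :=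
  Finset.prod_congr rfl fun q _ => ite_ggmMask (sgn_mul_self _) K y q

/-- The sign by which the generator with key `K` multiplies the basis state `u`, where `u (.inl i)`
is the string on the output for the query `x i`. -/
def maskSign (x : Fin ℓ → Bits m) (K : BlockKey m b) (u : Fin ℓ ⊕ Fin t → Bits n) : ℝ :=
  ∏ i, chi h (ggmMask K (x i)) (u (.inl i))

/-- The sign by which flipping the bit `q` of the key block `k_i^c`, `p = (c, i)`, multiplies the
basis state `u`. -/
def blockSign (x : Fin ℓ → Bits m) (u : Fin ℓ ⊕ Fin t → Bits n) (p : Bool × Fin m) (q : Fin b) :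
    ℝ :=
  ∏ k with x k p.2 = p.1, sgn (u (.inl k) (Fin.castLE h q))

lemma maskSign_eq_prod_blockSign (x : Fin ℓ → Bits m) (K : BlockKey m b)
    (u : Fin ℓ ⊕ Fin t → Bits n) :
    maskSign h x K u =
      ∏ r : (Bool × Fin m) × Fin b, if K r.1.1 r.1.2 r.2 then blockSign h x u r.1 r.2 else 1 := by
  have select (c : Bool) (i : Fin m) (q : Fin b) :
      (if K c i q then blockSign h x u (c, i) q else 1) =
        ∏ k, if x k i = c then if K c i q then sgn (u (.inl k) (Fin.castLE h q)) else 1 else 1 := by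
    rw [blockSign, Finset.prod_filter]
    split_ifs <;> simp
  simp only [maskSign, chi_ggmMask, Fintype.prod_prod_type, select]
  simp_rw [Finset.prod_comm (t := (Finset.univ : Finset (Fin ℓ)))]
  refine Finset.prod_congr rfl fun k _ => ?_
  rw [Finset.prod_comm, Finset.prod_comm (s := (Finset.univ : Finset Bool))]
  refine Finset.prod_congr rfl fun i _ => ?_
  rw [Finset.prod_comm]
  exact Finset.prod_congr rfl fun q _ => by simp

lemma expect_maskSign_mul_maskSign (x : Fin ℓ → Bits m) (u v : Fin ℓ ⊕ Fin t → Bits n) :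
    𝔼 K : BlockKey m b, maskSign h x K u * maskSign h x K v =
      if blockSign h x u = blockSign h x v then 1 else 0 := by
  let w (r : (Bool × Fin m) × Fin b) : ℝ := blockSign h x u r.1 r.2 * blockSign h x v r.1 r.2
  have signs (y : Fin ℓ ⊕ Fin t → Bits n) (p q) :
      blockSign h x y p q = 1 ∨ blockSign h x y p q = -1 :=
    prod_sgn_eq_one_or_neg_one _ _
  have w_eq_one_iff (r) : w r = 1 ↔ blockSign h x u r.1 r.2 = blockSign h x v r.1 r.2 := by
    rcases signs u r.1 r.2 with hu | hu <;> rcases signs v r.1 r.2 with hv | hv <;>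
      norm_num [w, hu, hv]
  have w_sign (r) : w r = 1 ∨ w r = -1 := by
    rcases signs u r.1 r.2 with hu | hu <;> rcases signs v r.1 r.2 with hv | hv <;>
      norm_num [w, hu, hv]
  let keyEquiv : BlockKey m b ≃ ((Bool × Fin m) × Fin b → Bool) :=
    ((Equiv.curry _ _ _).trans (Equiv.curry _ _ _)).symm
  rw [Fintype.expect_equiv keyEquiv _ (fun K => ∏ r, if K r then w r else 1) fun K => ?_,
    expect_prod_ite w_sign]
  · simp only [w_eq_one_iff, funext_iff, Prod.forall]
  · rw [maskSign_eq_prod_blockSign, maskSign_eq_prod_blockSign, ← Finset.prod_mul_distrib]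
    refine Finset.prod_congr rfl fun r _ => ?_
    change _ = if K r.1.1 r.1.2 r.2 then w r else 1
    split_ifs <;> simp [w]

end Masks

/-! ### The two averaged states -/

section AveragedStates

variable {m n ℓ : ℕ}

/-- The state in each tensor factor of the ideal state: `φ_y` for `.inl y`, the common state
for `.inr ()`. -/
def label (x : Fin ℓ → Bits m) (t : ℕ) : Fin ℓ ⊕ Fin t → Bits m ⊕ Unit :=
  Sum.map x fun _ => ()

/-- The basis of the joint system, indexed by all tensor factors at once. -/
def joinEquiv (ℓ t n : ℕ) :
    ((Fin ℓ → Bits n) × (Fin t → Bits n)) ≃ (Fin ℓ ⊕ Fin t → Bits n) :=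
  (Equiv.sumArrowEquivProdArrow (Fin ℓ) (Fin t) (Bits n)).symm

@[simp]
lemma joinEquiv_inl {t : ℕ} (w : (Fin ℓ → Bits n) × (Fin t → Bits n)) (i : Fin ℓ) :
    joinEquiv ℓ t n w (.inl i) = w.1 i := rfl

@[simp]
lemma joinEquiv_inr {t : ℕ} (w : (Fin ℓ → Bits n) × (Fin t → Bits n)) (i : Fin t) :
    joinEquiv ℓ t n w (.inr i) = w.2 i := rfl

lemma realState_apply {b : ℕ} (h : b ≤ n) (K : BlockKey m b) (x : Fin ℓ → Bits m) (t : ℕ)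
    (θ : PureState n) (u v : (Fin ℓ → Bits n) × (Fin t → Bits n)) :
    realState (ggmChannel n K) x t θ u v =
      maskSign h x K (joinEquiv ℓ t n u) * maskSign h x K (joinEquiv ℓ t n v) *
        (amplitude (fun _ => θ) (joinEquiv ℓ t n u) *
          star (amplitude (fun _ => θ) (joinEquiv ℓ t n v))) := by
  rw [amplitude, amplitude, Fintype.prod_sum_type, Fintype.prod_sum_type]
  simp only [realState, tensorPi, Matrix.kroneckerMap_apply, Matrix.of_apply,
    ggmChannel_ketbra_apply h, ketbra_apply, maskSign, Finset.prod_mul_distrib,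
    Complex.ofReal_prod, joinEquiv_inl, joinEquiv_inr, star_mul', star_prod]
  ring

lemma idealState_apply (x : Fin ℓ → Bits m) (t : ℕ) (φ : Bits m ⊕ Unit → PureState n)
    (u v : (Fin ℓ → Bits n) × (Fin t → Bits n)) :
    idealState x t (fun y => φ (.inl y)) (φ (.inr ())) u v =
      amplitude (φ ∘ label x t) (joinEquiv ℓ t n u) *
        star (amplitude (φ ∘ label x t) (joinEquiv ℓ t n v)) := by
  rw [amplitude, amplitude, Fintype.prod_sum_type, Fintype.prod_sum_type]
  simp only [idealState, tensorPi, Matrix.kroneckerMap_apply, Matrix.of_apply, ketbra_apply,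
    Finset.prod_mul_distrib, joinEquiv_inl, joinEquiv_inr, star_mul', star_prod,
    Function.comp_apply, label, Sum.map_inl, Sum.map_inr]
  ring

lemma integral_haarFamily {F : Type*} [NormedAddCommGroup F] [NormedSpace ℝ F]
    (f : (Bits m → PureState n) × PureState n → F) :
    ∫ p, f p ∂haarFamily m n =
      ∫ φ : Bits m ⊕ Unit → PureState n, f (fun y => φ (.inl y), φ (.inr ()))
        ∂Measure.pi fun _ => haar n :=
  let split := (MeasurableEquiv.sumPiEquivProdPi fun _ : Bits m ⊕ Unit => PureState n).trans
    ((MeasurableEquiv.refl _).prodCongr (MeasurableEquiv.funUnique Unit (PureState n)))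
  have hsplit : MeasurePreserving split (Measure.pi fun _ => haar n) (haarFamily m n) :=
    ((MeasurePreserving.id _).prod (measurePreserving_funUnique (haar n) Unit)).comp
      (measurePreserving_sumPiEquivProdPi fun _ : Bits m ⊕ Unit => haar n)
  (hsplit.integral_comp' f).symm

/-- The average over key and common state of the outputs of the generator and the copies of the
common state: only matrix entries between basis states with equal block signs survive the average
over the key. -/
def maskedAverage {b : ℕ} (h : b ≤ n) (x : Fin ℓ → Bits m) (t : ℕ) :
    Op (Fin ℓ ⊕ Fin t → Bits n) :=
  Matrix.of fun u v => (if blockSign h x u = blockSign h x v then 1 else 0) *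
    copiesAverage (haar n) (fun _ => ()) u v

lemma ggmRealAverage_eq_submatrix {b : ℕ} (h : b ≤ n) (x : Fin ℓ → Bits m) (t : ℕ) :
    ggmRealAverage b n x t =
      (maskedAverage h x t).submatrix (joinEquiv ℓ t n) (joinEquiv ℓ t n) := by
  ext u v
  have common (f : PureState n → ℂ) : ∫ θ, f θ ∂haar n =
      ∫ φ : Unit → PureState n, f (φ ()) ∂Measure.pi fun _ => haar n :=
    ((measurePreserving_funUnique (haar n) Unit).integral_comp' f).symm
  have signs := congrArg ((↑) : ℝ → ℂ)
    (expect_maskSign_mul_maskSign h x (joinEquiv ℓ t n u) (joinEquiv ℓ t n v))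
  simp only [ggmRealAverage, Matrix.of_apply, realState_apply h, integral_const_mul,
    ← Finset.expect_mul]
  rw [common]
  simp only [Matrix.submatrix_apply, maskedAverage, copiesAverage, Matrix.of_apply]
  congr 1
  simpa [Finset.expect_eq_sum_div_card, apply_ite ((↑) : ℝ → ℂ)] using signs

lemma idealAverage_eq_submatrix (x : Fin ℓ → Bits m) (t : ℕ) :
    idealAverage n x t =
      (copiesAverage (haar n) (label x t)).submatrix (joinEquiv ℓ t n) (joinEquiv ℓ t n) := by
  ext u v
  simp only [idealAverage, Matrix.of_apply, integral_haarFamily, idealState_apply,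
    Matrix.submatrix_apply, copiesAverage]

lemma posSemidef_maskedAverage {b : ℕ} (h : b ≤ n) (x : Fin ℓ → Bits m) (t : ℕ) :
    (maskedAverage h x t).PosSemidef := by
  have hsigns := posSemidef_blockIndicator (fun _ => True)
    (blockSign h x : (Fin ℓ ⊕ Fin t → Bits n) → _)
  simp only [true_and] at hsigns
  exact hsigns.hadamard (posSemidef_copiesAverage _)

lemma maskedAverage_self {b t : ℕ} (h : b ≤ n) (x : Fin ℓ → Bits m)
    (u : Fin ℓ ⊕ Fin t → Bits n) :
    maskedAverage h x t u u = outcomeDistribution (haar n) (fun _ => ()) u := by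
  simp [maskedAverage, copiesAverage_self]

end AveragedStates

/-! ### Good basis states -/

lemma prod_symmDiff_eq_mul {J R : Type*} [DecidableEq J] [CommMonoid R] {s : J → R}
    (hs : ∀ j, s j * s j = 1) (A B : Finset J) :
    ∏ j ∈ symmDiff A B, s j = (∏ j ∈ A, s j) * ∏ j ∈ B, s j := by
  have hinter : (∏ j ∈ A ∩ B, s j) * ∏ j ∈ A ∩ B, s j = 1 := by
    rw [← Finset.prod_mul_distrib]
    exact Finset.prod_eq_one fun j _ => hs j
  calc ∏ j ∈ symmDiff A B, s j = (∏ j ∈ A \ B, s j) * ∏ j ∈ B \ A, s j :=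
        Finset.prod_union disjoint_sdiff_sdiff
    _ = (∏ j ∈ A \ B, s j) * (∏ j ∈ B \ A, s j) *
          ((∏ j ∈ A ∩ B, s j) * ∏ j ∈ A ∩ B, s j) := by rw [hinter, mul_one]
    _ = (∏ j ∈ A, s j) * ∏ j ∈ B, s j := by
        rw [mul_mul_mul_comm, ← Finset.prod_inter_mul_prod_sdiff A B s,
          ← Finset.prod_inter_mul_prod_sdiff B A s, Finset.inter_comm B A]
        simp only [mul_comm]

lemma nontrivial_symmDiff_of_card_eq {J : Type*} [DecidableEq J] {A B : Finset J}
    (hcard : A.card = B.card) (hne : A ≠ B) : (symmDiff A B).Nontrivial := by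
  obtain ⟨j₁, h₁, h₁'⟩ := Finset.not_subset.1 fun hs =>
    hne (Finset.eq_of_subset_of_card_le hs hcard.ge)
  obtain ⟨j₂, h₂, h₂'⟩ := Finset.not_subset.1 fun hs =>
    hne (Finset.eq_of_subset_of_card_le hs hcard.le).symm
  refine ⟨j₁, ?_, j₂, ?_, fun he => h₁' (he ▸ h₂)⟩
  · exact Finset.mem_coe.2 (Finset.mem_symmDiff.2 (.inl ⟨h₁, h₁'⟩))
  · exact Finset.mem_coe.2 (Finset.mem_symmDiff.2 (.inr ⟨h₂, h₂'⟩))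

lemma sum_filter_le_sum_sum_filter {ι δ : Type*} [Fintype ι] {f : ι → ℝ} (hf : ∀ i, 0 ≤ f i)
    {p : ι → Prop} {q : δ → ι → Prop} [DecidablePred p] [∀ d, DecidablePred (q d)] {s : Finset δ}
    (hpq : ∀ i, p i → ∃ d ∈ s, q d i) :
    ∑ i with p i, f i ≤ ∑ d ∈ s, ∑ i with q d i, f i := by
  simp only [Finset.sum_filter]
  rw [Finset.sum_comm]
  refine Finset.sum_le_sum fun i _ => ?_
  have term_nonneg (d : δ) : 0 ≤ if q d i then f i else 0 := by split_ifs <;> simp [hf]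
  split_ifs with hi
  · obtain ⟨d, hd, hdi⟩ := hpq i hi
    exact (if_pos hdi).ge.trans (Finset.single_le_sum (fun d _ => term_nonneg d) hd)
  · exact Finset.sum_nonneg fun d _ => term_nonneg d

section Good

variable {m b n ℓ t : ℕ} (h : b ≤ n) (x : Fin ℓ → Bits m)

/-- Basis states between which the average over keys can have a nonzero matrix entry. -/
def KeyRel (u v : Fin ℓ ⊕ Fin t → Bits n) : Prop :=
  labelledType (fun _ => ()) u = labelledType (fun _ => ()) v ∧ blockSign h x u = blockSign h x v

/-- Basis states whose tensor factors are all different and on which the averages over keys and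
over independent states have the same nonzero matrix entries. -/
def Good (u : Fin ℓ ⊕ Fin t → Bits n) : Prop :=
  u.Injective ∧ ∀ v, KeyRel h x u v → labelledType (label x t) u = labelledType (label x t) v

variable {x} {u v : Fin ℓ ⊕ Fin t → Bits n}

lemma KeyRel.of_labelledType_eq
    (huv : labelledType (label x t) u = labelledType (label x t) v) : KeyRel h x u v := by
  obtain ⟨π, hπ⟩ := labelledType_eq_iff.1 huv
  refine ⟨labelledType_eq_iff.2 ⟨π, fun j => ⟨rfl, (hπ j).2⟩⟩, ?_⟩
  ext p q
  let factor (y : Bits m ⊕ Unit) (z : Bits n) : ℝ :=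
    y.elim (fun y => if y p.2 = p.1 then sgn (z (Fin.castLE h q)) else 1) fun _ => 1
  have blockSign_eq (w : Fin ℓ ⊕ Fin t → Bits n) :
      blockSign h x w p q = ∏ j, factor (label x t j) (w j) := by
    simp [blockSign, Finset.prod_filter, factor, label, Fintype.prod_sum_type]
  rw [blockSign_eq, blockSign_eq, ← Equiv.prod_comp π]
  exact Finset.prod_congr rfl fun j _ => by rw [(hπ j).1, (hπ j).2]

lemma Good.of_labelledType_eq {h : b ≤ n} (hu : Good h x u)
    (huv : labelledType (label x t) u = labelledType (label x t) v) : Good h x v := by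
  have hkey := KeyRel.of_labelledType_eq h huv
  refine ⟨?_, fun w hw => huv.symm.trans (hu.2 w ⟨hkey.1.trans hw.1, hkey.2.trans hw.2⟩)⟩
  obtain ⟨π, hπ⟩ := labelledType_eq_iff.1 huv
  rw [show v = u ∘ π from funext fun j => (hπ j).2.symm]
  exact hu.1.comp π.injective

/-- The tensor factors of the queries with `i`-th bit `c`, where `p = (c, i)`. -/
def queryPositions (x : Fin ℓ → Bits m) (t : ℕ) (p : Bool × Fin m) : Finset (Fin ℓ ⊕ Fin t) :=
  (Finset.univ.filter fun k => x k p.2 = p.1).map Function.Embedding.inl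

lemma mem_queryPositions {p : Bool × Fin m} {j : Fin ℓ ⊕ Fin t} :
    j ∈ queryPositions x t p ↔ ∃ k, x k p.2 = p.1 ∧ .inl k = j := by
  simp [queryPositions]

lemma label_eq_of_mem_queryPositions_iff (hm : 1 ≤ m) {j j' : Fin ℓ ⊕ Fin t}
    (hj : ∀ p, j ∈ queryPositions x t p ↔ j' ∈ queryPositions x t p) :
    label x t j = label x t j' := by
  rcases j with k | k <;> rcases j' with k' | k'
  · refine congrArg Sum.inl (funext fun i => ?_)
    have := (hj (x k i, i)).1 (mem_queryPositions.2 ⟨k, rfl, rfl⟩)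
    obtain ⟨_, hk, ⟨⟩⟩ := mem_queryPositions.1 this
    exact hk.symm
  · have := (hj (x k ⟨0, hm⟩, ⟨0, hm⟩)).1 (mem_queryPositions.2 ⟨k, rfl, rfl⟩)
    obtain ⟨_, _, ⟨⟩⟩ := mem_queryPositions.1 this
  · have := (hj (x k' ⟨0, hm⟩, ⟨0, hm⟩)).2 (mem_queryPositions.2 ⟨k', rfl, rfl⟩)
    obtain ⟨_, _, ⟨⟩⟩ := mem_queryPositions.1 this
  · rfl

/-- The factors that enter or leave `queryPositions` when the factor of each query `k` is moved
to `f k`. -/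
def movedPositions (x : Fin ℓ → Bits m) (f : Fin ℓ → Fin ℓ ⊕ Fin t) (p : Bool × Fin m) :
    Finset (Fin ℓ ⊕ Fin t) :=
  symmDiff (queryPositions x t p) ((Finset.univ.filter fun k => x k p.2 = p.1).image f)

lemma movedPositions_perm (π : Equiv.Perm (Fin ℓ ⊕ Fin t)) (p : Bool × Fin m) :
    movedPositions x (fun k => π (.inl k)) p =
      symmDiff (queryPositions x t p) ((queryPositions x t p).map π.toEmbedding) := by
  simp only [movedPositions, queryPositions, Finset.map_eq_image, Finset.image_image]
  rfl

lemma parityEvent_movedPositions (π : Equiv.Perm (Fin ℓ ⊕ Fin t)) (hv : ∀ j, u (π j) = v j)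
    (hsign : blockSign h x u = blockSign h x v) (p : Bool × Fin m) :
    ParityEvent h (movedPositions x (fun k => π (.inl k)) p) u := by
  intro q
  have before : ∏ j ∈ queryPositions x t p, sgn (u j (Fin.castLE h q)) =
      blockSign h x u p q := by
    simp [queryPositions, blockSign]
  have after : ∏ j ∈ (queryPositions x t p).map π.toEmbedding, sgn (u j (Fin.castLE h q)) =
      blockSign h x v p q := by
    simp [queryPositions, blockSign, hv]
  rw [movedPositions_perm, prod_symmDiff_eq_mul fun j => sgn_mul_self _, after, ← hsign, ← before,
    ← Finset.prod_mul_distrib]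
  exact Finset.prod_eq_one fun j _ => sgn_mul_self _

lemma exists_nontrivial_movedPositions (hm : 1 ≤ m) (π : Equiv.Perm (Fin ℓ ⊕ Fin t))
    (hπ : ∃ j, label x t (π j) ≠ label x t j) :
    ∃ p, (movedPositions x (fun k => π (.inl k)) p).Nontrivial := by
  obtain ⟨j, hj⟩ := hπ
  obtain ⟨p, hp⟩ : ∃ p, queryPositions x t p ≠ (queryPositions x t p).map π.toEmbedding := by
    by_contra! invariant
    refine hj (label_eq_of_mem_queryPositions_iff hm fun p => ?_)
    nth_rw 1 [invariant p]
    exact Finset.mem_map' π.toEmbedding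
  refine ⟨p, ?_⟩
  rw [movedPositions_perm]
  exact nontrivial_symmDiff_of_card_eq (Finset.card_map _).symm hp

open scoped Classical in
/-- The sets of tensor factors whose parity is tested: all pairs, to detect collisions, and for
every map of the queries to tensor factors one nontrivial set of moved positions, if there is
any. -/
def testSet (x : Fin ℓ → Bits m) :
    ((Fin ℓ ⊕ Fin t) × (Fin ℓ ⊕ Fin t)) ⊕ (Fin ℓ → Fin ℓ ⊕ Fin t) → Finset (Fin ℓ ⊕ Fin t)
  | .inl p => {p.1, p.2}
  | .inr f => if hf : ∃ p, (movedPositions x f p).Nontrivial then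
      movedPositions x f hf.choose else ∅

lemma exists_parityEvent_of_not_good (hm : 1 ≤ m) (hu : ¬ Good h x u) :
    ∃ d, (testSet x d).Nontrivial ∧ ParityEvent h (testSet x d) u := by
  by_cases hinj : Function.Injective u
  · obtain ⟨v, ⟨htype, hsign⟩, hlabel⟩ :
        ∃ v, KeyRel h x u v ∧ labelledType (label x t) u ≠ labelledType (label x t) v := by
      simpa [Good, hinj] using hu
    obtain ⟨π, hπ⟩ := labelledType_eq_iff.1 htype
    have moved : ∃ p, (movedPositions x (fun k => π (.inl k)) p).Nontrivial := by
      refine exists_nontrivial_movedPositions hm π ?_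
      by_contra! fixed
      exact hlabel (labelledType_eq_iff.2 ⟨π, fun j => ⟨fixed j, (hπ j).2⟩⟩)
    refine ⟨.inr fun k => π (.inl k), ?_⟩
    rw [testSet, dif_pos moved]
    exact ⟨moved.choose_spec, parityEvent_movedPositions h π (fun j => (hπ j).2) hsign _⟩
  · obtain ⟨j₁, j₂, he, hne⟩ := Function.not_injective_iff.1 hinj
    refine ⟨.inl (j₁, j₂), ⟨j₁, by simp [testSet], j₂, by simp [testSet], hne⟩, fun q => ?_⟩
    rw [testSet, Finset.prod_pair hne, he, sgn_mul_self]

variable {Y : Type*} [Fintype Y] {ν : Measure (UnitVector (Bits n))} [IsProbabilityMeasure ν]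

open scoped Classical in
lemma IsUnitarilyInvariant.sum_outcomeDistribution_not_good_le (hν : IsUnitarilyInvariant ν)
    (hm : 1 ≤ m) (lab : Fin ℓ ⊕ Fin t → Y) :
    ∑ u with ¬ Good h x u, outcomeDistribution ν lab u ≤
      (((ℓ : ℝ) + t) ^ 2 + ((ℓ : ℝ) + t) ^ ℓ) * (2 / 2 ^ b) := by
  calc ∑ u with ¬ Good h x u, outcomeDistribution ν lab u
      ≤ ∑ d with (testSet (t := t) x d).Nontrivial,
          ∑ u with ParityEvent h (testSet x d) u, outcomeDistribution ν lab u :=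
        sum_filter_le_sum_sum_filter (outcomeDistribution_nonneg lab) fun u hu => by
          simpa using exists_parityEvent_of_not_good h hm hu
    _ ≤ ∑ d with (testSet (t := t) x d).Nontrivial, (2 / 2 ^ b : ℝ) :=
        Finset.sum_le_sum fun d hd =>
          hν.sum_outcomeDistribution_parityEvent_le h lab (Finset.mem_filter.1 hd).2
    _ ≤ ∑ _d : ((Fin ℓ ⊕ Fin t) × (Fin ℓ ⊕ Fin t)) ⊕ (Fin ℓ → Fin ℓ ⊕ Fin t), (2 / 2 ^ b : ℝ) :=
        Finset.sum_le_sum_of_subset_of_nonneg (Finset.filter_subset _ _) fun _ _ _ => by positivity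
    _ = (((ℓ : ℝ) + t) ^ 2 + ((ℓ : ℝ) + t) ^ ℓ) * (2 / 2 ^ b) := by
        simp [pow_two]

end Good

/-! ### The trace distance of the averaged states -/

section TraceDistance

variable {m n ℓ t b : ℕ}

lemma IsUnitarilyInvariant.exists_outcomeDistribution_eq_const {Y J ι : Type*} [Fintype J]
    [Fintype ι] [Fintype Y] {ν : Measure (UnitVector ι)} [IsProbabilityMeasure ν]
    (hν : IsUnitarilyInvariant ν) (lab : J → Y) :
    ∃ r : ℝ, ∀ u : J → ι, u.Injective → outcomeDistribution ν lab u = r := by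
  by_cases hex : ∃ u₀ : J → ι, u₀.Injective
  · obtain ⟨u₀, hu₀⟩ := hex
    exact ⟨_, fun u hu => hν.outcomeDistribution_eq_of_injective lab hu hu₀⟩
  · exact ⟨0, fun u hu => (hex ⟨u, hu⟩).elim⟩

open scoped Classical in
/-- The block diagonal matrix on the good basis states with a block of ones for every labelled type.
On good basis states, both averaged states are multiples of it. -/
def goodBlocks (h : b ≤ n) (x : Fin ℓ → Bits m) (t : ℕ) : Op (Fin ℓ ⊕ Fin t → Bits n) :=
  Matrix.of fun u v => if Good h x u ∧ Good h x v ∧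
    labelledType (label x t) u = labelledType (label x t) v then 1 else 0

open scoped Classical in
lemma Good.goodBlocks_apply {h : b ≤ n} {x : Fin ℓ → Bits m} {u : Fin ℓ ⊕ Fin t → Bits n}
    (hu : Good h x u) (v : Fin ℓ ⊕ Fin t → Bits n) :
    goodBlocks h x t u v =
      if labelledType (label x t) u = labelledType (label x t) v then 1 else 0 := by
  rw [goodBlocks, Matrix.of_apply]
  exact if_congr ⟨fun huv => huv.2.2, fun huv => ⟨hu, hu.of_labelledType_eq huv, huv⟩⟩ rfl rfl

lemma Good.maskedAverage_apply {h : b ≤ n} {x : Fin ℓ → Bits m} {u : Fin ℓ ⊕ Fin t → Bits n}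
    (hu : Good h x u) (v : Fin ℓ ⊕ Fin t → Bits n) :
    maskedAverage h x t u v =
      outcomeDistribution (haar n) (fun _ => ()) u * goodBlocks h x t u v := by
  rw [hu.goodBlocks_apply]
  split_ifs with huv
  · obtain ⟨htype, hsign⟩ := KeyRel.of_labelledType_eq h huv
    rw [maskedAverage, Matrix.of_apply, if_pos hsign,
      copiesAverage_eq_self_of_labelledType_eq htype, copiesAverage_self, one_mul, mul_one]
  · rw [maskedAverage, Matrix.of_apply, mul_zero]
    split_ifs with hsign
    · rw [(isUnitarilyInvariant_haar n).copiesAverage_eq_zero fun htype =>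
        huv (hu.2 v ⟨htype, hsign⟩), mul_zero]
    · rw [zero_mul]

lemma Good.copiesAverage_apply {h : b ≤ n} {x : Fin ℓ → Bits m} {u : Fin ℓ ⊕ Fin t → Bits n}
    (hu : Good h x u) (v : Fin ℓ ⊕ Fin t → Bits n) :
    copiesAverage (haar n) (label x t) u v =
      outcomeDistribution (haar n) (label x t) u * goodBlocks h x t u v := by
  rw [hu.goodBlocks_apply]
  split_ifs with huv
  · rw [copiesAverage_eq_self_of_labelledType_eq huv, copiesAverage_self, mul_one]
  · rw [(isUnitarilyInvariant_haar n).copiesAverage_eq_zero huv, mul_zero]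

lemma trace_maskedAverage (h : b ≤ n) (x : Fin ℓ → Bits m) : (maskedAverage h x t).trace = 1 := by
  simp only [Matrix.trace, Matrix.diag_apply, maskedAverage_self]
  exact_mod_cast sum_outcomeDistribution (ν := haar n) fun _ : Fin ℓ ⊕ Fin t => ()

lemma trace_copiesAverage {Y J ι : Type*} [Fintype J] [DecidableEq J] [Fintype ι] [Fintype Y]
    {ν : Measure (UnitVector ι)} [IsProbabilityMeasure ν] (lab : J → Y) :
    (copiesAverage ν lab).trace = 1 := by
  simp only [Matrix.trace, Matrix.diag_apply, copiesAverage_self]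
  exact_mod_cast sum_outcomeDistribution (ν := ν) lab

lemma traceNorm_maskedAverage_sub_le (hm : 1 ≤ m) (h : b ≤ n) (x : Fin ℓ → Bits m) (t : ℕ) :
    traceNorm (maskedAverage h x t - copiesAverage (haar n) (label x t)) ≤
      2 * ((((ℓ : ℝ) + t) ^ 2 + ((ℓ : ℝ) + t) ^ ℓ) * (2 / 2 ^ b)) := by
  classical
  obtain ⟨r, hr⟩ := (isUnitarilyInvariant_haar n).exists_outcomeDistribution_eq_const
    fun _ : Fin ℓ ⊕ Fin t => ()
  obtain ⟨s, hs⟩ := (isUnitarilyInvariant_haar n).exists_outcomeDistribution_eq_const (label x t)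
  refine (traceNorm_sub_le_two_mul_max (good := Good h x) (P := goodBlocks h x t)
    (posSemidef_maskedAverage h x t) (posSemidef_copiesAverage _)
    (posSemidef_blockIndicator _ _)
    ((trace_maskedAverage h x).trans (trace_copiesAverage _).symm)
    (fun u v hu => by rw [hu.maskedAverage_apply, hr u hu.1])
    (fun u v hu => by rw [hu.copiesAverage_apply, hs u hu.1])
    fun u v hu => by simp [goodBlocks, hu]).trans ?_
  simp only [maskedAverage_self, copiesAverage_self, Complex.ofReal_re]
  gcongr
  exact max_le
    ((isUnitarilyInvariant_haar n).sum_outcomeDistribution_not_good_le h hm fun _ => ())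
    ((isUnitarilyInvariant_haar n).sum_outcomeDistribution_not_good_le h hm (label x t))

lemma ggmRealAverage_eq_idealAverage (x : Fin 0 → Bits m) (t : ℕ) :
    ggmRealAverage b n x t = idealAverage n x t := by
  obtain ⟨θ₀⟩ := nonempty_of_isProbabilityMeasure (haar n)
  have realState_eq (K : BlockKey m b) (θ : PureState n) :
      realState (ggmChannel n K) x t θ = idealState x t (fun _ => θ₀) θ :=
    congrArg (fun ρ => tensorPi ρ ⊗ₖ _) (Subsingleton.elim _ _)
  have idealState_eq (φ : Bits m → PureState n) (θ : PureState n) :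
      idealState x t φ θ = idealState x t (fun _ => θ₀) θ :=
    congrArg (fun ρ => tensorPi ρ ⊗ₖ _) (Subsingleton.elim _ _)
  ext u v
  simp only [ggmRealAverage, idealAverage, Matrix.of_apply, realState_eq,
    fun p : (Bits m → PureState n) × PureState n => idealState_eq p.1 p.2]
  rw [haarFamily, integral_fun_snd fun θ => idealState x t (fun _ => θ₀) θ u v,
    Finset.expect_const Finset.univ_nonempty]
  simp

theorem traceDist_ggmRealAverage_idealAverage_le (hm : 1 ≤ m) (h : b ≤ n) (x : Fin ℓ → Bits m)
    (t : ℕ) :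
    traceDist (ggmRealAverage b n x t) (idealAverage n x t) ≤
      4 * ((ℓ : ℝ) + t) ^ (2 * ℓ) / 2 ^ b := by
  rcases Nat.eq_zero_or_pos ℓ with rfl | hℓ
  · rw [ggmRealAverage_eq_idealAverage, traceDist, sub_self]
    have : traceNorm (0 : Op ((Fin 0 → Bits n) × (Fin t → Bits n))) = 0 := by simp [traceNorm]
    rw [this, zero_div]
    positivity
  have one_le : (1 : ℝ) ≤ ℓ + t := by exact_mod_cast Nat.le_add_right_of_le hℓ
  have sq_le : ((ℓ : ℝ) + t) ^ 2 ≤ ((ℓ : ℝ) + t) ^ (2 * ℓ) := pow_le_pow_right₀ one_le (by omega)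
  have pow_le : ((ℓ : ℝ) + t) ^ ℓ ≤ ((ℓ : ℝ) + t) ^ (2 * ℓ) := pow_le_pow_right₀ one_le (by omega)
  rw [traceDist, ggmRealAverage_eq_submatrix h, idealAverage_eq_submatrix]
  change traceNorm ((maskedAverage h x t - copiesAverage (haar n) (label x t)).submatrix
    (joinEquiv ℓ t n) (joinEquiv ℓ t n)) / 2 ≤ _
  rw [traceNorm_submatrix]
  calc traceNorm (maskedAverage h x t - copiesAverage (haar n) (label x t)) / 2
      ≤ (((ℓ : ℝ) + t) ^ 2 + ((ℓ : ℝ) + t) ^ ℓ) * (2 / 2 ^ b) := by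
        linarith [traceNorm_maskedAverage_sub_le hm h x t]
    _ ≤ (((ℓ : ℝ) + t) ^ (2 * ℓ) + ((ℓ : ℝ) + t) ^ (2 * ℓ)) * (2 / 2 ^ b) := by gcongr
    _ = 4 * ((ℓ : ℝ) + t) ^ (2 * ℓ) / 2 ^ b := by ring

end TraceDistance

/-! ### Writing down the circuit in polynomial time -/

/-- Adds the leading bits of `l` to the bits of `acc` if `d` is set. -/
def addBits (d : Bool) : List Bool → List Bool → List Bool
  | [], _ => []
  | v :: acc, l => xor v (l.head?.getD false && d) :: addBits d acc l.tail

/-- Cuts `l` into blocks of the length of `acc` and adds to `acc` those blocks whose index `i`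
satisfies `xᵢ = c`; the second component is the unused part of `l`. -/
def addBlocks (c : Bool) : List Bool → List Bool → List Bool → List Bool × List Bool
  | [], acc, l => (acc, l)
  | a :: x, acc, l => addBlocks c x (addBits (a == c) acc l) (l.drop acc.length)

/-- The mask `⊕ᵢ k_i^{xᵢ}` of a key `k`, together with the unused part of `k`. -/
def maskBits (k x : List Bool) : List Bool × List Bool :=
  let r := addBlocks false x (List.replicate (k.length / (2 * x.length)) false) k
  addBlocks true x r.1 r.2

/-- Prepends to `gs`, for every set bit of a mask whose first bit belongs to qubit `j`, four `T`
gates, that is, one `Z` gate. -/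
def zGates : List Bool → ℕ → List Gate → List Gate
  | [], _, gs => gs
  | v :: acc, j, gs => zGates acc (j + 1) (if v then List.replicate 4 (.T (.data j)) ++ gs else gs)

/-- The circuit of the generator, as a function of the key and the input. -/
def ggmCircuit (p : List Bool × List Bool) : Circuit := ⟨0, zGates (maskBits p.1 p.2).1 0 []⟩

lemma length_addBits (d : Bool) (acc l : List Bool) : (addBits d acc l).length = acc.length := by
  induction acc generalizing l with
  | nil => rfl
  | cons v acc ih => simp [addBits, ih]

lemma length_addBlocks (c : Bool) (x acc l : List Bool) :
    (addBlocks c x acc l).1.length = acc.length := by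
  induction x generalizing acc l with
  | nil => rfl
  | cons a x ih => rw [addBlocks, ih, length_addBits]

lemma length_addBlocks_snd_le (c : Bool) (x acc l : List Bool) :
    (addBlocks c x acc l).2.length ≤ l.length := by
  induction x generalizing acc l with
  | nil => exact le_rfl
  | cons a x ih => exact (ih _ _).trans (by simp)

lemma length_maskBits (k x : List Bool) :
    (maskBits k x).1.length = k.length / (2 * x.length) := by
  rw [maskBits, length_addBlocks, length_addBlocks, List.length_replicate]

lemma length_maskBits_snd_le (k x : List Bool) : (maskBits k x).2.length ≤ k.length :=
  (length_addBlocks_snd_le _ _ _ _).trans (length_addBlocks_snd_le _ _ _ _)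

namespace Machine

/-- The stacks of the machine: input, reversed key, key, reversed query, query, a unary counter,
accumulator, auxiliary stack, output. -/
inductive Stack : Type
  | inp | yek | key | yrq | qry | cnt | acc | aux | out
  deriving DecidableEq

instance : Fintype Stack where
  elems := {.inp, .yek, .key, .yrq, .qry, .cnt, .acc, .aux, .out}
  complete k := by cases k <;> simp

/-- The alphabets of the stacks. -/
def Letter : Stack → Type
  | .inp => Bool ⊕ Bool
  | .out => Sym
  | _ => Bool

instance : Fintype (Letter .inp) := inferInstanceAs (Fintype (Bool ⊕ Bool))

/-- The program lines. The machine loads key and query, divides the length of the key by twice the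
length of the query, accumulates the blocks `k_i^c` with `xᵢ = c` for `c = 0` and then for `c = 1`,
and emits four `T` gates for every set bit of the accumulator. -/
inductive Label : Type
  | load | reverse | check | divide | restore
  | rewind (c : Bool) | block (c : Bool) | add (c a : Bool) | back (c : Bool)
  | emit | gate (r : Fin 4) | tick (r : Fin 4) | untick (r : Fin 4) | nextBit
  | clean
  deriving Fintype

/-- Two registers for symbols. -/
abbrev Regs : Type := Option Bool × Option Bool

/-- Statements of the programming language of stack machines. -/
abbrev Program : Type := Turing.TM2.Stmt Letter Label Regs

open Turing.TM2.Stmt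

/-- Pops a bit into the first register and continues with `q₁` if there is one, otherwise with
`q₂`. -/
def popBit (k : Stack) (hk : Letter k = Bool) (q₁ q₂ : Program) : Program :=
  pop k (fun _ o => (o.map (cast hk), none)) (branch (fun s => s.1.isSome) q₁ q₂)

/-- Pushes the content of the first register. -/
def pushBit (k : Stack) (hk : Bool = Letter k) (q : Program) : Program :=
  push k (fun s => cast hk (s.1.getD false)) q

/-- The unconditional `goto`. -/
def jump (l : Label) : Program := goto fun _ => l

/-- The line that follows the `r`-th of four equal gates. -/
def afterGate (r : Fin 4) : Label := if r = 3 then .nextBit else .gate (r + 1)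

/-- The program of the machine. -/
def program : Label → Program
  | .load => pop .inp (fun _ o => match o with
      | some (.inl a) => (some a, none)
      | some (.inr a) => (none, some a)
      | none => (none, none))
      (branch (fun s => s.1.isSome) (pushBit .yek rfl (jump .load))
        (branch (fun s => s.2.isSome)
          (push .yrq (fun s => (s.2.getD false : Bool)) (jump .load)) (jump .reverse)))
  | .reverse => popBit .yek rfl
      (pushBit .key rfl (push .cnt (fun _ => true) (jump .reverse))) (jump .check)
  | .check => peek .yrq (fun _ o => (o, none))
      (branch (fun s => s.1.isSome) (jump .divide) (jump .clean))
  | .divide => popBit .yrq rfl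
      (pushBit .qry rfl (pop .cnt (fun s _ => s) (pop .cnt (fun s o => (s.1, o))
        (branch (fun s => s.2.isSome) (jump .divide) (jump (.rewind false))))))
      (push .acc (fun _ => false) (jump .restore))
  | .restore => popBit .qry rfl (pushBit .yrq rfl (jump .restore)) (jump .divide)
  | .rewind c => popBit .yrq rfl (pushBit .qry rfl (jump (.rewind c))) (jump (.block c))
  | .block c => popBit .qry rfl
      (pushBit .yrq rfl (goto fun s => .add c (s.1.getD false)))
      (jump (if c then .emit else .rewind true))
  | .add c a => popBit .acc rfl
      (pop .key (fun s o => (s.1, o))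
        (push .aux (fun s => xor (s.1.getD false) (s.2.getD false && (a == c)))
          (jump (.add c a))))
      (jump (.back c))
  | .back c => popBit .aux rfl (pushBit .acc rfl (jump (.back c))) (jump (.block c))
  | .emit => popBit .acc rfl
      (branch (fun s => s.1.getD false) (jump (.gate 0)) (jump .nextBit))
      (jump .clean)
  | .gate r => push .out (fun _ => Sym.t) (push .out (fun _ => Sym.data) (jump (.tick r)))
  | .tick r => popBit .cnt rfl
      (push .out (fun _ => Sym.tick) (pushBit .aux rfl (jump (.tick r)))) (jump (.untick r))
  | .untick r => popBit .aux rfl (pushBit .cnt rfl (jump (.untick r))) (jump (afterGate r))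
  | .nextBit => push .cnt (fun _ => true) (jump .emit)
  | .clean => popBit .key rfl (jump .clean) (popBit .yrq rfl (jump .clean)
      (popBit .cnt rfl (jump .clean) (push .out (fun _ => Sym.start) halt)))

/-- The Turing machine that writes down the circuit of the generator. -/
def machine : Turing.FinTM2 where
  K := Stack
  k₀ := .inp
  k₁ := .out
  Γ := Letter
  Λ := Label
  main := .load
  σ := Regs
  initialState := (none, none)
  m := program

/-- The contents of the stacks. -/
structure Mem : Type where
  inp : List (Bool ⊕ Bool) := []
  yek : List Bool := []
  key : List Bool := []
  yrq : List Bool := []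
  qry : List Bool := []
  cnt : List Bool := []
  acc : List Bool := []
  aux : List Bool := []
  out : List Sym := []

/-- The contents of the stacks as a dependent function. -/
def Mem.stk (s : Mem) : ∀ k, List (Letter k)
  | .inp => s.inp
  | .yek => s.yek
  | .key => s.key
  | .yrq => s.yrq
  | .qry => s.qry
  | .cnt => s.cnt
  | .acc => s.acc
  | .aux => s.aux
  | .out => s.out

/-- The configuration with current line `l`, registers `v` and stacks `s`. -/
def cfg (l : Option Label) (v : Regs) (s : Mem) : machine.Cfg := ⟨l, v, s.stk⟩

/-- Reachability in at most `n` steps. -/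
def RunsIn (c c' : machine.Cfg) (n : ℕ) : Prop :=
  ∃ k ≤ n, (flip Bind.bind machine.step)^[k] (some c) = some c'

lemma RunsIn.trans {c c' c'' : machine.Cfg} {n n' : ℕ} (h : RunsIn c c' n)
    (h' : RunsIn c' c'' n') : RunsIn c c'' (n + n') := by
  obtain ⟨k, hk, e⟩ := h
  obtain ⟨k', hk', e'⟩ := h'
  exact ⟨k' + k, by omega, by rw [Function.iterate_add_apply, e, e']⟩

lemma RunsIn.mono {c c' : machine.Cfg} {n n' : ℕ} (h : RunsIn c c' n) (hn : n ≤ n') :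
    RunsIn c c' n' := by
  obtain ⟨k, hk, e⟩ := h
  exact ⟨k, hk.trans hn, e⟩

lemma RunsIn.of_step {l : Label} {v : Regs} {s : Mem} {l' : Option Label} {v' : Regs} {s' : Mem}
    (hl : (Turing.TM2.stepAux (program l) v s.stk).l = l' := by rfl)
    (hv : (Turing.TM2.stepAux (program l) v s.stk).var = v' := by rfl)
    (hs : ∀ k, (Turing.TM2.stepAux (program l) v s.stk).stk k = s'.stk k := by
      rintro ⟨⟩ <;> rfl) :
    RunsIn (cfg (some l) v s) (cfg l' v' s') 1 := by
  refine ⟨1, le_rfl, ?_⟩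
  rw [cfg, cfg, ← hl, ← hv, ← funext hs]
  rfl

lemma RunsIn.step {l : Label} {v : Regs} {s : Mem} {l' : Option Label} {v' : Regs} {s' : Mem}
    {c : machine.Cfg} {n : ℕ} (h : RunsIn (cfg l' v' s') c n)
    (hl : (Turing.TM2.stepAux (program l) v s.stk).l = l' := by rfl)
    (hv : (Turing.TM2.stepAux (program l) v s.stk).var = v' := by rfl)
    (hs : ∀ k, (Turing.TM2.stepAux (program l) v s.stk).stk k = s'.stk k := by
      rintro ⟨⟩ <;> rfl) :
    RunsIn (cfg (some l) v s) c (n + 1) :=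
  ((RunsIn.of_step hl hv hs).trans h).mono (by omega)

lemma RunsIn.transfer {l l' : Label} {mem : List Bool → List Bool → Mem}
    (move : ∀ v a y z, RunsIn (cfg (some l) v (mem (a :: y) z))
      (cfg (some l) (some a, none) (mem y (a :: z))) 1)
    (leave : ∀ v z, RunsIn (cfg (some l) v (mem [] z)) (cfg (some l') (none, none) (mem [] z)) 1)
    (v : Regs) (y z : List Bool) :
    RunsIn (cfg (some l) v (mem y z)) (cfg (some l') (none, none) (mem [] (y.reverse ++ z)))
      (y.length + 1) := by
  induction y generalizing v z with
  | nil => exact leave v z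
  | cons a y ih =>
    rw [List.reverse_cons, List.append_assoc, List.length_cons, add_comm _ 1]
    exact (move v a y z).trans (ih _ _) |>.mono (by omega)

lemma run_load (v : Regs) (s : Mem) (k x : List Bool) :
    RunsIn (cfg (some .load) v { s with inp := k.map .inl ++ x.map .inr })
      (cfg (some .reverse) (none, none)
        { s with inp := [], yek := k.reverse ++ s.yek, yrq := x.reverse ++ s.yrq })
      (k.length + x.length + 1) := by
  induction k generalizing s v with
  | nil =>
    induction x generalizing s v with
    | nil => exact .of_step
    | cons a x ih =>
      simpa using (ih (none, some a) { s with yrq := a :: s.yrq }).step (v := v)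
        (s := { s with inp := .inr a :: x.map .inr })
  | cons a k ih =>
    simpa [add_right_comm] using (ih (some a, none) { s with yek := a :: s.yek }).step
      (v := v) (s := { s with inp := .inl a :: (k.map .inl ++ x.map .inr) })

lemma run_reverse (v : Regs) (s : Mem) (k : List Bool) :
    RunsIn (cfg (some .reverse) v { s with yek := k })
      (cfg (some .check) (none, none)
        { s with yek := [], key := k.reverse ++ s.key,
                 cnt := List.replicate k.length true ++ s.cnt })
      (k.length + 1) := by
  induction k generalizing s v with
  | nil => exact .of_step
  | cons a k ih =>
    simpa [List.replicate_succ'] using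
      (ih (some a, none) { s with key := a :: s.key, cnt := true :: s.cnt }).step
        (v := v) (s := { s with yek := a :: k })

lemma run_restore (v : Regs) (s : Mem) (y z : List Bool) :
    RunsIn (cfg (some .restore) v { s with qry := y, yrq := z })
      (cfg (some .divide) (none, none) { s with qry := [], yrq := y.reverse ++ z })
      (y.length + 1) :=
  .transfer (mem := fun y z => { s with qry := y, yrq := z })
    (fun _ _ _ _ => .of_step) (fun _ _ => .of_step) v y z

lemma run_rewind (c : Bool) (v : Regs) (s : Mem) (y z : List Bool) :
    RunsIn (cfg (some (.rewind c)) v { s with yrq := y, qry := z })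
      (cfg (some (.block c)) (none, none) { s with yrq := [], qry := y.reverse ++ z })
      (y.length + 1) :=
  .transfer (mem := fun y z => { s with yrq := y, qry := z })
    (fun _ _ _ _ => .of_step) (fun _ _ => .of_step) v y z

lemma run_back (c : Bool) (v : Regs) (s : Mem) (y z : List Bool) :
    RunsIn (cfg (some (.back c)) v { s with aux := y, acc := z })
      (cfg (some (.block c)) (none, none) { s with aux := [], acc := y.reverse ++ z })
      (y.length + 1) :=
  .transfer (mem := fun y z => { s with aux := y, acc := z })
    (fun _ _ _ _ => .of_step) (fun _ _ => .of_step) v y z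

lemma run_untick (r : Fin 4) (v : Regs) (s : Mem) (y z : List Bool) :
    RunsIn (cfg (some (.untick r)) v { s with aux := y, cnt := z })
      (cfg (some (afterGate r)) (none, none) { s with aux := [], cnt := y.reverse ++ z })
      (y.length + 1) :=
  .transfer (mem := fun y z => { s with aux := y, cnt := z })
    (fun _ _ _ _ => .of_step) (fun _ _ => .of_step) v y z

lemma run_divide_pass (v : Regs) (s : Mem) (y : List Bool) (r : ℕ) :
    RunsIn (cfg (some .divide) v
        { s with yrq := y, cnt := List.replicate (2 * y.length + r) true })
      (cfg (some .restore) (none, none)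
        { s with yrq := [], qry := y.reverse ++ s.qry, cnt := List.replicate r true,
                 acc := false :: s.acc })
      (y.length + 1) := by
  induction y generalizing s v with
  | nil =>
    rw [List.length_nil, mul_zero, zero_add]
    exact .of_step
  | cons a y ih =>
    rw [show 2 * (a :: y).length + r = 2 * y.length + r + 1 + 1 by simp; ring]
    simpa [List.replicate_succ] using
      (ih (some a, some true) { s with qry := a :: s.qry }).step (v := v)
        (s := { s with yrq := a :: y,
                       cnt := true :: true :: List.replicate (2 * y.length + r) true })

lemma run_divide_last (v : Regs) (s : Mem) (y : List Bool) (r : ℕ) (hr : r < 2 * y.length) :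
    RunsIn (cfg (some .divide) v { s with yrq := y, cnt := List.replicate r true })
      (cfg (some (.block false)) (none, none)
        { s with yrq := [], qry := y.reverse ++ s.qry, cnt := [] })
      (y.length + 1) := by
  induction y generalizing s v r with
  | nil => simp at hr
  | cons a y ih =>
    have rewinds := run_rewind false (some a, none) { s with cnt := [] } y (a :: s.qry)
    match r, hr with
    | 0, _ => simpa using rewinds.step (v := v) (s := { s with yrq := a :: y, cnt := [] })
    | 1, _ => simpa using rewinds.step (v := v) (s := { s with yrq := a :: y, cnt := [true] })
    | r + 2, hr =>
      have hr' : r < 2 * y.length := by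
        rw [List.length_cons] at hr
        omega
      simpa [List.replicate_succ] using
        (ih (some a, some true) { s with qry := a :: s.qry } r hr').step (v := v)
          (s := { s with yrq := a :: y, cnt := true :: true :: List.replicate r true })

lemma run_divide (v : Regs) (s : Mem) (y : List Bool) (q r : ℕ) (hr : r < 2 * y.length) :
    RunsIn (cfg (some .divide) v
        { s with yrq := y, qry := [], cnt := List.replicate (2 * y.length * q + r) true })
      (cfg (some (.block false)) (none, none)
        { s with yrq := [], qry := y.reverse, cnt := [],
                 acc := List.replicate q false ++ s.acc })
      ((q + 1) * (2 * y.length + 2)) := by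
  induction q generalizing s v with
  | zero =>
    have last := run_divide_last v { s with qry := [] } y r hr
    simpa using last.mono (by omega : y.length + 1 ≤ 2 * y.length + 2)
  | succ q ih =>
    have pass := run_divide_pass v { s with qry := [] } y (2 * y.length * q + r)
    have restore := run_restore (none, none)
      { s with cnt := List.replicate (2 * y.length * q + r) true, acc := false :: s.acc }
      y.reverse []
    have rest := ih (none, none) { s with acc := false :: s.acc }
    rw [show 2 * y.length * (q + 1) + r = 2 * y.length + (2 * y.length * q + r) by ring]
    simp only [List.append_nil, List.reverse_reverse, List.length_reverse] at pass restore rest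
    rw [List.replicate_succ', List.append_assoc]
    exact ((pass.trans restore).trans rest).mono (by ring_nf; omega)

lemma run_add (c a : Bool) (v : Regs) (s : Mem) (acc l : List Bool) :
    RunsIn (cfg (some (.add c a)) v { s with acc := acc, key := l })
      (cfg (some (.back c)) (none, none)
        { s with acc := [], key := l.drop acc.length,
                 aux := (addBits (a == c) acc l).reverse ++ s.aux })
      (acc.length + 1) := by
  induction acc generalizing s v l with
  | nil => exact .of_step
  | cons w acc ih =>
    simpa [addBits] using
      (ih (some w, l.head?)
        { s with aux := xor w (l.head?.getD false && (a == c)) :: s.aux } l.tail).step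
        (l := .add c a) (v := v) (s := { s with acc := w :: acc, key := l })

lemma run_block (c : Bool) (v : Regs) (s : Mem) (y acc l : List Bool) :
    RunsIn (cfg (some (.block c)) v { s with qry := y, acc := acc, key := l, aux := [] })
      (cfg (some (if c then .emit else .rewind true)) (none, none)
        { s with qry := [], yrq := y.reverse ++ s.yrq, acc := (addBlocks c y acc l).1,
                 key := (addBlocks c y acc l).2, aux := [] })
      (y.length * (2 * acc.length + 3) + 1) := by
  induction y generalizing s v acc l with
  | nil => exact RunsIn.mono .of_step (by simp)
  | cons a y ih =>
    have add := run_add c a (some a, none)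
      { s with qry := y, yrq := a :: s.yrq, aux := [] } acc l
    have back := run_back c (none, none)
      { s with qry := y, yrq := a :: s.yrq, key := l.drop acc.length }
      (addBits (a == c) acc l).reverse []
    have rest := ih (none, none) { s with yrq := a :: s.yrq } (addBits (a == c) acc l)
      (l.drop acc.length)
    simp only [List.append_nil, List.reverse_reverse, List.length_reverse, length_addBits]
      at add back rest
    rw [List.reverse_cons, List.append_assoc]
    refine (((add.trans back).trans rest).step (l := .block c) (v := v)
      (s := { s with qry := a :: y, acc := acc, key := l, aux := [] })).mono ?_
    simp only [List.length_cons]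
    ring_nf
    omega

lemma run_tick (r : Fin 4) (v : Regs) (s : Mem) (y : List Bool) :
    RunsIn (cfg (some (.tick r)) v { s with cnt := y })
      (cfg (some (.untick r)) (none, none)
        { s with cnt := [], aux := y.reverse ++ s.aux,
                 out := List.replicate y.length .tick ++ s.out })
      (y.length + 1) := by
  induction y generalizing s v with
  | nil => exact .of_step
  | cons a y ih =>
    simpa [List.replicate_succ'] using
      (ih (some a, none) { s with aux := a :: s.aux, out := .tick :: s.out }).step
        (v := v) (s := { s with cnt := a :: y })

lemma run_gate (r : Fin 4) (v : Regs) (s : Mem) :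
    RunsIn (cfg (some (.gate r)) v { s with aux := [] })
      (cfg (some (afterGate r)) (none, none)
        { s with aux := [], out := Gate.encode (.T (.data s.cnt.length)) ++ s.out })
      (2 * s.cnt.length + 3) := by
  have tick := run_tick r v { s with aux := [], out := .data :: .t :: s.out } s.cnt
  have untick := run_untick r (none, none)
    { s with out := List.replicate s.cnt.length .tick ++ .data :: .t :: s.out }
    s.cnt.reverse []
  simp only [List.append_nil, List.reverse_reverse, List.length_reverse] at tick untick
  have encode_append : Gate.encode (.T (.data s.cnt.length)) ++ s.out =
      List.replicate s.cnt.length .tick ++ .data :: .t :: s.out := by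
    simp [Gate.encode, Wire.encode]
  rw [encode_append]
  exact ((tick.trans untick).step (v := v) (s := { s with aux := [] })).mono (by omega)

lemma run_gates (v : Regs) (s : Mem) :
    RunsIn (cfg (some (.gate 0)) v { s with aux := [] })
      (cfg (some .nextBit) (none, none)
        { s with aux := [], out :=
          (List.replicate 4 (Gate.T (.data s.cnt.length))).flatMap Gate.encode ++ s.out })
      (4 * (2 * s.cnt.length + 3)) := by
  set e := Gate.encode (.T (.data s.cnt.length)) with he
  have flatMap_append : (List.replicate 4 (Gate.T (.data s.cnt.length))).flatMap Gate.encode ++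
      s.out = e ++ (e ++ (e ++ (e ++ s.out))) := by
    simp [List.replicate_succ, he]
  rw [flatMap_append]
  refine ((((run_gate 0 v s).trans
    (run_gate 1 (none, none) { s with out := e ++ s.out })).trans
    (run_gate 2 (none, none) { s with out := e ++ (e ++ s.out) })).trans
    (run_gate 3 (none, none) { s with out := e ++ (e ++ (e ++ s.out)) })).mono ?_
  dsimp only
  omega

lemma run_emit (v : Regs) (s : Mem) (acc : List Bool) (gs : List Gate)
    (hs : s.out = gs.flatMap Gate.encode) :
    RunsIn (cfg (some .emit) v { s with acc := acc, aux := [] })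
      (cfg (some .clean) (none, none)
        { s with acc := [], aux := [], cnt := List.replicate acc.length true ++ s.cnt,
                 out := (zGates acc s.cnt.length gs).flatMap Gate.encode })
      (acc.length * (8 * (s.cnt.length + acc.length) + 14) + 1) := by
  induction acc generalizing s v gs with
  | nil =>
    rw [zGates, ← hs]
    exact RunsIn.mono .of_step (by simp)
  | cons a acc ih =>
    rw [List.length_cons, List.replicate_succ', List.append_assoc]
    cases a with
    | false =>
      have rest := ih (some false, none) { s with cnt := true :: s.cnt } gs hs
      have next := rest.step (l := .nextBit) (v := (some false, none))
        (s := { s with acc := acc, aux := [] })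
      refine (next.step (v := v) (s := { s with acc := false :: acc, aux := [] })).mono ?_
      simp only [List.length_cons]
      ring_nf
      omega
    | true =>
      set gs' := List.replicate 4 (Gate.T (.data s.cnt.length)) ++ gs with hgs
      have gates := run_gates (some true, none) { s with acc := acc }
      have rest := ih (none, none)
        { s with cnt := true :: s.cnt, out := gs'.flatMap Gate.encode } gs' rfl
      rw [show List.flatMap _ _ ++ s.out = gs'.flatMap Gate.encode by simp [hs, hgs]] at gates
      have next := rest.step (l := .nextBit) (v := (none, none))
        (s := { s with acc := acc, aux := [], out := gs'.flatMap Gate.encode })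
      refine ((gates.trans next).step (v := v)
        (s := { s with acc := true :: acc, aux := [] })).mono ?_
      simp only [List.length_cons]
      ring_nf
      omega

lemma run_clean (v : Regs) (s : Mem) (k x c : List Bool) :
    RunsIn (cfg (some .clean) v { s with key := k, yrq := x, cnt := c })
      (cfg none (none, none) { s with key := [], yrq := [], cnt := [], out := .start :: s.out })
      (k.length + x.length + c.length + 1) := by
  induction k generalizing v with
  | nil =>
    induction x generalizing v with
    | nil =>
      induction c generalizing v with
      | nil => exact RunsIn.mono .of_step (by simp)
      | cons a c ih => exact (ih (some a, none)).step.mono (by simp only [List.length_cons]; omega)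
    | cons a x ih => exact (ih (some a, none)).step.mono (by simp only [List.length_cons]; omega)
  | cons a k ih => exact (ih (some a, none)).step.mono (by simp only [List.length_cons]; omega)

lemma run_load_reverse (k x : List Bool) :
    RunsIn (cfg (some .load) (none, none) { inp := k.map .inl ++ x.map .inr })
      (cfg (some .check) (none, none)
        { key := k, yrq := x.reverse, cnt := List.replicate k.length true })
      (2 * k.length + x.length + 2) := by
  have load := run_load (none, none) {} k x
  have reverse := run_reverse (none, none) { yrq := x.reverse } k.reverse
  simp only [List.append_nil, List.reverse_reverse, List.length_reverse] at load reverse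
  exact (load.trans reverse).mono (by omega)

lemma run_check_divide (k : List Bool) {x : List Bool} (hx : x ≠ []) :
    RunsIn (cfg (some .check) (none, none)
        { key := k, yrq := x.reverse, cnt := List.replicate k.length true })
      (cfg (some (.block false)) (none, none)
        { key := k, qry := x, acc := List.replicate (k.length / (2 * x.length)) false })
      ((k.length / (2 * x.length) + 1) * (2 * x.length + 2) + 1) := by
  obtain ⟨a, y, hay⟩ := List.exists_cons_of_ne_nil (List.reverse_ne_nil_iff.2 hx)
  have hpos : 0 < 2 * x.length := by
    have := List.length_pos_iff.2 hx
    omega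
  have divide := run_divide (some a, none) { key := k } x.reverse (k.length / (2 * x.length))
    (k.length % (2 * x.length)) (by simpa using Nat.mod_lt _ hpos)
  simp only [List.length_reverse, Nat.div_add_mod, List.reverse_reverse, List.append_nil]
    at divide
  rw [hay] at divide ⊢
  exact divide.step

lemma run_blocks (v : Regs) (k x : List Bool) :
    RunsIn (cfg (some (.block false)) v
        { key := k, qry := x, acc := List.replicate (k.length / (2 * x.length)) false })
      (cfg (some .emit) (none, none)
        { key := (maskBits k x).2, yrq := x.reverse, acc := (maskBits k x).1 })
      (2 * (x.length * (2 * (k.length / (2 * x.length)) + 3) + 1) + x.length + 1) := by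
  have zeroBlocks := run_block false v {} x (List.replicate (k.length / (2 * x.length)) false) k
  set r := addBlocks false x (List.replicate (k.length / (2 * x.length)) false) k with hr
  have length_r : r.1.length = k.length / (2 * x.length) := by
    rw [hr, length_addBlocks, List.length_replicate]
  have rewind := run_rewind true (none, none) { acc := r.1, key := r.2 } x.reverse []
  have oneBlocks := run_block true (none, none) {} x r.1 r.2
  simp only [List.append_nil, List.reverse_reverse, List.length_reverse, List.length_replicate,
    length_r, Bool.false_eq_true, if_false, if_true] at zeroBlocks rewind oneBlocks
  exact ((zeroBlocks.trans rewind).trans oneBlocks).mono (by omega)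

lemma run_emit_clean (k x : List Bool) :
    RunsIn (cfg (some .emit) (none, none)
        { key := (maskBits k x).2, yrq := x.reverse, acc := (maskBits k x).1 })
      (cfg none (none, none) { out := (ggmCircuit (k, x)).encode })
      (k.length / (2 * x.length) * (8 * (k.length / (2 * x.length)) + 15) + k.length +
        x.length + 2) := by
  have emit := run_emit (none, none) { key := (maskBits k x).2, yrq := x.reverse }
    (maskBits k x).1 [] rfl
  have clean := run_clean (none, none)
    { out := (zGates (maskBits k x).1 0 []).flatMap Gate.encode }
    (maskBits k x).2 x.reverse (List.replicate (maskBits k x).1.length true)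
  have encode_eq : (ggmCircuit (k, x)).encode =
      .start :: (zGates (maskBits k x).1 0 []).flatMap Gate.encode := by
    simp [ggmCircuit, Circuit.encode]
  simp only [List.append_nil, List.length_nil, zero_add, List.length_reverse,
    List.length_replicate, length_maskBits] at emit clean
  rw [encode_eq]
  refine (emit.trans clean).mono ?_
  have := length_maskBits_snd_le k x
  ring_nf
  omega

lemma run_check_nil (k : List Bool) :
    RunsIn (cfg (some .check) (none, none) { key := k, cnt := List.replicate k.length true })
      (cfg none (none, none) { out := (ggmCircuit (k, [])).encode })
      (2 * k.length + 2) := by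
  have clean := run_clean (none, none) {} k [] (List.replicate k.length true)
  have mask_eq : (maskBits k []).1 = [] :=
    List.length_eq_zero_iff.1 (by rw [length_maskBits, List.length_nil, mul_zero, Nat.div_zero])
  rw [ggmCircuit, mask_eq]
  refine (clean.step (l := .check) (v := (none, none))
    (s := { key := k, cnt := List.replicate k.length true })).mono ?_
  simp only [List.length_nil, List.length_replicate]
  omega

lemma run_machine (k x : List Bool) :
    RunsIn (cfg (some .load) (none, none) { inp := k.map .inl ++ x.map .inr })
      (cfg none (none, none) { out := (ggmCircuit (k, x)).encode })
      (100 * (k.length + x.length + 1) ^ 2) := by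
  rcases eq_or_ne x [] with rfl | hx
  · refine ((run_load_reverse k []).trans (run_check_nil k)).mono ?_
    rw [List.length_nil]
    nlinarith
  · refine ((((run_load_reverse k x).trans (run_check_divide k hx)).trans
      (run_blocks (none, none) k x)).trans (run_emit_clean k x)).mono ?_
    have hmul : 2 * x.length * (k.length / (2 * x.length)) ≤ k.length := Nat.mul_div_le _ _
    have hle : k.length / (2 * x.length) ≤ k.length := Nat.div_le_self _ _
    have hsq := Nat.mul_le_mul hle hle
    nlinarith [Nat.zero_le (k.length * x.length), Nat.zero_le (x.length * x.length)]

lemma initList_machine (l : List (Bool ⊕ Bool)) :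
    Turing.initList machine l = cfg (some .load) (none, none) { inp := l } := by
  refine congrArg (Turing.TM2.Cfg.mk _ _) (funext fun k => ?_)
  cases k <;> rfl

lemma haltList_machine (l : List Sym) :
    Turing.haltList machine l = cfg none (none, none) { out := l } := by
  refine congrArg (Turing.TM2.Cfg.mk _ _) (funext fun k => ?_)
  cases k <;> rfl

def computableInPolyTime :
    Turing.TM2ComputableInPolyTime bitsPairEncoding.encode circuitEncoding.encode ggmCircuit where
  tm := machine
  inputAlphabet := Equiv.refl _
  outputAlphabet := Equiv.refl _
  time := 100 * (Polynomial.X + 1) ^ 2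
  outputsFun p := by
    have h := run_machine p.1 p.2
    rw [← initList_machine, ← haltList_machine] at h
    refine ⟨⟨h.choose, ?_⟩, h.choose_spec.1.trans (le_of_eq ?_)⟩
    · exact (congrArg (fun l => (flip Bind.bind machine.step)^[h.choose] (some l))
        (congrArg (Turing.initList machine) (List.map_id _))).trans (h.choose_spec.2.trans
          (congrArg (fun l => some (Turing.haltList machine l)) (List.map_id _).symm))
    · simp [bitsPairEncoding, encodingProd, encodingList]

end Machine

/-! ### The circuit implements the generator -/

lemma sgn_xor (a b : Bool) : sgn (xor a b) = sgn a * sgn b := by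
  cases a <;> cases b <;> simp

lemma sgn_and (a d : Bool) : sgn (a && d) = if d then sgn a else 1 := by
  cases a <;> cases d <;> simp

lemma sgn_injective : Function.Injective sgn := by
  intro a b h
  cases a <;> cases b <;> first | rfl | (norm_num at h)

lemma getD_drop (l : List Bool) (i j : ℕ) : (l.drop i).getD j false = l.getD (i + j) false := by
  simp [List.getD_eq_getElem?_getD, List.getElem?_drop]

lemma getD_ofFn {n : ℕ} (f : Fin n → Bool) {i : ℕ} (hi : i < n) :
    (List.ofFn f).getD i false = f ⟨i, hi⟩ := by
  simp [List.getD_eq_getElem?_getD, hi]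

lemma getD_addBits (d : Bool) (acc l : List Bool) {j : ℕ} (hj : j < acc.length) :
    (addBits d acc l).getD j false = xor (acc.getD j false) (l.getD j false && d) := by
  induction acc generalizing l j with
  | nil => simp at hj
  | cons v acc ih =>
    rcases j with - | j
    · cases l <;> simp [addBits]
    · rw [addBits, List.getD_cons_succ, List.getD_cons_succ, ih _ (by simpa using hj)]
      cases l <;> simp

lemma addBlocks_snd (c : Bool) (x acc l : List Bool) :
    (addBlocks c x acc l).2 = l.drop (x.length * acc.length) := by
  induction x generalizing acc l with
  | nil => simp [addBlocks]
  | cons a x ih =>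
    rw [addBlocks, ih, length_addBits, List.drop_drop]
    congr 1
    simp only [List.length_cons]
    ring

lemma sgn_addBlocks (c : Bool) (x acc l : List Bool) {j : ℕ} (hj : j < acc.length) :
    sgn ((addBlocks c x acc l).1.getD j false) = sgn (acc.getD j false) *
      ∏ i ∈ Finset.range x.length,
        if x.getD i false = c then sgn (l.getD (i * acc.length + j) false) else 1 := by
  induction x generalizing acc l with
  | nil => simp [addBlocks]
  | cons a x ih =>
    rw [addBlocks, ih _ _ (by rwa [length_addBits]), getD_addBits _ _ _ hj, sgn_xor, sgn_and,
      List.length_cons, Finset.prod_range_succ', mul_assoc]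
    congr 1
    rw [mul_comm]
    simp only [List.getD_cons_zero, List.getD_cons_succ, zero_mul, zero_add, beq_iff_eq,
      length_addBits, getD_drop]
    congr 1
    refine Finset.prod_congr rfl fun i _ => ?_
    rw [show acc.length + (i * acc.length + j) = (i + 1) * acc.length + j by ring]

lemma getD_maskBits {lam m : ℕ} (k : Bits lam) (x : Bits m) (q : Fin (lam / (2 * m))) :
    (maskBits (List.ofFn k) (List.ofFn x)).1.getD q false = ggmMask (keyBlocks m k) x q := by
  apply sgn_injective
  have length_zeros : (List.replicate (lam / (2 * m)) false).length = lam / (2 * m) := by simp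
  have getD_zeros : (List.replicate (lam / (2 * m)) false).getD q false = false := by
    simp [List.getD_eq_getElem?_getD]
  have sgn_mask : sgn (ggmMask (keyBlocks m k) x q) =
      ∏ i, if keyBlocks m k (x i) i q then (-1 : ℝ) else 1 := ite_ggmMask (by norm_num) _ x q
  rw [sgn_mask, maskBits, List.length_ofFn, List.length_ofFn]
  rw [sgn_addBlocks _ _ _ _ (by rw [length_addBlocks, length_zeros]; exact q.2),
    sgn_addBlocks _ _ _ _ (by rw [length_zeros]; exact q.2), addBlocks_snd]
  simp only [List.length_ofFn, length_addBlocks, length_zeros, getD_drop]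
  rw [getD_zeros, sgn_false, one_mul, ← Finset.prod_mul_distrib, Finset.prod_range]
  refine Finset.prod_congr rfl fun i _ => ?_
  rw [getD_ofFn x i.2, Fin.eta, keyBlocks]
  cases hx : x i
  · have index_lt := block_index_lt (lam := lam) false i q
    rw [getD_ofFn k (by simpa using index_lt)]
    simp [sgn]
  · have index_eq : m * (lam / (2 * m)) + (i * (lam / (2 * m)) + q) =
        (true.toNat * m + i) * (lam / (2 * m)) + q := by
      simp only [Bool.toNat_true]
      ring
    rw [index_eq, getD_ofFn k (block_index_lt true i q)]
    simp [sgn]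

lemma mem_zGates {acc : List Bool} {j : ℕ} {gs : List Gate} {g : Gate}
    (hg : g ∈ zGates acc j gs) :
    g ∈ gs ∨ ∃ i < j + acc.length, g = .T (.data i) := by
  induction acc generalizing j gs with
  | nil => exact .inl hg
  | cons v acc ih =>
    rcases ih hg with h | ⟨i, hi, h⟩
    · split_ifs at h
      · rcases List.mem_append.1 h with h | h
        · exact .inr ⟨j, by simp, List.eq_of_mem_replicate h⟩
        · exact .inl h
      · exact .inl h
    · exact .inr ⟨i, by simp only [List.length_cons]; omega, h⟩

/-- The phase that a `T` gate on an input qubit contributes to a basis vector; other gates get the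
junk value `1`. -/
def tPhase {n a : ℕ} (s : Fin n ⊕ Fin a → Bool) : Gate → ℂ
  | .T (.data j) => if h : j < n then
      (if s (.inl ⟨j, h⟩) then Complex.exp (Real.pi / 4 * Complex.I) else 1) else 1
  | _ => 1

lemma onQubit_tGate {W : Type} [Fintype W] [DecidableEq W] (w : W) :
    onQubit w tGate = Matrix.diagonal fun s : W → Bool =>
      if s w then Complex.exp (Real.pi / 4 * Complex.I) else 1 := by
  have factor_eq (v : W) : (if v = w then tGate else 1) = Matrix.diagonal fun a : Bool =>
      if v = w then (if a then Complex.exp (Real.pi / 4 * Complex.I) else 1) else 1 := by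
    split_ifs <;> rfl
  simp only [onQubit, factor_eq, tensorPi_diagonal, Finset.prod_ite_eq', Finset.mem_univ, if_true]

lemma gate_op_eq_diagonal {n a j : ℕ} (hj : j < n) :
    Gate.op n a (.T (.data j)) = Matrix.diagonal fun s => tPhase s (.T (.data j)) := by
  simp [Gate.op, Wire.resolve, hj, onQubit_tGate, tPhase]

lemma gatesOp_eq_diagonal {n a : ℕ} (gs : List Gate)
    (hgs : ∀ g ∈ gs, ∃ j < n, g = .T (.data j)) :
    gatesOp n a gs = Matrix.diagonal fun s => (gs.map (tPhase s)).prod := by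
  suffices foldl_eq : ∀ d : (Fin n ⊕ Fin a → Bool) → ℂ,
      gs.foldl (fun U g => g.op n a * U) (Matrix.diagonal d) =
        Matrix.diagonal fun s => (gs.map (tPhase s)).prod * d s by
    rw [gatesOp, ← Matrix.diagonal_one, foldl_eq]
    simp only [mul_one]
  induction gs with
  | nil => simp
  | cons g gs ih =>
    intro d
    obtain ⟨j, hj, rfl⟩ := hgs g (by simp)
    rw [List.foldl_cons, gate_op_eq_diagonal hj, Matrix.diagonal_mul_diagonal,
      ih fun g hg => hgs g (by simp [hg])]
    congr 1
    ext s
    simp only [List.map_cons, List.prod_cons]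
    ring

lemma tPhase_pow_four {n a j : ℕ} (hj : j < n) (s : Fin n ⊕ Fin a → Bool) :
    tPhase s (.T (.data j)) ^ 4 = (sgn (s (.inl ⟨j, hj⟩)) : ℂ) := by
  simp only [tPhase, hj, dif_pos]
  cases s (.inl ⟨j, hj⟩)
  · simp
  · simp only [if_true, ← Complex.exp_nat_mul, sgn_true]
    rw [show ((4 : ℕ) : ℂ) * (Real.pi / 4 * Complex.I) = Real.pi * Complex.I by push_cast; ring,
      Complex.exp_pi_mul_I]
    simp

lemma prod_tPhase_zGates {n a : ℕ} (s : Fin n ⊕ Fin a → Bool) (acc : List Bool) (j : ℕ)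
    (gs : List Gate) :
    ((zGates acc j gs).map (tPhase s)).prod =
      (∏ i ∈ Finset.range acc.length,
        if acc.getD i false then tPhase s (.T (.data (j + i))) ^ 4 else 1) *
        (gs.map (tPhase s)).prod := by
  induction acc generalizing j gs with
  | nil => simp [zGates]
  | cons v acc ih =>
    rw [zGates, ih, List.length_cons, Finset.prod_range_succ', mul_assoc]
    congr 1
    · refine Finset.prod_congr rfl fun i _ => ?_
      rw [List.getD_cons_succ, show j + 1 + i = j + (i + 1) by ring]
    · cases v
      · simp
      · simp only [List.getD_cons_zero, if_true, add_zero, List.map_append, List.map_replicate,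
          List.prod_append, List.prod_replicate]

section Circuit

variable {lam m n : ℕ} (h : lam / (2 * m) ≤ n) (k : Bits lam) (x : Bits m)
include h

lemma ggmCircuit_gates :
    ∀ g ∈ (ggmCircuit (List.ofFn k, List.ofFn x)).gates, ∃ j < n, g = .T (.data j) := by
  intro g hg
  rcases mem_zGates hg with hg | ⟨j, hj, rfl⟩
  · simp at hg
  · refine ⟨j, ?_, rfl⟩
    rw [length_maskBits, List.length_ofFn, List.length_ofFn] at hj
    omega

lemma ggmCircuit_wellFormed : (ggmCircuit (List.ofFn k, List.ofFn x)).WellFormed n := by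
  intro g hg
  obtain ⟨j, hj, rfl⟩ := ggmCircuit_gates h k x g hg
  simp [Gate.WellFormed, Wire.resolve, hj]

lemma gatesOp_ggmCircuit :
    gatesOp n 0 (ggmCircuit (List.ofFn k, List.ofFn x)).gates =
      Matrix.diagonal fun s => (chi h (ggmMask (keyBlocks m k) x) fun i => s (.inl i) : ℂ) := by
  rw [gatesOp_eq_diagonal _ (ggmCircuit_gates h k x)]
  congr 1
  ext s
  rw [ggmCircuit, prod_tPhase_zGates, length_maskBits]
  simp only [List.length_ofFn, List.map_nil, List.prod_nil, mul_one]
  rw [Finset.prod_range, chi, Complex.ofReal_prod]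
  refine Finset.prod_congr rfl fun q _ => ?_
  rw [getD_maskBits k x q, zero_add, tPhase_pow_four (q.2.trans_le h)]
  split_ifs <;> rfl

lemma run_ggmCircuit (ρ : Op (Bits n)) :
    (ggmCircuit (List.ofFn k, List.ofFn x)).run n ρ = ggmChannel n (keyBlocks m k) x ρ := by
  ext u v
  change traceAncillas (n := n) (a := 0) (gatesOp n 0 _ * withAncillas ρ *
      (gatesOp n 0 _).conjTranspose) u v =
    (zPrefix n (ggmMask (keyBlocks m k) x) * ρ *
      (zPrefix n (ggmMask (keyBlocks m k) x)).conjTranspose) u v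
  rw [gatesOp_ggmCircuit h, zPrefix_eq_diagonal h, traceAncillas, Matrix.of_apply,
    Fintype.sum_subsingleton _ (Fin.elim0 : Bits 0), Matrix.diagonal_conjTranspose,
    Matrix.diagonal_conjTranspose, Matrix.mul_diagonal, Matrix.mul_diagonal, Matrix.diagonal_mul,
    Matrix.diagonal_mul, withAncillas, Matrix.of_apply,
    if_pos ⟨fun j => j.elim0, fun j => j.elim0⟩]
  rfl

end Circuit

/-! ### Channels and acceptance probabilities -/

lemma isChannel_conjBy {ι : Type} [Fintype ι] [DecidableEq ι] {U : Op ι}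
    (hU : U.conjTranspose * U = 1) : IsChannel (conjBy U) := by
  refine ⟨fun ρ => ?_, fun d X hX => ?_⟩
  · change (U * ρ * U.conjTranspose).trace = ρ.trace
    rw [Matrix.trace_mul_comm, ← Matrix.mul_assoc, hU, Matrix.one_mul]
  · convert hX.mul_mul_conjTranspose_same ((1 : Op (Fin d)) ⊗ₖ U)
    ext ⟨p, i⟩ ⟨q, j⟩
    change (U * (Matrix.of fun i j => X (p, i) (q, j)) * U.conjTranspose) i j = _
    simp only [Matrix.mul_apply, Matrix.conjTranspose_apply, Matrix.kronecker_apply,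
      Fintype.sum_prod_type, Matrix.of_apply, Matrix.one_apply]
    rw [Finset.sum_eq_single q (fun a _ ha => by simp [ha.symm]) (by simp)]
    simp

lemma conjTranspose_zPrefix_mul_self {b n : ℕ} (h : b ≤ n) (s : Bits b) :
    (zPrefix n s).conjTranspose * zPrefix n s = 1 := by
  rw [zPrefix_eq_diagonal h, Matrix.diagonal_conjTranspose, Matrix.diagonal_mul_diagonal,
    ← Matrix.diagonal_one]
  congr 1
  ext z
  simp only [Pi.star_apply, Complex.star_def, Complex.conj_ofReal]
  exact_mod_cast chi_mul_self h s z

lemma exists_ggmChannel_ketbra_eq {m b n : ℕ} (h : b ≤ n) (K : BlockKey m b) (y : Bits m)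
    (θ : PureState n) : ∃ θ' : PureState n, ggmChannel n K y (ketbra θ) = ketbra θ' := by
  let sign (z : Bits n) : Circle :=
    ⟨(chi h (ggmMask K y) z : ℂ), mem_sphere_zero_iff_norm.2 (by simp [abs_chi])⟩
  have star_sign (z : Bits n) : star (sign z : ℂ) = sign z := Complex.conj_ofReal _
  refine ⟨rotate (phaseIsometry sign) θ, ?_⟩
  ext u v
  rw [ggmChannel_ketbra_apply h, ketbra_apply, rotate_phaseIsometry_apply,
    rotate_phaseIsometry_apply, star_mul', star_sign, mul_mul_mul_comm]

section AcceptProb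

variable {ι : Type} [Fintype ι]

lemma acceptProb_sub (M ρ σ : Op ι) : acceptProb M (ρ - σ) = acceptProb M ρ - acceptProb M σ := by
  simp [acceptProb, Matrix.mul_sub]

lemma acceptProb_eq_sum (M ρ : Op ι) : acceptProb M ρ = ∑ u, ∑ v, (M u v * ρ v u).re := by
  simp only [acceptProb, Matrix.trace, Matrix.diag_apply, Matrix.mul_apply, Complex.re_sum]

lemma integral_acceptProb {Ω : Type*} [MeasurableSpace Ω] {μ : Measure Ω} (M : Op ι)
    {f : Ω → Op ι} (hf : ∀ u v, Integrable (fun ω => f ω u v) μ) :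
    ∫ ω, acceptProb M (f ω) ∂μ = acceptProb M (Matrix.of fun u v => ∫ ω, f ω u v ∂μ) := by
  have integrable_entry (u v : ι) : Integrable (fun ω => (M u v * f ω v u).re) μ :=
    ((hf v u).const_mul _).re
  simp only [acceptProb_eq_sum, Matrix.of_apply]
  rw [integral_finsetSum _ fun u _ => integrable_finsetSum _ fun v _ => integrable_entry u v]
  refine Finset.sum_congr rfl fun u _ => ?_
  rw [integral_finsetSum _ fun v _ => integrable_entry u v]
  refine Finset.sum_congr rfl fun v _ => ?_
  rw [← integral_const_mul]
  exact integral_re ((hf v u).const_mul _)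

lemma expect_acceptProb {κ : Type*} [Fintype κ] (M : Op ι) (f : κ → Op ι) :
    𝔼 K, acceptProb M (f K) = acceptProb M (Matrix.of fun u v => 𝔼 K, f K u v) := by
  have average_eq : (Matrix.of fun u v => 𝔼 K, f K u v) =
      ((Fintype.card κ : ℝ)⁻¹ : ℂ) • ∑ K, f K := by
    ext u v
    simp [Finset.expect_eq_sum_div_card, Matrix.sum_apply, div_eq_inv_mul]
  rw [average_eq, acceptProb, Matrix.mul_smul, Matrix.trace_smul, Matrix.mul_sum,
    Matrix.trace_sum, smul_eq_mul, ← Complex.ofReal_inv, Complex.re_ofReal_mul, Complex.re_sum,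
    Finset.expect_eq_sum_div_card, div_eq_inv_mul, Finset.card_univ]
  rfl

end AcceptProb

section Probabilities

variable {m n ℓ : ℕ}

@[fun_prop]
lemma continuous_ketbra : Continuous (ketbra : PureState n → Op (Bits n)) :=
  continuous_matrix fun u v => by
    simp only [ketbra_apply]
    fun_prop

lemma integrable_realState (Φ : Bits m → (Op (Bits n) →ₗ[ℂ] Op (Bits n))) (x : Fin ℓ → Bits m)
    (t : ℕ) (u v : (Fin ℓ → Bits n) × (Fin t → Bits n)) :
    Integrable (fun θ => realState Φ x t θ u v) (haar n) := by
  have continuous_Φ (y : Bits m) : Continuous (Φ y) := (Φ y).continuous_of_finiteDimensional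
  refine integrable_of_continuous ?_
  simp only [realState, tensorPi, Matrix.kroneckerMap_apply, Matrix.of_apply]
  fun_prop

lemma integrable_idealState (x : Fin ℓ → Bits m) (t : ℕ)
    (u v : (Fin ℓ → Bits n) × (Fin t → Bits n)) :
    Integrable (fun p => idealState x t p.1 p.2 u v) (haarFamily m n) := by
  have : IsProbabilityMeasure (haarFamily m n) := by
    unfold haarFamily
    infer_instance
  refine integrable_of_continuous ?_
  simp only [idealState, tensorPi, Matrix.kroneckerMap_apply, Matrix.of_apply]
  fun_prop

lemma idealProb_eq_acceptProb (x : Fin ℓ → Bits m) (t : ℕ)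
    (M : Op ((Fin ℓ → Bits n) × (Fin t → Bits n))) :
    idealProb x t M = acceptProb M (idealAverage n x t) :=
  integral_acceptProb M (integrable_idealState x t)

end Probabilities

lemma realProb_eq_acceptProb {m n : ℕ → ℕ} (G : Generator m n) {lam ℓ : ℕ}
    (x : Fin ℓ → Bits (m lam)) (t : ℕ)
    (M : Op ((Fin ℓ → Bits (n lam)) × (Fin t → Bits (n lam)))) :
    realProb G lam x t M = acceptProb M (Matrix.of fun u v =>
      𝔼 k : Bits lam, ∫ θ, realState (G lam k) x t θ u v ∂haar (n lam)) := by
  simp only [realProb, integral_acceptProb M (integrable_realState _ x t), expect_acceptProb,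
    Matrix.of_apply]

/-! ### The generator -/

lemma expect_comp_injective {α β γ E : Type*} [Fintype α] [Fintype β] [Fintype γ] [Nonempty γ]
    [DecidableEq α] [DecidableEq β] [AddCommMonoid E] [Module ℚ≥0 E] {e : α → β}
    (he : Function.Injective e) (F : (α → γ) → E) :
    𝔼 k : β → γ, F (k ∘ e) = 𝔼 K, F K := by
  classical
  let split := (Equiv.piEquivPiSubtypeProd (· ∈ Set.range e) fun _ => γ).trans
    (((Equiv.ofInjective e he).symm.arrowCongr (Equiv.refl γ)).prodCongr (Equiv.refl _))
  calc 𝔼 k : β → γ, F (k ∘ e) = 𝔼 p : (α → γ) × ({y // y ∉ Set.range e} → γ), F p.1 :=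
        Fintype.expect_equiv split _ _ fun k => rfl
    _ = 𝔼 K, F K := by
        rw [← Finset.univ_product_univ, Finset.expect_product]
        simp only [Finset.expect_const Finset.univ_nonempty]

/-- The position in the key of the `j`-th bit of the block `k_i^c`. -/
def blockIndex {lam m : ℕ} (p : Bool × Fin m × Fin (lam / (2 * m))) : Fin lam :=
  ⟨(p.1.toNat * m + p.2.1) * (lam / (2 * m)) + p.2.2, block_index_lt p.1 p.2.1 p.2.2⟩

lemma blockIndex_injective {lam m : ℕ} :
    Function.Injective (blockIndex : Bool × Fin m × Fin (lam / (2 * m)) → Fin lam) := by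
  rintro ⟨c, i, j⟩ ⟨c', i', j'⟩ h
  have hval : (c.toNat * m + i) * (lam / (2 * m)) + j =
      (c'.toNat * m + i') * (lam / (2 * m)) + j' := congrArg Fin.val h
  have hdiv := congrArg (· / (lam / (2 * m))) hval
  have hmod := congrArg (· % (lam / (2 * m))) hval
  simp only [mul_comm _ (lam / (2 * m)), Nat.mul_add_mod, Nat.mod_eq_of_lt j.2,
    Nat.mod_eq_of_lt j'.2] at hmod
  simp only [mul_comm _ (lam / (2 * m)), Nat.mul_add_div j.pos, Nat.div_eq_of_lt j.2,
    Nat.div_eq_of_lt j'.2, add_zero] at hdiv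
  have hj : j = j' := Fin.ext hmod
  have hi := i.2
  have hi' := i'.2
  cases c <;> cases c' <;> simp only [Bool.toNat_true, Bool.toNat_false] at hdiv <;>
    first
    | omega
    | simp only [Prod.mk.injEq, Fin.ext_iff, true_and, hj, and_true]; omega

lemma expect_keyBlocks {lam m : ℕ} {E : Type*} [AddCommMonoid E] [Module ℚ≥0 E]
    (F : BlockKey m (lam / (2 * m)) → E) : 𝔼 k : Bits lam, F (keyBlocks m k) = 𝔼 K, F K := by
  let curryBlocks : (Bool × Fin m × Fin (lam / (2 * m)) → Bool) ≃ BlockKey m (lam / (2 * m)) :=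
    (Equiv.curry _ _ _).trans ((Equiv.refl _).arrowCongr (Equiv.curry _ _ _))
  exact (expect_comp_injective blockIndex_injective fun K => F (curryBlocks K)).trans
    (Fintype.expect_equiv curryBlocks _ _ fun _ => rfl)

/-- The generator of the construction, with the blocks read off from the key. -/
def ggmGenerator (m n : ℕ → ℕ) : Generator m n :=
  fun lam k x => ggmChannel (n lam) (keyBlocks (m lam) k) x

section Generator

variable {m n : ℕ → ℕ}

lemma realProb_ggmGenerator {lam ℓ : ℕ} (x : Fin ℓ → Bits (m lam)) (t : ℕ)
    (M : Op ((Fin ℓ → Bits (n lam)) × (Fin t → Bits (n lam)))) :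
    realProb (ggmGenerator m n) lam x t M =
      acceptProb M (ggmRealAverage (lam / (2 * m lam)) (n lam) x t) := by
  rw [realProb_eq_acceptProb]
  congr 1
  ext u v
  exact expect_keyBlocks fun K => ∫ θ, realState (ggmChannel (n lam) K) x t θ u v ∂haar (n lam)

lemma abs_realProb_sub_idealProb_le {lam ℓ : ℕ} (hm : 1 ≤ m lam) (h : lam / (2 * m lam) ≤ n lam)
    (x : Fin ℓ → Bits (m lam)) (t : ℕ)
    {M : Op ((Fin ℓ → Bits (n lam)) × (Fin t → Bits (n lam)))} (hM : IsEffect M) :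
    |realProb (ggmGenerator m n) lam x t M - idealProb x t M| ≤
      8 * ((ℓ : ℝ) + t) ^ (2 * ℓ) / 2 ^ (lam / (2 * m lam)) := by
  have hermitian : (ggmRealAverage (lam / (2 * m lam)) (n lam) x t -
      idealAverage (n lam) x t).IsHermitian := by
    rw [ggmRealAverage_eq_submatrix h, idealAverage_eq_submatrix]
    exact ((posSemidef_maskedAverage h x t).submatrix _).isHermitian.sub
      ((posSemidef_copiesAverage _).submatrix _).isHermitian
  have traceDist_le := traceDist_ggmRealAverage_idealAverage_le hm h x t
  rw [realProb_ggmGenerator, idealProb_eq_acceptProb, ← acceptProb_sub]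
  calc _ ≤ _ := abs_acceptProb_le_traceNorm hM hermitian
    _ = 2 * traceDist (ggmRealAverage (lam / (2 * m lam)) (n lam) x t)
        (idealAverage (n lam) x t) := by rw [traceDist]; ring
    _ ≤ 2 * (4 * ((ℓ : ℝ) + t) ^ (2 * ℓ) / 2 ^ (lam / (2 * m lam))) := by gcongr
    _ = 8 * ((ℓ : ℝ) + t) ^ (2 * ℓ) / 2 ^ (lam / (2 * m lam)) := by ring

lemma isQPT_ggmGenerator (h : ∀ lam, lam / (2 * m lam) ≤ n lam) : IsQPT (ggmGenerator m n) :=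
  ⟨ggmCircuit, ⟨Machine.computableInPolyTime⟩, fun lam k x =>
    ⟨ggmCircuit_wellFormed (h lam) k x, fun ρ => (run_ggmCircuit (h lam) k x ρ).symm⟩⟩

lemma stateGeneration_ggmGenerator (h : ∀ lam, lam / (2 * m lam) ≤ n lam) :
    StateGeneration (ggmGenerator m n) := fun lam _ x =>
  ⟨isChannel_conjBy (conjTranspose_zPrefix_mul_self (h lam) _),
    fun θ => exists_ggmChannel_ketbra_eq (h lam) _ x θ⟩

end Generator

/-! ### Asymptotics of the parameters -/

section Rounding

variable {X : ℝ} {m : ℕ}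

lemma one_le_of_eq_floor_or_ceil (hX : 1 ≤ X) (hm : m = ⌊X⌋₊ ∨ m = ⌈X⌉₊) : 1 ≤ m := by
  rcases hm with rfl | rfl
  · exact (Nat.one_le_floor_iff _).2 hX
  · exact Nat.one_le_ceil_iff.2 (by linarith)

lemma le_two_mul_of_eq_floor_or_ceil (hX : 1 ≤ X) (hm : m = ⌊X⌋₊ ∨ m = ⌈X⌉₊) : X ≤ 2 * m := by
  have one_le : (1 : ℝ) ≤ m := by exact_mod_cast one_le_of_eq_floor_or_ceil hX hm
  rcases hm with rfl | rfl
  · linarith [Nat.lt_floor_add_one X]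
  · linarith [Nat.le_ceil X]

lemma natCast_le_two_mul_of_eq_floor_or_ceil (hX : 1 ≤ X) (hm : m = ⌊X⌋₊ ∨ m = ⌈X⌉₊) :
    (m : ℝ) ≤ 2 * X := by
  rcases hm with rfl | rfl
  · linarith [Nat.floor_le (zero_le_one.trans hX)]
  · linarith [Nat.ceil_lt_add_one (zero_le_one.trans hX)]

end Rounding

section Parameters

variable {c : ℝ} {lam m : ℕ}

lemma one_le_natCast_rpow (hc : 0 ≤ c) (hlam : 1 ≤ lam) : 1 ≤ (lam : ℝ) ^ c :=
  Real.one_le_rpow (by exact_mod_cast hlam) hc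

lemma natCast_rpow_mul_rpow_one_sub (hlam : 1 ≤ lam) :
    (lam : ℝ) ^ c * (lam : ℝ) ^ (1 - c) = lam := by
  rw [← Real.rpow_add (by exact_mod_cast hlam), add_sub_cancel, Real.rpow_one]

lemma block_length_le (hc : 0 ≤ c) {n : ℕ}
    (hm : m = ⌊(lam : ℝ) ^ c⌋₊ ∨ m = ⌈(lam : ℝ) ^ c⌉₊) (hn : (lam : ℝ) ^ (1 - c) ≤ n) :
    lam / (2 * m) ≤ n := by
  rcases Nat.eq_zero_or_pos lam with rfl | hlam
  · simp
  have lam_le : (lam : ℝ) ≤ 2 * m * n := by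
    rw [← natCast_rpow_mul_rpow_one_sub (c := c) hlam]
    exact mul_le_mul (le_two_mul_of_eq_floor_or_ceil (one_le_natCast_rpow hc hlam) hm) hn
      (by positivity) (by positivity)
  exact Nat.div_le_of_le_mul (by exact_mod_cast lam_le)

lemma rpow_div_four_le_block_length_add_one (hc : 0 ≤ c) (hlam : 1 ≤ lam)
    (hm : m = ⌊(lam : ℝ) ^ c⌋₊ ∨ m = ⌈(lam : ℝ) ^ c⌉₊) :
    (lam : ℝ) ^ (1 - c) / 4 ≤ ((lam / (2 * m) : ℕ) : ℝ) + 1 := by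
  have one_le := one_le_natCast_rpow hc hlam
  have m_pos := one_le_of_eq_floor_or_ceil one_le hm
  have m_le := natCast_le_two_mul_of_eq_floor_or_ceil one_le hm
  rw [div_le_iff₀ four_pos]
  refine le_of_mul_le_mul_left ?_ (zero_lt_one.trans_le one_le)
  calc (lam : ℝ) ^ c * (lam : ℝ) ^ (1 - c) = lam := natCast_rpow_mul_rpow_one_sub hlam
    _ ≤ 2 * m * (((lam / (2 * m) : ℕ) : ℝ) + 1) := by
      exact_mod_cast (Nat.lt_mul_div_succ lam (by omega : 0 < 2 * m)).le
    _ ≤ 2 * (2 * (lam : ℝ) ^ c) * (((lam / (2 * m) : ℕ) : ℝ) + 1) := by gcongr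
    _ = (lam : ℝ) ^ c * ((((lam / (2 * m) : ℕ) : ℝ) + 1) * 4) := by ring

lemma inv_two_pow_block_length_le (hc : 0 ≤ c) (hlam : 1 ≤ lam)
    (hm : m = ⌊(lam : ℝ) ^ c⌋₊ ∨ m = ⌈(lam : ℝ) ^ c⌉₊) :
    ((2 : ℝ) ^ (lam / (2 * m)))⁻¹ ≤ 2 * Real.exp (-(Real.log 2 / 4 * (lam : ℝ) ^ (1 - c))) := by
  have length_ge := rpow_div_four_le_block_length_add_one hc hlam hm
  have log_pos : 0 < Real.log 2 := Real.log_pos one_lt_two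
  have pow_eq_exp (k : ℕ) : (2 : ℝ) ^ k = Real.exp (k * Real.log 2) := by
    rw [Real.exp_nat_mul, Real.exp_log two_pos]
  rw [pow_eq_exp, ← Real.exp_neg]
  nth_rewrite 2 [← Real.exp_log (two_pos : (0 : ℝ) < 2)]
  rw [← Real.exp_add, Real.exp_le_exp]
  nlinarith

end Parameters

lemma eventually_eval_le_pow (p : Polynomial ℕ) :
    ∀ᶠ lam : ℕ in atTop, p.eval lam ≤ lam ^ (p.natDegree + 1) := by
  filter_upwards [eventually_ge_atTop (p.eval 1), eventually_ge_atTop 1] with lam eval_le one_le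
  calc p.eval lam ≤ p.eval 1 * lam ^ p.natDegree := by
        rw [Polynomial.eval_eq_sum_range, Polynomial.eval_eq_sum_range, Finset.sum_mul]
        refine Finset.sum_le_sum fun i hi => ?_
        rw [one_pow, mul_one]
        exact Nat.mul_le_mul_left _
          (Nat.pow_le_pow_right one_le (Nat.le_of_lt_succ (Finset.mem_range.1 hi)))
    _ ≤ lam * lam ^ p.natDegree := Nat.mul_le_mul_right _ eval_le
    _ = lam ^ (p.natDegree + 1) := by ring

lemma PolyBounded.exists_eventually_add_le_pow {t : ℕ → ℕ} (ht : PolyBounded t) :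
    ∃ D : ℕ, 0 < D ∧ ∀ᶠ lam in atTop, lam + t lam ≤ lam ^ D := by
  obtain ⟨p, hp⟩ := ht
  refine ⟨(Polynomial.X + p).natDegree + 1, Nat.succ_pos _,
    (eventually_eval_le_pow (Polynomial.X + p)).mono fun lam h => ?_⟩
  rw [Polynomial.eval_add, Polynomial.eval_X] at h
  exact (Nat.add_le_add_left (hp lam) lam).trans h

lemma tendsto_log_natCast_atTop : Tendsto (fun lam : ℕ => Real.log lam) atTop atTop :=
  Real.tendsto_log_atTop.comp tendsto_natCast_atTop_atTop

lemma isLittleO_mul_log_of_isBigO {a ε : ℝ} (hε : 0 < ε) {f : ℕ → ℝ}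
    (hf : f =O[atTop] fun lam : ℕ => (lam : ℝ) ^ a / Real.log lam ^ (1 + ε)) :
    (fun lam : ℕ => f lam * Real.log lam) =o[atTop] fun lam : ℕ => (lam : ℝ) ^ a := by
  have mul_log_eq : (fun lam : ℕ => (lam : ℝ) ^ a / Real.log lam ^ (1 + ε) * Real.log lam)
      =ᶠ[atTop] fun lam : ℕ => (lam : ℝ) ^ a * Real.log lam ^ (-ε) := by
    filter_upwards [tendsto_log_natCast_atTop.eventually_gt_atTop 0] with lam hlam
    rw [Real.rpow_add hlam, Real.rpow_one, Real.rpow_neg hlam.le]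
    have := (Real.rpow_pos_of_pos hlam ε).ne'
    field_simp
  have log_rpow_neg : (fun lam : ℕ => Real.log lam ^ (-ε)) =o[atTop] fun _ => (1 : ℝ) :=
    (isLittleO_one_iff ℝ).2 ((tendsto_rpow_neg_atTop hε).comp tendsto_log_natCast_atTop)
  refine ((hf.mul (isBigO_refl (fun lam : ℕ => Real.log lam) atTop)).congr' .rfl
    mul_log_eq).trans_isLittleO ?_
  simpa using (isBigO_refl (fun lam : ℕ => (lam : ℝ) ^ a) atTop).mul_isLittleO log_rpow_neg

lemma eventually_le_natCast_of_isLittleO {a : ℝ} (ha : a ≤ 1) {f : ℕ → ℝ}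
    (hf : (fun lam : ℕ => f lam * Real.log lam) =o[atTop] fun lam : ℕ => (lam : ℝ) ^ a) :
    ∀ᶠ lam : ℕ in atTop, f lam ≤ lam := by
  filter_upwards [hf.bound one_pos, tendsto_log_natCast_atTop.eventually_ge_atTop 1,
    eventually_ge_atTop 1] with lam bound one_le_log one_le
  calc f lam ≤ ‖f lam‖ := le_abs_self _
    _ ≤ ‖f lam‖ * ‖Real.log lam‖ :=
      le_mul_of_one_le_right (norm_nonneg _) (one_le_log.trans (le_abs_self _))
    _ ≤ (lam : ℝ) ^ a := by
      rwa [norm_mul, one_mul, Real.norm_of_nonneg (by positivity : 0 ≤ (lam : ℝ) ^ a)] at bound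
    _ ≤ lam := by
      simpa using Real.rpow_le_rpow_of_exponent_le (by exact_mod_cast one_le : (1 : ℝ) ≤ lam) ha

lemma eventually_add_pow_le_exp {a : ℝ} (ha : a ≤ 1) {ℓ t : ℕ → ℕ}
    (hℓ : (fun lam : ℕ => ℓ lam * Real.log lam) =o[atTop] fun lam : ℕ => (lam : ℝ) ^ a)
    (ht : PolyBounded t) {δ : ℝ} (hδ : 0 < δ) :
    ∀ᶠ lam : ℕ in atTop, ((ℓ lam : ℝ) + t lam) ^ (2 * ℓ lam) ≤ Real.exp (δ * (lam : ℝ) ^ a) := by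
  obtain ⟨D, D_pos, hD⟩ := ht.exists_eventually_add_le_pow
  have D_pos' : (0 : ℝ) < 2 * D := by positivity
  filter_upwards [hD, hℓ.bound (div_pos hδ D_pos'), eventually_le_natCast_of_isLittleO ha hℓ,
    eventually_gt_atTop 0] with lam add_le bound queries_le lam_pos
  have lam_pos' : (0 : ℝ) < lam := by exact_mod_cast lam_pos
  have base_le : (ℓ lam : ℝ) + t lam ≤ (lam : ℝ) ^ D := by
    have : (lam : ℝ) + t lam ≤ (lam : ℝ) ^ D := by exact_mod_cast add_le
    linarith
  have exponent_le : ℓ lam * Real.log lam ≤ δ / (2 * D) * (lam : ℝ) ^ a := by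
    rw [Real.norm_of_nonneg (by positivity : 0 ≤ (lam : ℝ) ^ a)] at bound
    exact (le_abs_self _).trans bound
  calc ((ℓ lam : ℝ) + t lam) ^ (2 * ℓ lam) ≤ ((lam : ℝ) ^ D) ^ (2 * ℓ lam) := by gcongr
    _ = Real.exp (2 * D * (ℓ lam * Real.log lam)) := by
      rw [← pow_mul, ← Real.exp_log (pow_pos lam_pos' (D * (2 * ℓ lam))), Real.log_pow]
      push_cast
      ring_nf
    _ ≤ Real.exp (2 * D * (δ / (2 * D) * (lam : ℝ) ^ a)) := by gcongr
    _ = Real.exp (δ * (lam : ℝ) ^ a) := by rw [← mul_assoc, mul_div_cancel₀ _ D_pos'.ne']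

lemma negligible_exp_neg_rpow {a δ : ℝ} (ha : 0 < a) (hδ : 0 < δ) :
    Negligible fun lam : ℕ => Real.exp (-(δ * (lam : ℝ) ^ a)) := by
  intro k
  refine ((tendsto_rpow_mul_exp_neg_mul_atTop_nhds_zero (k / a) δ hδ).comp
    ((tendsto_rpow_atTop ha).comp tendsto_natCast_atTop_atTop)).congr fun lam => ?_
  simp only [Function.comp_apply]
  rw [← Real.rpow_mul (Nat.cast_nonneg lam), mul_div_cancel₀ _ ha.ne', Real.rpow_natCast, neg_mul]

lemma selectivelySecure_ggmGenerator {c ε : ℝ} (hc : 0 ≤ c) (hc1 : c < 1) (hε : 0 < ε)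
    {m n ℓ : ℕ → ℕ}
    (hm : ∀ lam : ℕ, m lam = ⌊(lam : ℝ) ^ c⌋₊ ∨ m lam = ⌈(lam : ℝ) ^ c⌉₊)
    (hn : ∀ lam : ℕ, (lam : ℝ) ^ (1 - c) ≤ n lam)
    (hℓ : (fun lam : ℕ => (ℓ lam : ℝ)) =O[atTop]
      (fun lam : ℕ => (lam : ℝ) ^ (1 - c) / Real.log lam ^ (1 + ε))) :
    SelectivelySecure ℓ (ggmGenerator m n) := by
  intro t ht A hA x
  refine ⟨_, ?_, fun lam => le_rfl⟩
  have rate_pos : 0 < Real.log 2 / 8 := div_pos (Real.log_pos one_lt_two) (by norm_num)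
  refine ((negligible_exp_neg_rpow (sub_pos.2 hc1) rate_pos).const_mul 16).trans_eventually_abs_le
    ?_
  filter_upwards [eventually_add_pow_le_exp (by linarith) (isLittleO_mul_log_of_isBigO hε hℓ) ht
    rate_pos, eventually_ge_atTop 1] with lam pow_le_exp hlam
  have m_pos := one_le_of_eq_floor_or_ceil (one_le_natCast_rpow hc hlam) (hm lam)
  have inv_le := inv_two_pow_block_length_le hc hlam (hm lam)
  simp only [Function.comp_apply, abs_abs]
  refine le_trans ?_ (le_abs_self _)
  calc |realProb (ggmGenerator m n) lam (x lam) (t lam) (A lam (x lam)) -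
        idealProb (x lam) (t lam) (A lam (x lam))|
      ≤ 8 * ((ℓ lam : ℝ) + t lam) ^ (2 * ℓ lam) / 2 ^ (lam / (2 * m lam)) :=
        abs_realProb_sub_idealProb_le m_pos (block_length_le hc (hm lam) (hn lam)) (x lam) (t lam)
          (hA lam (x lam))
    _ ≤ 8 * Real.exp (Real.log 2 / 8 * (lam : ℝ) ^ (1 - c)) *
          (2 * Real.exp (-(Real.log 2 / 4 * (lam : ℝ) ^ (1 - c)))) := by
        rw [div_eq_mul_inv]
        gcongr
    _ = 16 * Real.exp (-(Real.log 2 / 8 * (lam : ℝ) ^ (1 - c))) := by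
        rw [mul_mul_mul_comm, ← Real.exp_add]
        ring_nf

end CHS

end

open CHS in
theorem mainTheorem2 :
    (∃ C : ℝ, 0 < C ∧ ∀ m b n ℓ t : ℕ, 1 ≤ m → b ≤ n → ∀ x : Fin ℓ → Bits m,
      traceDist (ggmRealAverage b n x t) (idealAverage n x t) ≤
        C * ((ℓ : ℝ) + t) ^ (2 * ℓ) / 2 ^ b) ∧
    ∀ c : ℝ, 0 ≤ c → c < 1 → ∀ m n : ℕ → ℕ,
      (∀ lam : ℕ, m lam = ⌊(lam : ℝ) ^ c⌋₊ ∨ m lam = ⌈(lam : ℝ) ^ c⌉₊) →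
      (∀ lam : ℕ, (lam : ℝ) ^ (1 - c) ≤ n lam) →
      ∃ G : Generator m n,
        (∀ (lam : ℕ) (k : Bits lam) (x : Bits (m lam)),
          lam / (2 * m lam) ≤ n lam ∧
          G lam k x = ggmChannel (n lam) (keyBlocks (m lam) k) x) ∧
        ∀ ε : ℝ, 0 < ε → ∀ ℓ : ℕ → ℕ,
          (fun lam : ℕ => (ℓ lam : ℝ)) =O[atTop]
            (fun lam : ℕ => (lam : ℝ) ^ (1 - c) / Real.log lam ^ (1 + ε)) →
          IsStatisticalPRFS m n ℓ G := by
  refine ⟨⟨4, by norm_num, fun m b n ℓ t hm h x =>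
    traceDist_ggmRealAverage_idealAverage_le hm h x t⟩, fun c hc hc1 m n hm hn => ?_⟩
  have h (lam : ℕ) : lam / (2 * m lam) ≤ n lam := block_length_le hc (hm lam) (hn lam)
  exact ⟨ggmGenerator m n, fun lam _ _ => ⟨h lam, rfl⟩, fun ε hε ℓ hℓ =>
    ⟨isQPT_ggmGenerator h, stateGeneration_ggmGenerator h,
      selectivelySecure_ggmGenerator hc hc1 hε hm hn hℓ⟩⟩
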